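/- Let $\mathcal D$ be a triangulated category, $\Lambda$ a free abelian group of finite rank, and $v\colon K(\mathcal D)\twoheadrightarrow\Lambda$ a surjective homomorphism from the Grothendieck group of $\mathcal D$. Put $\Lambda_{\mathbb R}=\Lambda\otimes\mathbb R$. A pre-stability condition on $\mathcal D$ is a pair $\sigma=(Z,\mathcal P)$ of a homomorphism $Z\colon\Lambda\to\mathbb C$ (the central charge) and a family of strictly full subcategories $\mathcal P(\phi)\subset\mathcal D$, $\phi\in\mathbb R$, containing the zero objects, such that: (i) $\mathcal P(\phi+1)=\mathcal P(\phi)[1]$; (ii) $\mathrm{Hom}(\mathcal P(\phi_1),\mathcal P(\phi_2))=0$ for $\phi_1>\phi_2$; (iii) $Z(v(E))\in\mathbb R_{>0}\,e^{i\pi\phi}$ for $0\ne E\in\mathcal P(\phi)$; (iv) every object $E$ has a Harder–Narasimhan filtration $0=E_0\to E_1\to\dots\to E_m=E$ in which the cone of $E_{i-1}\to E_i$ is a nonzero object $A_i\in\mathcal P(\phi_i)$ and $\phi_1>\dots>\phi_m$. The objects of the $\mathcal P(\phi)$ are called $\sigma$-semistable. For $E\neq0$ write $\phi^+_\sigma(E)=\phi_1$,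 $\phi^-_\sigma(E)=\phi_m$ and $m_\sigma(E)=\sum_i|Z(v(A_i))|$. The pre-stability condition $\sigma$ satisfies the support property with respect to a real quadratic form $Q$ on $\Lambda_{\mathbb R}$ if $Q$ is negative definite on the kernel of the $\mathbb R$-linear extension $\Lambda_{\mathbb R}\to\mathbb C$ of $Z$, and $Q(v(E))\ge0$ for every $\sigma$-semistable object $E$. Let $\mathrm{Stab}_\Lambda(\mathcal D)$ be the set of pre-stability conditions that satisfy the support property with respect to some $Q$, with the topology of the generalized metric $$d(\sigma_1,\sigma_2)=\sup_{0\ne E\in\mathcal D}\max\left\{|\phi^-_{\sigma_2}(E)-\phi^-_{\sigma_1}(E)|,\ |\phi^+_{\sigma_2}(E)-\phi^+_{\sigma_1}(E)|,\ |\log m_{\sigma_2}(E)-\log m_{\sigma_1}(E)|\right\}\in[0,\infty],$$ and let $\mathcal Z\colon\mathrm{Stab}_\Lambda(\mathcal D)\to\mathrm{Hom}(\Lambda,\mathbb C)$, $(Z,\mathcal P)\mapsto Z$. **Proposition.** Assume that $\sigma=(Z,\mathcal P)\in\mathrm{Stab}_\Lambda(\mathcal D)$ satisfies the support property with respect to a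 quadratic form $Q$ on $\Lambda_{\mathbb R}$. The set of central charges in $\mathrm{Hom}(\Lambda,\mathbb C)$ whose kernel (in $\Lambda_{\mathbb R}$) is negative definite with respect to $Q$ is open; let $U$ be its connected component containing $Z$, and let $\mathcal U\subset\mathrm{Stab}_\Lambda(\mathcal D)$ be the connected component of $\mathcal Z^{-1}(U)$ containing $\sigma$. Then: 1. the restriction $\mathcal Z|_{\mathcal U}\colon\mathcal U\to U$ is a (surjective) covering map; 2. every $\sigma'\in\mathcal U$ satisfies the support property with respect to the same quadratic form $Q$. -/

import Mathlib

open CategoryTheory CategoryTheory.Limits CategoryTheory.Pretriangulated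
open scoped TensorProduct ENNReal

noncomputable section

namespace BridgelandStab

universe w u

section Grothendieck

variable (D : Type u) [Category.{w} D] [HasZeroObject D] [HasShift D ℤ] [Preadditive D]
  [∀ n : ℤ, (shiftFunctor D n).Additive] [Pretriangulated D]

/-- The subgroup generated by the elements `[Y] - [X] - [Z]`, one for each distinguished
triangle `X ⟶ Y ⟶ Z ⟶ X⟦1⟧`. -/
def triangleRelations : AddSubgroup (FreeAbelianGroup D) :=
  AddSubgroup.closure
    {x | ∃ T ∈ distTriang D, x = FreeAbelianGroup.of T.obj₂ - FreeAbelianGroup.of T.obj₁ -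
      FreeAbelianGroup.of T.obj₃}

/-- The Grothendieck group `K(D)` of a triangulated category. -/
abbrev K₀ : Type u := FreeAbelianGroup D ⧸ triangleRelations D

variable {D}

/-- The class `[E]` of an object in the Grothendieck group. -/
def K₀.of (E : D) : K₀ D := QuotientAddGroup.mk (FreeAbelianGroup.of E)

/-- A Harder-Narasimhan filtration
`0 = E_0 ⟶ E_1 ⟶ ⋯ ⟶ E_n = E` of `E` with respect to a family `P` of full subcategories: the cone
of `E_i ⟶ E_(i+1)` is a nonzero object `factor i` of `P (phase i)`, and the phases
strictly decrease. -/
structure HNFiltration (P : ℝ → ObjectProperty D) (E : D) where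
  n : ℕ
  obj : Fin (n + 1) → D
  factor : Fin n → D
  phase : Fin n → ℝ
  ι : ∀ i : Fin n, obj i.castSucc ⟶ obj i.succ
  π : ∀ i : Fin n, obj i.succ ⟶ factor i
  δ : ∀ i : Fin n, factor i ⟶ (obj i.castSucc)⟦(1 : ℤ)⟧
  isZero_bot : IsZero (obj 0)
  top : obj (Fin.last n) ≅ E
  distinguished : ∀ i : Fin n, Triangle.mk (ι i) (π i) (δ i) ∈ distTriang D
  factor_mem : ∀ i : Fin n, P (phase i) (factor i)
  factor_ne_zero : ∀ i : Fin n, ¬ IsZero (factor i)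
  phase_strictAnti : StrictAnti phase

theorem HNFiltration.n_pos {P : ℝ → ObjectProperty D} {E : D} (F : HNFiltration P E)
    (hE : ¬ IsZero E) : 0 < F.n := by
  rcases F with ⟨n, obj, factor, phase, ι, π, δ, h0, top, h1, h2, h3, h4⟩
  rcases Nat.eq_zero_or_pos n with h | h
  · subst h
    exact absurd (h0.of_iso top.symm) hE
  · exact h

end Grothendieck

section Charges

variable {Λ : Type*} [AddCommGroup Λ]

/-- The topology on `Hom(Λ, ℂ)` is that of pointwise convergence; for `Λ` of finite rank this is
the usual topology of a finite-dimensional complex vector space. -/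
instance chargeTopology : TopologicalSpace (Λ →ₗ[ℤ] ℂ) :=
  TopologicalSpace.induced (fun Z (x : Λ) => Z x) inferInstance

/-- The kernel, in `Λ_ℝ = ℝ ⊗ Λ`, of the `ℝ`-linear extension of `Z` is negative definite with
respect to `Q`. -/
def KerNegDef (Q : QuadraticForm ℝ (ℝ ⊗[ℤ] Λ)) (Z : Λ →ₗ[ℤ] ℂ) : Prop :=
  ∀ x : ℝ ⊗[ℤ] Λ, Z.liftBaseChange ℝ x = 0 → x ≠ 0 → Q x < 0

/-- The set of central charges whose kernel is negative definite with respect to `Q`. -/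
def negDefCharges (Q : QuadraticForm ℝ (ℝ ⊗[ℤ] Λ)) : Set (Λ →ₗ[ℤ] ℂ) := {Z | KerNegDef Q Z}

end Charges

section Stab

variable {D : Type u} [Category.{w} D] [HasZeroObject D] [HasShift D ℤ] [Preadditive D]
  [∀ n : ℤ, (shiftFunctor D n).Additive] [Pretriangulated D]
  {Λ : Type*} [AddCommGroup Λ]

/-- A pre-stability condition `(Z, P)` with respect to `v : K(D) → Λ`. The subcategories `P φ` are
strictly full and contain the zero objects; closure under finite direct sums
follows from the remaining axioms. -/
structure PreStabilityCondition (v : K₀ D →+ Λ) where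
  Z : Λ →ₗ[ℤ] ℂ
  P : ℝ → ObjectProperty D
  iso_closed : ∀ (φ : ℝ) {E F : D}, (E ≅ F) → P φ E → P φ F
  zero_mem : ∀ (φ : ℝ) {E : D}, IsZero E → P φ E
  shift_iff : ∀ (φ : ℝ) (E : D), P (φ + 1) (E⟦(1 : ℤ)⟧) ↔ P φ E
  hom_eq_zero : ∀ {φ₁ φ₂ : ℝ}, φ₂ < φ₁ → ∀ {E F : D}, P φ₁ E → P φ₂ F → ∀ f : E ⟶ F, f = 0
  charge_mem_ray : ∀ {φ : ℝ} {E : D}, P φ E → ¬ IsZero E →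
    ∃ r : ℝ, 0 < r ∧ Z (v (K₀.of E)) = r * Complex.exp (Complex.I * Real.pi * φ)
  exists_hn : ∀ E : D, Nonempty (HNFiltration P E)

namespace PreStabilityCondition

variable {v : K₀ D →+ Λ}

/-- An object is semistable if it lies in some `P φ`. -/
def IsSemistable (σ : PreStabilityCondition v) (E : D) : Prop := ∃ φ : ℝ, σ.P φ E

/-- The support property with respect to a given quadratic form `Q` on `Λ_ℝ`. -/
def SupportProperty (σ : PreStabilityCondition v) (Q : QuadraticForm ℝ (ℝ ⊗[ℤ] Λ)) : Prop :=
  KerNegDef Q σ.Z ∧ ∀ E : D, σ.IsSemistable E → 0 ≤ Q ((1 : ℝ) ⊗ₜ[ℤ] v (K₀.of E))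

/-- A Harder-Narasimhan filtration of `E`; it is unique up to isomorphism, so that the
phases and the mass below do not depend on the choice. -/
def hn (σ : PreStabilityCondition v) (E : D) : HNFiltration σ.P E :=
  Classical.choice (σ.exists_hn E)

/-- The maximal phase `φ⁺(E)` in the Harder-Narasimhan filtration of `E ≠ 0`. -/
def phiPlus (σ : PreStabilityCondition v) (E : {E : D // ¬ IsZero E}) : ℝ :=
  (σ.hn E.1).phase ⟨0, (σ.hn E.1).n_pos E.2⟩

/-- The minimal phase `φ⁻(E)` in the Harder-Narasimhan filtration of `E ≠ 0`. -/
def phiMinus (σ : PreStabilityCondition v) (E : {E : D // ¬ IsZero E}) : ℝ :=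
  (σ.hn E.1).phase ⟨(σ.hn E.1).n - 1, Nat.sub_lt ((σ.hn E.1).n_pos E.2) Nat.one_pos⟩

/-- The mass `m(E) = ∑ |Z(A_i)|`, over the Harder-Narasimhan factors `A_i` of `E`. -/
def mass (σ : PreStabilityCondition v) (E : D) : ℝ :=
  ∑ i, ‖σ.Z (v (K₀.of ((σ.hn E).factor i)))‖

end PreStabilityCondition

/-- `Stab_Λ(D)`: pre-stability conditions that satisfy the support property. -/
structure StabilityCondition (v : K₀ D →+ Λ) extends PreStabilityCondition v where
  support : ∃ Q : QuadraticForm ℝ (ℝ ⊗[ℤ] Λ), toPreStabilityCondition.SupportProperty Q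

namespace StabilityCondition

variable {v : K₀ D →+ Λ}

/-- Bridgeland's generalized metric on `Stab_Λ(D)`: the supremum over `E ≠ 0` of
`|φ⁻(E) - φ'⁻(E)|`, `|φ⁺(E) - φ'⁺(E)|` and `|log m(E) - log m'(E)|`. -/
def stabEDist (σ τ : StabilityCondition v) : ℝ≥0∞ :=
  ⨆ E : {E : D // ¬ IsZero E},
    max (edist (σ.phiMinus E) (τ.phiMinus E))
      (max (edist (σ.phiPlus E) (τ.phiPlus E))
        (edist (Real.log (σ.mass E.1)) (Real.log (τ.mass E.1))))

/-- `Stab_Λ(D)` carries the topology of the generalized metric. -/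
instance : PseudoEMetricSpace (StabilityCondition v) where
  edist := stabEDist
  edist_self σ := by
    simp [stabEDist]
  edist_comm σ τ := by
    simp only [stabEDist, edist_comm]
  edist_triangle σ τ ρ := by
    refine iSup_le fun E => ?_
    have h1 := le_iSup (fun E : {E : D // ¬ IsZero E} =>
      max (edist (σ.phiMinus E) (τ.phiMinus E))
      (max (edist (σ.phiPlus E) (τ.phiPlus E))
        (edist (Real.log (σ.mass E.1)) (Real.log (τ.mass E.1))))) E
    have h2 := le_iSup (fun E : {E : D // ¬ IsZero E} =>
      max (edist (τ.phiMinus E) (ρ.phiMinus E))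
      (max (edist (τ.phiPlus E) (ρ.phiPlus E))
        (edist (Real.log (τ.mass E.1)) (Real.log (ρ.mass E.1))))) E
    simp only [max_le_iff] at h1 h2
    refine max_le ?_ (max_le ?_ ?_)
    · exact (edist_triangle _ _ _).trans (add_le_add h1.1 h2.1)
    · exact (edist_triangle _ _ _).trans (add_le_add h1.2.1 h2.2.1)
    · exact (edist_triangle _ _ _).trans (add_le_add h1.2.2 h2.2.2)

/-- The forgetful map `(Z, P) ↦ Z`. -/
def charge (σ : StabilityCondition v) : Λ →ₗ[ℤ] ℂ := σ.Z

/-- The connected component, containing the central charge of `σ`, of the set of central charges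
whose kernel is negative definite with respect to `Q`. -/
def chargeComponent (σ : StabilityCondition v) (Q : QuadraticForm ℝ (ℝ ⊗[ℤ] Λ)) :
    Set (Λ →ₗ[ℤ] ℂ) :=
  connectedComponentIn (negDefCharges Q) σ.charge

/-- The connected component, containing `σ`, of the preimage in `Stab_Λ(D)` of
`σ.chargeComponent Q`. -/
def stabComponent (σ : StabilityCondition v) (Q : QuadraticForm ℝ (ℝ ⊗[ℤ] Λ)) :
    Set (StabilityCondition v) :=
  connectedComponentIn (charge ⁻¹' σ.chargeComponent Q) σ

theorem mapsTo_charge (σ : StabilityCondition v) (Q : QuadraticForm ℝ (ℝ ⊗[ℤ] Λ)) :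
    Set.MapsTo charge (σ.stabComponent Q) (σ.chargeComponent Q) :=
  fun _ h => connectedComponentIn_subset (charge ⁻¹' σ.chargeComponent Q) σ h

end StabilityCondition

end Stab

end BridgelandStab

end

/-! The central charge is deformed one real component at a time. Fix a lattice norm `N`. The support
property gives N(v(E)) ≤ C|Z(E)| for semistable E, hence N(v(E)) ≤ C·m(E) for every E by summing
over Harder–Narasimhan factors. A nearby charge is reached from Z in two moves, the first keeping
the imaginary part and the second the real part. As long as the component `imRot α` is kept, the
hearts of phases (α+n, α+n+1] can be kept too, and the new semistable objects are the
slope-semistable objects of these hearts for the new charge (`slopeP`).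

Harder–Narasimhan filtrations for the new slope come from a finiteness statement: in a fixed heart,
the subobjects of E whose new charge has bounded real part have only finitely many classes
(`finite_subClasses`). In a heart with phases (β, β+1], the mass minus the real part of the charge
(rotated by β) is π times the integral over θ of the height of the Harder–Narasimhan polygon in
direction θ (`integral_height`). The polygon of E lies above that of a subobject
(`imRot_le_of_tri`), so the mass of a subobject is bounded through its real part, and then so is
`N`. The same integral compares the masses of E before and after the deformation (`massList_le`),
and planar estimates bound the change of phases (`gt_of_slopeP`, `le_of_slopeP`). Hence the deformed
condition is close to the original one in the generalized metric.

The form Q survives by wall-crossing (`quadratic_nonneg`). An object semistable at time t but not at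
time 0 becomes, at some wall s ≤ t, an extension of two semistable objects of the same phase
(`exists_wall`). Both are smaller, so induction gives Q ≥ 0 for them. Vectors with Q ≥ 0 and charge
on a common ray form a convex cone, because Q is negative definite on the kernel
(`KerNegDef.add_nonneg`).

All constants depend only on Q and on a box around a charge, so every condition supported by Q with
charge in the box deforms over the whole box, with uniform control of distance (`exists_deform`).
Two conditions at distance at most 1/8 with the same charge are equal (`eq_of_edist_le`), and the
charge is continuous (`continuous_charge`). The rest is point-set topology (`UniformLifting`): the
locus supported by Q is open and closed over the negative definite charges, so it contains the
component of σ, and the unique nearby lifts are the local sections that trivialize the covering. -/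

open CategoryTheory CategoryTheory.Limits CategoryTheory.Pretriangulated
open scoped TensorProduct ENNReal ZeroObject

set_option linter.unusedSectionVars false

noncomputable section

namespace BridgelandStab

universe w u

/-! ### Distinguished triangles up to their morphisms, and consequences of the octahedral axiom. -/

section Triangles

variable {D : Type u} [Category.{w} D] [HasZeroObject D] [HasShift D ℤ] [Preadditive D]
  [∀ n : ℤ, (shiftFunctor D n).Additive] [Pretriangulated D]

/-- There is a distinguished triangle `A ⟶ E ⟶ B ⟶ A⟦1⟧`. -/
def Tri (A E B : D) : Prop :=
  ∃ (f : A ⟶ E) (g : E ⟶ B) (h : B ⟶ A⟦(1 : ℤ)⟧), Triangle.mk f g h ∈ distTriang D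

theorem K₀.of_eq_add_of_tri {A E B : D} (h : Tri A E B) :
    K₀.of E = K₀.of A + K₀.of B := by
  obtain ⟨f, g, k, hT⟩ := h
  have : FreeAbelianGroup.of E - FreeAbelianGroup.of A - FreeAbelianGroup.of B ∈
      triangleRelations D := AddSubgroup.subset_closure ⟨_, hT, rfl⟩
  have h2 := (QuotientAddGroup.eq_zero_iff _).2 this
  rw [QuotientAddGroup.mk_sub, QuotientAddGroup.mk_sub, sub_sub, sub_eq_zero] at h2
  exact h2

theorem Tri.rotate {A E B : D} (h : Tri A E B) : Tri E B (A⟦(1 : ℤ)⟧) := by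
  obtain ⟨f, g, k, hT⟩ := h
  exact ⟨_, _, _, rot_of_distTriang _ hT⟩

theorem Tri.invRotate {A E B : D} (h : Tri A E B) : Tri (B⟦(-1 : ℤ)⟧) A E := by
  obtain ⟨f, g, k, hT⟩ := h
  exact ⟨_, _, _, inv_rot_of_distTriang _ hT⟩

theorem Tri.shift {A E B : D} (h : Tri A E B) (n : ℤ) : Tri (A⟦n⟧) (E⟦n⟧) (B⟦n⟧) := by
  obtain ⟨f, g, k, hT⟩ := h
  exact ⟨_, _, _, Triangle.shift_distinguished _ hT n⟩

theorem Tri.of_iso {A E B A' E' B' : D} (h : Tri A E B) (a : A' ≅ A) (e : E' ≅ E) (b : B' ≅ B) :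
    Tri A' E' B' := by
  obtain ⟨f, g, k, hT⟩ := h
  refine ⟨a.hom ≫ f ≫ e.inv, e.hom ≫ g ≫ b.inv, b.hom ≫ k ≫ (a.inv)⟦(1 : ℤ)⟧', ?_⟩
  refine isomorphic_distinguished _ hT _ (Triangle.isoMk _ _ a e b ?_ ?_ ?_)
  · change (a.hom ≫ f ≫ e.inv) ≫ e.hom = a.hom ≫ f
    simp only [Category.assoc, Iso.inv_hom_id, Category.comp_id]
  · change (e.hom ≫ g ≫ b.inv) ≫ b.hom = e.hom ≫ g
    simp only [Category.assoc, Iso.inv_hom_id, Category.comp_id]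
  · change (b.hom ≫ k ≫ (shiftFunctor D (1 : ℤ)).map a.inv) ≫
      (shiftFunctor D (1 : ℤ)).map a.hom = b.hom ≫ k
    simp only [Category.assoc, ← Functor.map_comp, Iso.inv_hom_id, CategoryTheory.Functor.map_id,
      Category.comp_id]

theorem Tri.of_shift {A E B : D} {n : ℤ} (h : Tri (A⟦n⟧) (E⟦n⟧) (B⟦n⟧)) : Tri A E B :=
  (h.shift (-n)).of_iso (shiftShiftNeg A n).symm (shiftShiftNeg E n).symm (shiftShiftNeg B n).symm

theorem tri_of_isZero_right {A E Y : D} (e : A ≅ E) (hY : IsZero Y) : Tri A E Y := by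
  have h : Tri A A (0 : D) := ⟨_, _, _, contractible_distinguished A⟩
  exact h.of_iso (Iso.refl _) e.symm (hY.iso (isZero_zero D))

theorem tri_of_isZero_left {X E B : D} (e : E ≅ B) (hX : IsZero X) : Tri X E B := by
  have h : Tri (0 : D) B B := ⟨_, _, _, contractible_distinguished₁ B⟩
  exact h.of_iso (hX.iso (isZero_zero D)) e (Iso.refl _)

theorem Tri.nonempty_iso_right {X E B : D} (h : Tri X E B) (hX : IsZero X) : Nonempty (E ≅ B) := by
  obtain ⟨f, g, k, hT⟩ := h
  have : IsIso g := ((Triangle.mk f g k).isZero₁_iff_isIso₂ hT).1 hX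
  exact ⟨asIso g⟩

theorem Tri.nonempty_iso_left {A E Y : D} (h : Tri A E Y) (hY : IsZero Y) : Nonempty (A ≅ E) := by
  obtain ⟨f, g, k, hT⟩ := h
  have : IsIso f := ((Triangle.mk f g k).isZero₃_iff_isIso₁ hT).1 hY
  exact ⟨asIso f⟩

theorem K₀.of_isZero {X : D} (hX : IsZero X) : K₀.of X = 0 := by
  have := K₀.of_eq_add_of_tri (tri_of_isZero_left (Iso.refl X) hX)
  simpa using this

theorem K₀.of_iso {A B : D} (e : A ≅ B) : K₀.of A = K₀.of B := by
  have := K₀.of_eq_add_of_tri (tri_of_isZero_right e (isZero_zero D))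
  rw [K₀.of_isZero (isZero_zero D)] at this
  simpa using this.symm

theorem isZero_shift_iff {A : D} {n : ℤ} : IsZero (A⟦n⟧) ↔ IsZero A := by
  constructor
  · intro h
    exact (Functor.map_isZero (shiftFunctor D (-n)) h).of_iso (shiftShiftNeg A n).symm
  · intro h
    exact Functor.map_isZero (shiftFunctor D n) h

theorem K₀.of_shift (A : D) : K₀.of (A⟦(1 : ℤ)⟧) = -K₀.of A := by
  have h : Tri A (0 : D) (A⟦(1 : ℤ)⟧) :=
    (tri_of_isZero_right (Iso.refl A) (isZero_zero D)).rotate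
  have := K₀.of_eq_add_of_tri h
  rw [K₀.of_isZero (isZero_zero D)] at this
  exact (neg_eq_of_add_eq_zero_right this.symm).symm

variable [IsTriangulated D]

/-- If `g ≫ x = f`, the cones of the three morphisms form a distinguished triangle. -/
theorem exists_tri_of_comp {S X E S' Y : D} {f : S ⟶ E} {f' : E ⟶ S'} {f'' : S' ⟶ S⟦(1 : ℤ)⟧}
    (hf : Triangle.mk f f' f'' ∈ distTriang D)
    {x : X ⟶ E} {x' : E ⟶ Y} {x'' : Y ⟶ X⟦(1 : ℤ)⟧} (hx : Triangle.mk x x' x'' ∈ distTriang D)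
    (g : S ⟶ X) (hg : g ≫ x = f) : ∃ R, Tri S X R ∧ Tri R S' Y := by
  obtain ⟨R, g', g'', hT⟩ := distinguished_cocone_triangle g
  exact ⟨R, ⟨_, _, _, hT⟩, _, _, _, (Triangulated.someOctahedron hg hT hx hf).mem⟩

/-- A subobject of a subobject is a subobject. -/
theorem Tri.comp {A' A C E B : D} (h₁ : Tri A' A C) (h₂ : Tri A E B) :
    ∃ X, Tri A' E X ∧ Tri C X B := by
  obtain ⟨f, f', f'', hf⟩ := h₁
  obtain ⟨g, g', g'', hg⟩ := h₂
  obtain ⟨X, k, k', hk⟩ := distinguished_cocone_triangle (f ≫ g)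
  exact ⟨X, ⟨_, _, _, hk⟩, _, _, _, (Triangulated.someOctahedron rfl hf hg hk).mem⟩

/-- If `g : E ⟶ B` and `b : B ⟶ B''` have fibres `A` and `B'`, the fibre of `g ≫ b` is an
extension of `B'` by `A`. -/
theorem exists_tri_fiber_comp {A E B B' B'' : D} {f : A ⟶ E} {g : E ⟶ B} {h : B ⟶ A⟦(1 : ℤ)⟧}
    (h₁ : Triangle.mk f g h ∈ distTriang D) {b' : B' ⟶ B} {b : B ⟶ B''}
    {b'' : B'' ⟶ B'⟦(1 : ℤ)⟧} (h₂ : Triangle.mk b' b b'' ∈ distTriang D) :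
    ∃ (E' : D) (i : E' ⟶ E) (j : B'' ⟶ E'⟦(1 : ℤ)⟧), Tri A E' B' ∧
      Triangle.mk i (g ≫ b) j ∈ distTriang D := by
  obtain ⟨E', i, j, hT⟩ := distinguished_cocone_triangle₁ (g ≫ b)
  refine ⟨E', i, j, ?_, hT⟩
  -- All three triangles are rotated, so the octahedron produces the wanted triangle shifted by one.
  have h3 := (Triangulated.someOctahedron rfl (rot_of_distTriang _ h₁) (rot_of_distTriang _ h₂)
    (rot_of_distTriang _ hT)).mem
  exact Tri.of_shift (n := 1) ⟨_, _, _, h3⟩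

/-- Preimage of a subobject of a quotient. -/
theorem Tri.pullback {A E B B' B'' : D} (h₁ : Tri A E B) (h₂ : Tri B' B B'') :
    ∃ E', Tri A E' B' ∧ Tri E' E B'' := by
  obtain ⟨f, g, h, h₁⟩ := h₁
  obtain ⟨b', b, b'', h₂⟩ := h₂
  obtain ⟨E', i, j, h3, h4⟩ := exists_tri_fiber_comp h₁ h₂
  exact ⟨E', h3, _, _, _, h4⟩

end Triangles

/-! ### Harder–Narasimhan filtrations as inductive chains. -/

section Chains

variable {D : Type u} [Category.{w} D] [HasZeroObject D] [HasShift D ℤ] [Preadditive D]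
  [∀ n : ℤ, (shiftFunctor D n).Additive] [Pretriangulated D]

theorem exists_lift {A Y B E : D} {a : A ⟶ Y} {b : Y ⟶ B} {c : B ⟶ A⟦(1 : ℤ)⟧}
    (hT : Triangle.mk a b c ∈ distTriang D) (f : E ⟶ Y) (hf : f ≫ b = 0) :
    ∃ g : E ⟶ A, g ≫ a = f := by
  obtain ⟨g, hg⟩ := Triangle.coyoneda_exact₂ _ hT f hf
  exact ⟨g, hg.symm⟩

theorem exists_desc {A Y B E : D} {a : A ⟶ Y} {b : Y ⟶ B} {c : B ⟶ A⟦(1 : ℤ)⟧}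
    (hT : Triangle.mk a b c ∈ distTriang D) (f : Y ⟶ E) (hf : a ≫ f = 0) :
    ∃ g : B ⟶ E, b ≫ g = f := by
  obtain ⟨g, hg⟩ := Triangle.yoneda_exact₂ _ hT f hf
  exact ⟨g, hg.symm⟩

theorem Tri.hom_to_mid_eq_zero {A Y B E : D} (h : Tri A Y B) (hA : ∀ f : E ⟶ A, f = 0)
    (hB : ∀ f : E ⟶ B, f = 0) (f : E ⟶ Y) : f = 0 := by
  obtain ⟨a, b, c, hT⟩ := h
  obtain ⟨g, rfl⟩ := exists_lift hT f (hB _)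
  rw [hA g, zero_comp]

theorem Tri.hom_from_mid_eq_zero {A Y B E : D} (h : Tri A Y B) (hA : ∀ f : A ⟶ E, f = 0)
    (hB : ∀ f : B ⟶ E, f = 0) (f : Y ⟶ E) : f = 0 := by
  obtain ⟨a, b, c, hT⟩ := h
  obtain ⟨g, rfl⟩ := exists_desc hT f (hA _)
  rw [hB g, comp_zero]

/-- A Harder-Narasimhan filtration recorded by the list of its phases and factors, the last
factor first. -/
inductive HNChain (P : ℝ → ObjectProperty D) : List (ℝ × D) → D → Prop
  | nil {E : D} : IsZero E → HNChain P [] E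
  | cons {E' E A : D} {φ : ℝ} {l : List (ℝ × D)} : HNChain P l E' → Tri E' E A → P φ A →
      ¬ IsZero A → (∀ p ∈ l, φ < p.1) → HNChain P ((φ, A) :: l) E

namespace HNChain

variable {P : ℝ → ObjectProperty D}

theorem of_iso {l : List (ℝ × D)} {E F : D} (h : HNChain P l E) (e : E ≅ F) : HNChain P l F := by
  cases h with
  | nil h => exact .nil (h.of_iso e.symm)
  | cons h t hA hA' hl => exact .cons h (t.of_iso (Iso.refl _) e.symm (Iso.refl _)) hA hA' hl

theorem mem {l : List (ℝ × D)} {E : D} (h : HNChain P l E) : ∀ p ∈ l, P p.1 p.2 := by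
  induction h with
  | nil h => simp
  | cons h t hA hA' hl ih => simpa using ⟨hA, fun a b h => ih (a, b) h⟩

theorem ne_zero {l : List (ℝ × D)} {E : D} (h : HNChain P l E) : ∀ p ∈ l, ¬ IsZero p.2 := by
  induction h with
  | nil h => simp
  | cons h t hA hA' hl ih => simpa using ⟨hA', fun a b h => ih (a, b) h⟩

theorem K₀_of_eq_sum {l : List (ℝ × D)} {E : D} (h : HNChain P l E) :
    K₀.of E = (l.map fun p => K₀.of p.2).sum := by
  induction h with
  | nil h => simpa using K₀.of_isZero h
  | cons h t hA hA' hl ih => simp [K₀.of_eq_add_of_tri t, ih, add_comm]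

theorem isZero_of_nil {E : D} (h : HNChain P [] E) : IsZero E := by
  cases h with
  | nil h => exact h

/-- Induction over extension-closed properties. -/
theorem ext_induction {l : List (ℝ × D)} {E : D} (h : HNChain P l E) (q : D → Prop)
    (h0 : ∀ E, IsZero E → q E) (hext : ∀ A E B, Tri A E B → q A → q B → q E)
    (hl : ∀ p ∈ l, q p.2) : q E := by
  induction h with
  | nil h => exact h0 _ h
  | cons h t hA hA' hl' ih =>
    exact hext _ _ _ t (ih fun p hp => hl p (List.mem_cons_of_mem _ hp))
      (hl _ List.mem_cons_self)

/-- Phases increase away from the head of the list, so a chain can be cut at any level `a`: the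
stage containing all factors of phase above `a` is `X`, and the octahedral axiom (`Tri.comp`)
rebuilds the remaining factors on its cone. -/
theorem exists_tri_filter [IsTriangulated D] {l : List (ℝ × D)} {E : D} (h : HNChain P l E)
    (a : ℝ) : ∃ X Y, Tri X E Y ∧ HNChain P (l.filter fun p => a < p.1) X ∧
      HNChain P (l.filter fun p => p.1 ≤ a) Y := by
  induction h with
  | @nil E h =>
    exact ⟨E, E, tri_of_isZero_right (Iso.refl _) h, by simpa using .nil h, by simpa using .nil h⟩
  | @cons E' E A φ l h t hA hA' hl ih =>
    by_cases hφ : a < φ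
    · refine ⟨E, 0, tri_of_isZero_right (Iso.refl _) (isZero_zero D), ?_, ?_⟩
      · rw [List.filter_eq_self.2]
        · exact .cons h t hA hA' hl
        · intro p hp
          rcases List.mem_cons.1 hp with rfl | hp
          · simpa using hφ
          · simpa using hφ.trans (hl p hp)
      · rw [List.filter_eq_nil_iff.2]
        · exact .nil (isZero_zero D)
        · intro p hp
          rcases List.mem_cons.1 hp with rfl | hp
          · simpa using hφ
          · simpa using hφ.trans (hl p hp)
    · obtain ⟨X, Y', hT, hX, hY'⟩ := ih
      obtain ⟨Y, hY, hY2⟩ := hT.comp t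
      refine ⟨X, Y, hY, ?_, ?_⟩
      · rw [List.filter_cons_of_neg (by simpa using hφ)]
        exact hX
      · rw [List.filter_cons_of_pos (by simpa using hφ)]
        exact .cons hY' hY2 hA hA' fun p hp => hl p (List.mem_of_mem_filter hp)

/-- The chain of `Y` is pulled back along `E ⟶ Y` one factor at a time, starting from `X`; the
condition on phases keeps the concatenated list strictly ordered. -/
theorem append [IsTriangulated D] {l₁ l₂ : List (ℝ × D)} {X E Y : D} (h₁ : HNChain P l₁ X)
    (h₂ : HNChain P l₂ Y) (t : Tri X E Y) (hl : ∀ p ∈ l₁, ∀ q ∈ l₂, q.1 < p.1) :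
    HNChain P (l₂ ++ l₁) E := by
  induction h₂ generalizing E with
  | nil h =>
    obtain ⟨e⟩ := t.nonempty_iso_left h
    exact h₁.of_iso e
  | @cons Y' Y A φ l h t' hA hA' hl' ih =>
    obtain ⟨E', hE', hE''⟩ := t.pullback t'
    refine .cons (ih hE' fun p hp q hq => hl p hp q (List.mem_cons_of_mem _ hq)) hE'' hA hA' ?_
    intro p hp
    rcases List.mem_append.1 hp with hp | hp
    · exact hl' p hp
    · exact hl p hp _ List.mem_cons_self

theorem of_fin (n : ℕ) (obj : Fin (n + 1) → D) (factor : Fin n → D) (phase : Fin n → ℝ)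
    (h0 : IsZero (obj 0)) (ht : ∀ i : Fin n, Tri (obj i.castSucc) (obj i.succ) (factor i))
    (hP : ∀ i, P (phase i) (factor i)) (hne : ∀ i, ¬ IsZero (factor i)) (hs : StrictAnti phase) :
    HNChain P (List.ofFn fun i => (phase i, factor i)).reverse (obj (Fin.last n)) := by
  induction n with
  | zero => simpa using .nil h0
  | succ n ih =>
    rw [List.ofFn_succ_last, List.reverse_append]
    refine .cons (ih (fun i => obj i.castSucc) (fun i => factor i.castSucc)
      (fun i => phase i.castSucc) h0 (fun i => ht i.castSucc) (fun i => hP _) (fun i => hne _)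
      (fun i j hij => hs hij)) (ht (Fin.last n)) (hP _) (hne _) ?_
    intro p hp
    obtain ⟨i, rfl⟩ := List.mem_ofFn.1 (List.mem_reverse.1 hp)
    exact hs (Fin.castSucc_lt_last i)

/-- Indexing by ℕ, with irrelevant values past `n`, lets the induction append a last factor without
casts between `Fin` types. -/
theorem exists_nat {l : List (ℝ × D)} {E : D} (h : HNChain P l E) :
    ∃ (n : ℕ) (o fac : ℕ → D) (ph : ℕ → ℝ), IsZero (o 0) ∧ Nonempty (o n ≅ E) ∧
      (∀ i < n, Tri (o i) (o (i + 1)) (fac i)) ∧ (∀ i < n, P (ph i) (fac i)) ∧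
      (∀ i < n, ¬ IsZero (fac i)) ∧ (∀ i j, i < j → j < n → ph j < ph i) ∧
      (∀ i < n, (ph i, fac i) ∈ l) := by
  induction h with
  | @nil E h => exact ⟨0, fun _ => E, fun _ => E, fun _ => 0, h, ⟨Iso.refl _⟩, by simp⟩
  | @cons E' E A φ l h t hA hA' hl ih =>
    obtain ⟨n, o, fac, ph, h0, ⟨e⟩, h1, h2, h3, h4, h5⟩ := ih
    refine ⟨n + 1, fun i => if i ≤ n then o i else E, fun i => if i < n then fac i else A,
      fun i => if i < n then ph i else φ, by simpa using h0, ⟨by simpa using Iso.refl _⟩,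
      ?_, ?_, ?_, ?_, ?_⟩
    · intro i hi
      rcases Nat.lt_succ_iff_lt_or_eq.1 hi with hi | rfl
      · simpa [hi, hi.le, Nat.succ_le_of_lt hi] using h1 i hi
      · simpa using t.of_iso e (Iso.refl _) (Iso.refl _)
    · intro i hi
      rcases Nat.lt_succ_iff_lt_or_eq.1 hi with hi | rfl
      · simpa [hi] using h2 i hi
      · simpa using hA
    · intro i hi
      rcases Nat.lt_succ_iff_lt_or_eq.1 hi with hi | rfl
      · simpa [hi] using h3 i hi
      · simpa using hA'
    · intro i j hij hj
      rcases Nat.lt_succ_iff_lt_or_eq.1 hj with hj | rfl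
      · simpa [hj, hij.trans hj] using h4 i j hij hj
      · simpa [hij] using hl _ (h5 i hij)
    · intro i hi
      rcases Nat.lt_succ_iff_lt_or_eq.1 hi with hi | rfl
      · simpa [hi] using Or.inr (h5 i hi)
      · simp

theorem nonempty_hnFiltration {l : List (ℝ × D)} {E : D} (h : HNChain P l E) :
    Nonempty (HNFiltration P E) := by
  obtain ⟨n, o, fac, ph, h0, ⟨e⟩, h1, h2, h3, h4, -⟩ := h.exists_nat
  choose f g k hT using fun i : Fin n => h1 i i.2
  exact ⟨⟨n, fun i => o i, fun i => fac i, fun i => ph i, f, g, k, h0, e, hT,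
    fun i => h2 i i.2, fun i => h3 i i.2, fun i j hij => h4 i j hij j.2⟩⟩

end HNChain

/-- The list of phases and factors of a Harder-Narasimhan filtration, the last factor first. -/
def HNFiltration.list {P : ℝ → ObjectProperty D} {E : D} (F : HNFiltration P E) :
    List (ℝ × D) :=
  (List.ofFn fun i => (F.phase i, F.factor i)).reverse

theorem HNFiltration.chain {P : ℝ → ObjectProperty D} {E : D} (F : HNFiltration P E) :
    HNChain P F.list E :=
  (HNChain.of_fin F.n F.obj F.factor F.phase F.isZero_bot
    (fun i => ⟨_, _, _, F.distinguished i⟩) F.factor_mem F.factor_ne_zero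
    F.phase_strictAnti).of_iso F.top

end Chains

/-! ### Truncations of a slicing, and the phases read off from them. -/

section Slicing

variable {D : Type u} [Category.{w} D] [HasZeroObject D] [HasShift D ℤ] [Preadditive D]
  [∀ n : ℤ, (shiftFunctor D n).Additive] [Pretriangulated D]
  {Λ : Type*} [AddCommGroup Λ] {v : K₀ D →+ Λ}

namespace PreStabilityCondition

/-- The objects all of whose phases are greater than `a`. -/
def GT (σ : PreStabilityCondition v) (a : ℝ) (E : D) : Prop :=
  ∀ φ ≤ a, ∀ F, σ.P φ F → ∀ f : E ⟶ F, f = 0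

/-- The objects all of whose phases are at most `a`. -/
def LE (σ : PreStabilityCondition v) (a : ℝ) (E : D) : Prop :=
  ∀ φ, a < φ → ∀ F, σ.P φ F → ∀ f : F ⟶ E, f = 0

variable (σ : PreStabilityCondition v)

theorem exists_chain (E : D) : ∃ l, HNChain σ.P l E := ⟨_, (σ.hn E).chain⟩

variable {σ}

theorem GT.of_isZero {a : ℝ} {E : D} (h : IsZero E) : σ.GT a E :=
  fun _ _ _ _ f => h.eq_of_src f 0

theorem LE.of_isZero {a : ℝ} {E : D} (h : IsZero E) : σ.LE a E :=
  fun _ _ _ _ f => h.eq_of_tgt f 0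

theorem GT.anti {a b : ℝ} {E : D} (h : σ.GT a E) (hab : b ≤ a) : σ.GT b E :=
  fun φ hφ => h φ (hφ.trans hab)

theorem LE.mono {a b : ℝ} {E : D} (h : σ.LE a E) (hab : a ≤ b) : σ.LE b E :=
  fun φ hφ => h φ (hab.trans_lt hφ)

theorem GT.of_mem {a φ : ℝ} {E : D} (h : σ.P φ E) (hφ : a < φ) : σ.GT a E :=
  fun _ hψ _ hF f => σ.hom_eq_zero (hψ.trans_lt hφ) h hF f

theorem LE.of_mem {a φ : ℝ} {E : D} (h : σ.P φ E) (hφ : φ ≤ a) : σ.LE a E :=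
  fun _ hψ _ hF f => σ.hom_eq_zero (hφ.trans_lt hψ) hF h f

/-- Since `GT` and `LE` are defined by vanishing of morphisms to or from semistable objects, closure
under extensions is exactness of Hom. -/
theorem GT.ext {a : ℝ} {A E B : D} (t : Tri A E B) (hA : σ.GT a A) (hB : σ.GT a B) : σ.GT a E :=
  fun φ hφ F hF => t.hom_from_mid_eq_zero (hA φ hφ F hF) (hB φ hφ F hF)

theorem LE.ext {a : ℝ} {A E B : D} (t : Tri A E B) (hA : σ.LE a A) (hB : σ.LE a B) : σ.LE a E :=
  fun φ hφ F hF => t.hom_to_mid_eq_zero (hA φ hφ F hF) (hB φ hφ F hF)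

theorem GT.of_iso {a : ℝ} {E F : D} (h : σ.GT a E) (e : E ≅ F) : σ.GT a F :=
  GT.ext (tri_of_isZero_right e (isZero_zero D)) h (.of_isZero (isZero_zero D))

theorem LE.of_iso {a : ℝ} {E F : D} (h : σ.LE a E) (e : E ≅ F) : σ.LE a F :=
  LE.ext (tri_of_isZero_right e (isZero_zero D)) h (.of_isZero (isZero_zero D))

theorem GT.of_chain {a : ℝ} {E : D} {l : List (ℝ × D)} (h : HNChain σ.P l E)
    (hl : ∀ p ∈ l, a < p.1) : σ.GT a E :=
  h.ext_induction _ (fun _ => .of_isZero) (fun _ _ _ => .ext)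
    fun p hp => .of_mem (h.mem p hp) (hl p hp)

theorem LE.of_chain {a : ℝ} {E : D} {l : List (ℝ × D)} (h : HNChain σ.P l E)
    (hl : ∀ p ∈ l, p.1 ≤ a) : σ.LE a E :=
  h.ext_induction _ (fun _ => .of_isZero) (fun _ _ _ => .ext)
    fun p hp => .of_mem (h.mem p hp) (hl p hp)

theorem P_neg_shift {φ : ℝ} {E : D} (h : σ.P φ E) : σ.P (φ - 1) (E⟦(-1 : ℤ)⟧) := by
  rw [← σ.shift_iff, sub_add_cancel]
  exact σ.iso_closed φ (shiftNegShift E (1 : ℤ)).symm h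

theorem gt_shift_iff {a : ℝ} {E : D} : σ.GT (a + 1) (E⟦(1 : ℤ)⟧) ↔ σ.GT a E := by
  constructor
  · intro h φ hφ F hF f
    have := h (φ + 1) (by linarith) _ ((σ.shift_iff φ F).2 hF) ((shiftFunctor D (1 : ℤ)).map f)
    exact (shiftFunctor D (1 : ℤ)).map_injective (by simpa using this)
  · intro h φ hφ F hF f
    have e := shiftNegShift F (1 : ℤ)
    obtain ⟨g, hg⟩ := (shiftFunctor D (1 : ℤ)).map_surjective (f ≫ e.inv)
    rw [h (φ - 1) (by linarith) _ (P_neg_shift hF) g, Functor.map_zero] at hg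
    rw [← cancel_mono e.inv, ← hg, zero_comp]

theorem le_shift_iff {a : ℝ} {E : D} : σ.LE (a + 1) (E⟦(1 : ℤ)⟧) ↔ σ.LE a E := by
  constructor
  · intro h φ hφ F hF f
    have := h (φ + 1) (by linarith) _ ((σ.shift_iff φ F).2 hF) ((shiftFunctor D (1 : ℤ)).map f)
    exact (shiftFunctor D (1 : ℤ)).map_injective (by simpa using this)
  · intro h φ hφ F hF f
    have e := shiftNegShift F (1 : ℤ)
    obtain ⟨g, hg⟩ := (shiftFunctor D (1 : ℤ)).map_surjective (e.hom ≫ f)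
    rw [h (φ - 1) (by linarith) _ (P_neg_shift hF) g, Functor.map_zero] at hg
    rw [← cancel_epi e.hom, ← hg, comp_zero]

theorem gt_neg_shift {a : ℝ} {E : D} (h : σ.GT a E) : σ.GT (a - 1) (E⟦(-1 : ℤ)⟧) := by
  rw [← gt_shift_iff, sub_add_cancel]
  exact h.of_iso (shiftNegShift E (1 : ℤ)).symm

theorem le_neg_shift {a : ℝ} {E : D} (h : σ.LE a E) : σ.LE (a - 1) (E⟦(-1 : ℤ)⟧) := by
  rw [← le_shift_iff, sub_add_cancel]
  exact h.of_iso (shiftNegShift E (1 : ℤ)).symm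

/-- Subobjects of objects in `LE b`. -/
theorem LE.left {b : ℝ} {X E Y : D} (t : Tri X E Y) (hE : σ.LE b E) (hY : σ.LE (b + 1) Y) :
    σ.LE b X :=
  LE.ext t.invRotate (by simpa using le_neg_shift hY) hE

/-- Quotients of objects in `GT a`. -/
theorem GT.right {a : ℝ} {X E Y : D} (t : Tri X E Y) (hE : σ.GT a E) (hX : σ.GT (a - 1) X) :
    σ.GT a Y :=
  GT.ext t.rotate hE (by simpa using gt_shift_iff.2 hX)

variable [IsTriangulated D]

theorem exists_trunc (σ : PreStabilityCondition v) (a : ℝ) (E : D) :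
    ∃ X Y, Tri X E Y ∧ σ.GT a X ∧ σ.LE a Y := by
  obtain ⟨l, hl⟩ := σ.exists_chain E
  obtain ⟨X, Y, hT, hX, hY⟩ := hl.exists_tri_filter a
  exact ⟨X, Y, hT, .of_chain hX (by simp), .of_chain hY (by simp)⟩

/-- Cut `F` at `a` into `X ⟶ F ⟶ Y`. Morphisms from `E` to the factors of `Y` vanish, so `f` lifts
to `X`; morphisms from the factors of `X` to `F` vanish, so the composite is zero. -/
theorem GT.hom_eq_zero {a : ℝ} {E F : D} (hE : σ.GT a E) (hF : σ.LE a F) (f : E ⟶ F) :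
    f = 0 := by
  obtain ⟨l, hl⟩ := σ.exists_chain F
  obtain ⟨X, Y, hT, hX, hY⟩ := hl.exists_tri_filter a
  have h2 : ∀ g : E ⟶ Y, g = 0 := by
    refine hY.ext_induction (fun Y => ∀ g : E ⟶ Y, g = 0) (fun Z hZ g => hZ.eq_of_tgt _ _)
      (fun A B C t hA hC => t.hom_to_mid_eq_zero hA hC) fun p hp => ?_
    exact hE p.1 (by simpa using (List.mem_filter.1 hp).2) _ (hY.mem p hp)
  have h1 : ∀ g : X ⟶ F, g = 0 := by
    refine hX.ext_induction (fun X => ∀ g : X ⟶ F, g = 0) (fun Z hZ g => hZ.eq_of_src _ _)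
      (fun A B C t hA hC => t.hom_from_mid_eq_zero hA hC) fun p hp => ?_
    exact hF p.1 (by simpa using (List.mem_filter.1 hp).2) _ (hX.mem p hp)
  obtain ⟨x, y, z, hT⟩ := hT
  obtain ⟨g, rfl⟩ := exists_lift hT f (h2 _)
  rw [h1 x, comp_zero]

theorem GT.isZero {a : ℝ} {E : D} (h : σ.GT a E) (h' : σ.LE a E) : IsZero E :=
  (IsZero.iff_id_eq_zero E).2 (h.hom_eq_zero h' _)

/-- Together with `GT.hom_eq_zero` this says that `GT a` and `LE a` are orthogonal complements, so
an inclusion between the `LE` parts of two slicings yields the reverse inclusion between the `GT`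
parts. -/
theorem GT.of_hom {a : ℝ} {E : D} (h : ∀ F, σ.LE a F → ∀ f : E ⟶ F, f = 0) : σ.GT a E :=
  fun _ hφ F hF f => h F (.of_mem hF hφ) f

theorem LE.of_hom {a : ℝ} {E : D} (h : ∀ F, σ.GT a F → ∀ f : F ⟶ E, f = 0) : σ.LE a E :=
  fun _ hφ F hF f => h F (.of_mem hF hφ) f

end PreStabilityCondition

/-- If `E = 0`, the last factor `A` is a shift of `E'`, whose phases exceed `φ`; this places `A` in
`GT φ`, against its being in `P φ`. -/
theorem HNChain.eq_nil_of_isZero [IsTriangulated D] {σ : PreStabilityCondition v}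
    {l : List (ℝ × D)} {E : D} (h : HNChain σ.P l E) (hE : IsZero E) : l = [] := by
  cases h with
  | nil h => rfl
  | @cons E' E A φ l h t hA hA' hl =>
    refine absurd ?_ hA'
    have h1 : σ.GT φ E' := .of_chain h hl
    exact (PreStabilityCondition.GT.right t (.of_isZero hE) (h1.anti (by linarith))).isZero
      (.of_mem hA le_rfl)

/-- The part of the chain above `b` is a truncation lying in both `GT b` and `LE b`, hence zero.
This reads the extreme phases off any chain, independently of its choice. -/
theorem HNChain.le_iff [IsTriangulated D] {σ : PreStabilityCondition v}
    {l : List (ℝ × D)} {E : D} (h : HNChain σ.P l E) {b : ℝ} :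
    σ.LE b E ↔ ∀ p ∈ l, p.1 ≤ b := by
  refine ⟨fun hE p hp => ?_, .of_chain h⟩
  obtain ⟨X, Y, hT, hX, hY⟩ := h.exists_tri_filter b
  have hY' : σ.LE b Y := .of_chain hY (by simp)
  have hX' : σ.GT b X := .of_chain hX (by simp)
  have := hX.eq_nil_of_isZero (hX'.isZero (.left hT hE (hY'.mono (by linarith))))
  simpa using List.filter_eq_nil_iff.1 this p hp

theorem HNChain.gt_iff [IsTriangulated D] {σ : PreStabilityCondition v}
    {l : List (ℝ × D)} {E : D} (h : HNChain σ.P l E) {a : ℝ} :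
    σ.GT a E ↔ ∀ p ∈ l, a < p.1 := by
  refine ⟨fun hE p hp => ?_, .of_chain h⟩
  obtain ⟨X, Y, hT, hX, hY⟩ := h.exists_tri_filter a
  have hY' : σ.LE a Y := .of_chain hY (by simp)
  have hX' : σ.GT a X := .of_chain hX (by simp)
  have := hY.eq_nil_of_isZero
    (PreStabilityCondition.GT.isZero (.right hT hE (hX'.anti (by linarith))) hY')
  simpa using List.filter_eq_nil_iff.1 this p hp

namespace PreStabilityCondition

theorem mem_list_iff {P : ℝ → ObjectProperty D} {E : D} (F : HNFiltration P E) (p : ℝ × D) :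
    p ∈ F.list ↔ ∃ i, (F.phase i, F.factor i) = p := by
  simp [HNFiltration.list, List.mem_ofFn]

theorem mass_eq_sum (σ : PreStabilityCondition v) (E : D) :
    σ.mass E = ((σ.hn E).list.map fun p => ‖σ.Z (v (K₀.of p.2))‖).sum := by
  simp [mass, HNFiltration.list, List.sum_reverse, List.sum_ofFn, List.map_ofFn,
    Function.comp_def]

variable [IsTriangulated D]

theorem phiPlus_le_iff (σ : PreStabilityCondition v) (E : {E : D // ¬ IsZero E}) (b : ℝ) :
    σ.phiPlus E ≤ b ↔ σ.LE b E.1 := by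
  rw [(σ.hn E.1).chain.le_iff]
  constructor
  · intro h p hp
    obtain ⟨i, rfl⟩ := (mem_list_iff _ _).1 hp
    exact ((σ.hn E.1).phase_strictAnti.antitone (Fin.mk_le_of_le_val (Nat.zero_le _))).trans h
  · intro h
    exact h _ ((mem_list_iff _ _).2 ⟨_, rfl⟩)

theorem lt_phiMinus_iff (σ : PreStabilityCondition v) (E : {E : D // ¬ IsZero E}) (a : ℝ) :
    a < σ.phiMinus E ↔ σ.GT a E.1 := by
  rw [(σ.hn E.1).chain.gt_iff]
  constructor
  · intro h p hp
    obtain ⟨i, rfl⟩ := (mem_list_iff _ _).1 hp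
    exact h.trans_le ((σ.hn E.1).phase_strictAnti.antitone
      (Fin.le_def.2 (Nat.le_sub_one_of_lt i.2)))
  · intro h
    exact h _ ((mem_list_iff _ _).2 ⟨_, rfl⟩)

end PreStabilityCondition

end Slicing

/-! ### Rotated coordinates on ℂ and rays of given phase. -/

section Rotation

open Real

/-- The imaginary part of `exp (-iπθ) * x`. -/
def imRot (θ : ℝ) : ℂ →ₗ[ℝ] ℝ :=
  cos (π * θ) • Complex.imLm - sin (π * θ) • Complex.reLm

/-- The real part of `exp (-iπθ) * x`. -/
def reRot (θ : ℝ) : ℂ →ₗ[ℝ] ℝ :=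
  cos (π * θ) • Complex.reLm + sin (π * θ) • Complex.imLm

theorem imRot_apply (θ : ℝ) (x : ℂ) : imRot θ x = cos (π * θ) * x.im - sin (π * θ) * x.re := by
  simp [imRot]

theorem reRot_apply (θ : ℝ) (x : ℂ) : reRot θ x = cos (π * θ) * x.re + sin (π * θ) * x.im := by
  simp [reRot]

/-- The points of the open ray of phase `φ`. -/
def OnRay (φ : ℝ) (z : ℂ) : Prop :=
  ∃ r : ℝ, 0 < r ∧ z = r * Complex.exp (Complex.I * Real.pi * φ)

theorem ray_re (r φ : ℝ) : ((r : ℂ) * Complex.exp (Complex.I * Real.pi * φ)).re =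
    r * cos (π * φ) := by
  have : Complex.I * Real.pi * φ = ((π * φ : ℝ) : ℂ) * Complex.I := by push_cast; ring
  rw [this, Complex.re_ofReal_mul, Complex.exp_ofReal_mul_I_re]

theorem ray_im (r φ : ℝ) : ((r : ℂ) * Complex.exp (Complex.I * Real.pi * φ)).im =
    r * sin (π * φ) := by
  have : Complex.I * Real.pi * φ = ((π * φ : ℝ) : ℂ) * Complex.I := by push_cast; ring
  rw [this, Complex.im_ofReal_mul, Complex.exp_ofReal_mul_I_im]

theorem norm_ray {r φ : ℝ} (hr : 0 ≤ r) :
    ‖(r : ℂ) * Complex.exp (Complex.I * Real.pi * φ)‖ = r := by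
  have : Complex.I * Real.pi * φ = ((π * φ : ℝ) : ℂ) * Complex.I := by push_cast; ring
  rw [this, norm_mul, Complex.norm_exp_ofReal_mul_I, Complex.norm_real, mul_one,
    Real.norm_of_nonneg hr]

theorem sq_add_sq_rot (θ : ℝ) (x : ℂ) : reRot θ x ^ 2 + imRot θ x ^ 2 = ‖x‖ ^ 2 := by
  rw [Complex.sq_norm, Complex.normSq_apply, reRot_apply, imRot_apply]
  have := Real.sin_sq_add_cos_sq (π * θ)
  linear_combination (x.re ^ 2 + x.im ^ 2) * this

theorem abs_imRot_le (θ : ℝ) (x : ℂ) : |imRot θ x| ≤ ‖x‖ := by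
  apply abs_le_of_sq_le_sq _ (norm_nonneg _)
  nlinarith [sq_add_sq_rot θ x, sq_nonneg (reRot θ x)]

theorem abs_reRot_le (θ : ℝ) (x : ℂ) : |reRot θ x| ≤ ‖x‖ := by
  apply abs_le_of_sq_le_sq _ (norm_nonneg _)
  nlinarith [sq_add_sq_rot θ x, sq_nonneg (imRot θ x)]

theorem eq_zero_of_rot {θ : ℝ} {x : ℂ} (h₁ : reRot θ x = 0) (h₂ : imRot θ x = 0) : x = 0 := by
  have := sq_add_sq_rot θ x
  rw [h₁, h₂] at this
  simpa using this.symm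

theorem OnRay.norm_pos {φ : ℝ} {z : ℂ} (h : OnRay φ z) : 0 < ‖z‖ := by
  obtain ⟨r, hr, rfl⟩ := h
  rwa [norm_ray hr.le]

theorem OnRay.ne_zero {φ : ℝ} {z : ℂ} (h : OnRay φ z) : z ≠ 0 := norm_pos_iff.1 h.norm_pos

theorem OnRay.imRot {φ : ℝ} {z : ℂ} (h : OnRay φ z) (θ : ℝ) :
    imRot θ z = ‖z‖ * sin (π * (φ - θ)) := by
  obtain ⟨r, hr, rfl⟩ := h
  rw [norm_ray hr.le, imRot_apply, ray_re, ray_im, mul_sub, Real.sin_sub]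
  ring

theorem OnRay.reRot {φ : ℝ} {z : ℂ} (h : OnRay φ z) (θ : ℝ) :
    reRot θ z = ‖z‖ * cos (π * (φ - θ)) := by
  obtain ⟨r, hr, rfl⟩ := h
  rw [norm_ray hr.le, reRot_apply, ray_re, ray_im, mul_sub, Real.cos_sub]
  ring

theorem onRay_iff {φ : ℝ} {z : ℂ} :
    OnRay φ z ↔ 0 < BridgelandStab.reRot φ z ∧ BridgelandStab.imRot φ z = 0 := by
  constructor
  · intro h
    rw [h.reRot, h.imRot]
    simpa using h.ne_zero
  · rintro ⟨h1, h2⟩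
    refine ⟨_, h1, ?_⟩
    apply Complex.ext
    · rw [ray_re]
      rw [reRot_apply] at *
      rw [imRot_apply] at h2
      linear_combination (-z.re) * Real.sin_sq_add_cos_sq (π * φ) - sin (π * φ) * h2
    · rw [ray_im]
      rw [reRot_apply] at *
      rw [imRot_apply] at h2
      linear_combination (-z.im) * Real.sin_sq_add_cos_sq (π * φ) + cos (π * φ) * h2

theorem imRot_add_one (θ : ℝ) (x : ℂ) : imRot (θ + 1) x = -imRot θ x := by
  simp only [imRot_apply, mul_add, mul_one, Real.cos_add_pi, Real.sin_add_pi]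
  ring

theorem reRot_add_one (θ : ℝ) (x : ℂ) : reRot (θ + 1) x = -reRot θ x := by
  simp only [reRot_apply, mul_add, mul_one, Real.cos_add_pi, Real.sin_add_pi]
  ring

theorem OnRay.neg {φ : ℝ} {z : ℂ} (h : OnRay φ z) : OnRay (φ + 1) (-z) := by
  rw [onRay_iff] at *
  rw [reRot_add_one, imRot_add_one, map_neg, map_neg]
  simpa using h

theorem onRay_neg_iff {φ : ℝ} {z : ℂ} : OnRay (φ + 1) (-z) ↔ OnRay φ z := by
  refine ⟨fun h => ?_, OnRay.neg⟩
  rw [onRay_iff] at *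
  rw [reRot_add_one, imRot_add_one, map_neg, map_neg] at h
  simpa using h

theorem OnRay.imRot_nonneg {φ θ : ℝ} {z : ℂ} (h : OnRay φ z) (h1 : θ ≤ φ) (h2 : φ ≤ θ + 1) :
    0 ≤ BridgelandStab.imRot θ z := by
  rw [h.imRot]
  refine mul_nonneg (norm_nonneg _) (Real.sin_nonneg_of_nonneg_of_le_pi ?_ ?_)
  · have := Real.pi_pos; nlinarith
  · have := Real.pi_pos; nlinarith

theorem OnRay.imRot_pos {φ θ : ℝ} {z : ℂ} (h : OnRay φ z) (h1 : θ < φ) (h2 : φ < θ + 1) :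
    0 < BridgelandStab.imRot θ z := by
  rw [h.imRot]
  refine mul_pos h.norm_pos (Real.sin_pos_of_pos_of_lt_pi ?_ ?_)
  · have := Real.pi_pos; nlinarith
  · have := Real.pi_pos; nlinarith

theorem OnRay.imRot_neg {φ θ : ℝ} {z : ℂ} (h : OnRay φ z) (h1 : θ - 1 < φ) (h2 : φ < θ) :
    BridgelandStab.imRot θ z < 0 := by
  have := h.neg.imRot_pos (θ := θ) (by linarith) (by linarith)
  rw [map_neg] at this
  linarith

end Rotation

theorem linear_sum_map {α : Type*} (f : ℂ →ₗ[ℝ] ℝ) (l : List α) (g : α → ℂ) :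
    f (l.map g).sum = (l.map fun p => f (g p)).sum := by
  rw [map_list_sum, List.map_map]
  rfl

/-! ### The mass as an integral of polygon heights. -/

section MassIntegral

open Real MeasureTheory intervalIntegral

/-- The height, in direction `θ`, of the part of phase greater than `θ`. -/
def height (l : List (ℝ × ℂ)) (θ : ℝ) : ℝ :=
  (l.map fun p => if θ < p.1 then imRot θ p.2 else 0).sum

/-- For θ between β and φ the height is ‖z‖ sin(π(φ−θ)), with antiderivative ‖z‖ cos(π(φ−θ))/π, and
beyond φ it is zero; the integral is ‖z‖(1 − cos(π(φ−β)))/π. -/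
theorem integral_height_single {β φ : ℝ} {z : ℂ} (h : OnRay φ z) (h1 : β < φ) (h2 : φ ≤ β + 1) :
    IntervalIntegrable (fun θ => if θ < φ then imRot θ z else 0) volume β (β + 1) ∧
    π * ∫ θ in β..(β + 1), (if θ < φ then imRot θ z else 0) = ‖z‖ - reRot β z := by
  have e1 : Set.EqOn (fun θ => if θ < φ then imRot θ z else 0)
      (fun θ => ‖z‖ * sin (π * (φ - θ))) (Set.uIcc β φ) := by
    intro θ hθ
    rw [Set.uIcc_of_le h1.le] at hθ
    dsimp only
    split_ifs with hlt
    · exact h.imRot θ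
    · have : θ = φ := le_antisymm hθ.2 (not_lt.1 hlt)
      simp [this]
  have e2 : Set.EqOn (fun θ => if θ < φ then imRot θ z else 0)
      (fun _ => (0 : ℝ)) (Set.uIcc φ (β + 1)) := by
    intro θ hθ
    rw [Set.uIcc_of_le h2] at hθ
    simp [hθ.1.not_gt]
  have i1 : IntervalIntegrable (fun θ => if θ < φ then imRot θ z else 0) volume β φ := by
    refine IntervalIntegrable.congr (fun θ hθ => (e1 (Set.uIoc_subset_uIcc hθ)).symm) ?_
    exact Continuous.intervalIntegrable (by fun_prop) _ _
  have i2 : IntervalIntegrable (fun θ => if θ < φ then imRot θ z else 0) volume φ (β + 1) := by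
    refine IntervalIntegrable.congr (fun θ hθ => (e2 (Set.uIoc_subset_uIcc hθ)).symm) ?_
    exact intervalIntegrable_const
  refine ⟨i1.trans i2, ?_⟩
  rw [← integral_add_adjacent_intervals i1 i2, integral_congr e1, integral_congr e2]
  have hd : ∀ θ ∈ Set.uIcc β φ, HasDerivAt (fun θ => ‖z‖ * cos (π * (φ - θ)) / π)
      (‖z‖ * sin (π * (φ - θ))) θ := by
    intro θ _
    have h1 : HasDerivAt (fun θ => π * (φ - θ)) (π * (-1)) θ :=
      ((hasDerivAt_id θ).const_sub φ).const_mul π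
    convert! ((h1.cos.const_mul ‖z‖).div_const π) using 1
    have := Real.pi_ne_zero
    field_simp
  rw [integral_eq_sub_of_hasDerivAt hd (Continuous.intervalIntegrable (by fun_prop) _ _),
    h.reRot]
  have := Real.pi_ne_zero
  simp
  field_simp

theorem integral_height {β : ℝ} (l : List (ℝ × ℂ)) (hl : ∀ p ∈ l, OnRay p.1 p.2)
    (hl' : ∀ p ∈ l, β < p.1 ∧ p.1 ≤ β + 1) :
    IntervalIntegrable (height l) volume β (β + 1) ∧
    π * ∫ θ in β..(β + 1), height l θ =
      (l.map fun p => ‖p.2‖).sum - reRot β (l.map fun p => p.2).sum := by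
  induction l with
  | nil =>
    have : height [] = fun _ => 0 := by ext; simp [height]
    simp [this]
  | cons p l ih =>
    simp only [List.mem_cons, forall_eq_or_imp] at hl hl'
    obtain ⟨i1, e1⟩ := integral_height_single hl.1 hl'.1.1 hl'.1.2
    obtain ⟨i2, e2⟩ := ih hl.2 hl'.2
    have : height (p :: l) = fun θ => (if θ < p.1 then imRot θ p.2 else 0) + height l θ := by
      ext; simp [height]
    rw [this]
    refine ⟨i1.add i2, ?_⟩
    rw [integral_add i1 i2, mul_add, e1, e2]
    simp
    ring

/-- A Crofton-type comparison: pointwise domination of heights is integrated over an interval of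
length one, so an error ε in the height costs πε in the mass. -/
theorem sum_norm_sub_reRot_le {β ε : ℝ} {l₁ l₂ : List (ℝ × ℂ)}
    (hl₁ : ∀ p ∈ l₁, OnRay p.1 p.2) (hl₁' : ∀ p ∈ l₁, β < p.1 ∧ p.1 ≤ β + 1)
    (hl₂ : ∀ p ∈ l₂, OnRay p.1 p.2) (hl₂' : ∀ p ∈ l₂, β < p.1 ∧ p.1 ≤ β + 1)
    (h : ∀ θ, β ≤ θ → θ ≤ β + 1 → height l₂ θ ≤ height l₁ θ + ε) :
    (l₂.map fun p => ‖p.2‖).sum - reRot β (l₂.map fun p => p.2).sum ≤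
      (l₁.map fun p => ‖p.2‖).sum - reRot β (l₁.map fun p => p.2).sum + π * ε := by
  obtain ⟨i1, e1⟩ := integral_height l₁ hl₁ hl₁'
  obtain ⟨i2, e2⟩ := integral_height l₂ hl₂ hl₂'
  rw [← e1, ← e2, ← mul_add]
  refine mul_le_mul_of_nonneg_left ?_ Real.pi_pos.le
  have := integral_mono_on (by linarith : β ≤ β + 1) i2 (i1.add intervalIntegrable_const)
    (fun θ hθ => h θ hθ.1 hθ.2)
  rw [integral_add i1 intervalIntegrable_const] at this
  simpa using this

end MassIntegral

/-! ### Central charges on hearts, polygons and images. -/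

section Heart

variable {D : Type u} [Category.{w} D] [HasZeroObject D] [HasShift D ℤ] [Preadditive D]
  [∀ n : ℤ, (shiftFunctor D n).Additive] [Pretriangulated D]
  {Λ : Type*} [AddCommGroup Λ] {v : K₀ D →+ Λ}

/-- The class of an object in `Λ`. -/
def cls (v : K₀ D →+ Λ) (E : D) : Λ := v (K₀.of E)

theorem cls_tri {A E B : D} (t : Tri A E B) : cls v E = cls v A + cls v B := by
  simp [cls, K₀.of_eq_add_of_tri t]

theorem cls_isZero {E : D} (h : IsZero E) : cls v E = 0 := by
  simp [cls, K₀.of_isZero h]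

theorem cls_iso {A B : D} (e : A ≅ B) : cls v A = cls v B := by
  simp [cls, K₀.of_iso e]

theorem cls_shift (A : D) : cls v (A⟦(1 : ℤ)⟧) = -cls v A := by
  simp [cls, K₀.of_shift]

theorem HNChain.cls_eq_sum {P : ℝ → ObjectProperty D} {l : List (ℝ × D)} {E : D}
    (h : HNChain P l E) : cls v E = (l.map fun p => cls v p.2).sum := by
  simp [cls, h.K₀_of_eq_sum, map_list_sum, Function.comp_def]

theorem HNChain.map_cls_eq_sum {M : Type*} [AddCommMonoid M] {G : Type*} [FunLike G Λ M]
    [AddMonoidHomClass G Λ M] (W : G) {P : ℝ → ObjectProperty D}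
    {l : List (ℝ × D)} {E : D} (h : HNChain P l E) :
    W (cls v E) = (l.map fun p => W (cls v p.2)).sum := by
  rw [h.cls_eq_sum, map_list_sum, List.map_map]
  rfl

namespace PreStabilityCondition

variable {σ : PreStabilityCondition v}

theorem onRay {φ : ℝ} {E : D} (h : σ.P φ E) (hE : ¬ IsZero E) : OnRay φ (σ.Z (cls v E)) :=
  σ.charge_mem_ray h hE

theorem onRay_of_chain {E : D} {l : List (ℝ × D)} (h : HNChain σ.P l E) :
    ∀ p ∈ l, OnRay p.1 (σ.Z (cls v p.2)) :=
  fun p hp => onRay (h.mem p hp) (h.ne_zero p hp)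

variable [IsTriangulated D]

theorem imRot_nonneg {θ : ℝ} {E : D} (h1 : σ.GT θ E) (h2 : σ.LE (θ + 1) E) :
    0 ≤ imRot θ (σ.Z (cls v E)) := by
  obtain ⟨l, hl⟩ := σ.exists_chain E
  rw [hl.map_cls_eq_sum, linear_sum_map]
  refine List.sum_nonneg ?_
  simp only [List.mem_map, forall_exists_index, and_imp]
  rintro _ p hp rfl
  exact (onRay_of_chain hl p hp).imRot_nonneg (hl.gt_iff.1 h1 p hp).le (hl.le_iff.1 h2 p hp)

theorem imRot_nonpos {θ : ℝ} {E : D} (h1 : σ.GT (θ - 1) E) (h2 : σ.LE θ E) :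
    imRot θ (σ.Z (cls v E)) ≤ 0 := by
  have := imRot_nonneg (θ := θ - 1) h1 (by simpa using h2)
  have h3 := imRot_add_one (θ - 1) (σ.Z (cls v E))
  rw [sub_add_cancel] at h3
  linarith

/-- The Harder-Narasimhan polygon lies above all subobjects. -/
theorem imRot_le_of_tri {β θ : ℝ} {X E X' T Y : D} (hX : Tri X E X') (h1 : σ.GT β X)
    (h2 : σ.LE (β + 1) X') (hβ : β ≤ θ) (hθ : θ ≤ β + 1) (hT : Tri T E Y) (h3 : σ.GT θ T)
    (h4 : σ.LE θ Y) : imRot θ (σ.Z (cls v X)) ≤ imRot θ (σ.Z (cls v T)) := by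
  -- If all phases of `X` exceed θ, then `X ⟶ E` factors through `T`, and the cone of `X ⟶ T` has
  -- phases in (θ, β+1], so its height is nonnegative.
  have key : ∀ X X' : D, Tri X E X' → σ.GT θ X → σ.LE (β + 1) X' →
      imRot θ (σ.Z (cls v X)) ≤ imRot θ (σ.Z (cls v T)) := by
    rintro X X' ⟨f, f', f'', hf⟩ h1 h2
    obtain ⟨x, x', x'', hx⟩ := hT
    obtain ⟨g, hg⟩ := exists_lift hx f (h1.hom_eq_zero h4 _)
    obtain ⟨R, hR, hR'⟩ := exists_tri_of_comp hf hx g hg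
    have hR1 : σ.GT θ R := .right hR h3 (h1.anti (by linarith))
    have hR2 : σ.LE (β + 1) R := .left hR' h2 (h4.mono (by linarith))
    have := imRot_nonneg hR1 (hR2.mono (by linarith))
    rw [cls_tri hR, map_add, map_add]
    linarith
  -- In general only the part `A` of `X` above θ is compared with `T`; the rest `B` has phases in
  -- (θ−1, θ] and contributes a nonpositive height.
  obtain ⟨A, B, hAB, hA, hB⟩ := σ.exists_trunc θ X
  obtain ⟨X'', hX1, hX2⟩ := hAB.comp hX
  have hB1 : σ.GT (θ - 1) B := .right hAB (h1.anti (by linarith)) (hA.anti (by linarith))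
  have := key A X'' hX1 hA (.ext hX2 (hB.mono hθ) h2)
  have h5 := imRot_nonpos hB1 hB
  rw [cls_tri hAB, map_add, map_add]
  linarith

/-- The heart of the t-structure with phases in `(β, β + 1]`. -/
def Heart (σ : PreStabilityCondition v) (β : ℝ) (E : D) : Prop := σ.GT β E ∧ σ.LE (β + 1) E

theorem Heart.of_isZero {β : ℝ} {E : D} (h : IsZero E) : σ.Heart β E :=
  ⟨.of_isZero h, .of_isZero h⟩

theorem Heart.of_iso {β : ℝ} {E F : D} (h : σ.Heart β E) (e : E ≅ F) : σ.Heart β F :=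
  ⟨h.1.of_iso e, h.2.of_iso e⟩

theorem Heart.ext {β : ℝ} {A E B : D} (t : Tri A E B) (hA : σ.Heart β A) (hB : σ.Heart β B) :
    σ.Heart β E :=
  ⟨.ext t hA.1 hB.1, .ext t hA.2 hB.2⟩

/-- Image factorization in a heart. -/
theorem Heart.exists_image {β : ℝ} {E F : D} (hE : σ.Heart β E) (hF : σ.Heart β F) (f : E ⟶ F) :
    ∃ K I C, σ.Heart β K ∧ σ.Heart β I ∧ σ.Heart β C ∧ Tri K E I ∧ Tri I F C ∧
      (IsZero I → f = 0) := by
  obtain ⟨C₀, c, c', hc⟩ := distinguished_cocone_triangle f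
  have tC : Tri E F C₀ := ⟨_, _, _, hc⟩
  have h1 : σ.GT β C₀ := .right tC hF.1 (hE.1.anti (by linarith))
  have h2 : σ.LE (β + 1 + 1) C₀ := .ext tC.rotate (hF.2.mono (by linarith)) (le_shift_iff.2 hE.2)
  -- The cone of `f` has phases in (β, β+2]. Cut at β+1, it yields the shifted kernel `U` and the
  -- cokernel `C`; the image is the fibre of `F ⟶ C`.
  obtain ⟨U, C, ⟨u, d, e, hU⟩, hU1, hC1⟩ := σ.exists_trunc (β + 1) C₀
  have tU : Tri U C₀ C := ⟨_, _, _, hU⟩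
  have hU2 : σ.LE (β + 1 + 1) U := .left tU h2 (hC1.mono (by linarith))
  have hC2 : σ.GT β C := .right tU h1 (hU1.anti (by linarith))
  obtain ⟨I, i, j, hI, hI'⟩ := exists_tri_fiber_comp hc hU
  refine ⟨U⟦(-1 : ℤ)⟧, I, C, ⟨by simpa using gt_neg_shift hU1, by simpa using le_neg_shift hU2⟩,
    ⟨.ext hI hE.1 (hU1.anti (by linarith)), .left ⟨_, _, _, hI'⟩ hF.2 (hC1.mono (by linarith))⟩,
    ⟨hC2, hC1⟩, hI.invRotate, ⟨_, _, _, hI'⟩, fun h0 => ?_⟩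
  have : IsIso (c ≫ d) := (Triangle.isZero₁_iff_isIso₂ _ hI').1 h0
  have hfc : f ≫ c = 0 := comp_distTriang_mor_zero₁₂ _ hc
  rw [← cancel_mono (c ≫ d), zero_comp, ← Category.assoc, hfc, zero_comp]

end PreStabilityCondition

end Heart

/-! ### Comparing arguments in the upper half plane by signed areas. -/

section UpperHalfPlane

open Real

/-- The union of the open upper half plane and the negative real axis. -/
def Upper (z : ℂ) : Prop := 0 < z.im ∨ (z.im = 0 ∧ z.re < 0)

/-- The signed area of the parallelogram spanned by `x` and `y`. -/
def cross (x y : ℂ) : ℝ := x.re * y.im - x.im * y.re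

@[simp] theorem cross_self (x : ℂ) : cross x x = 0 := by simp [cross, mul_comm]

@[simp] theorem cross_zero_left (x : ℂ) : cross 0 x = 0 := by simp [cross]

@[simp] theorem cross_zero_right (x : ℂ) : cross x 0 = 0 := by simp [cross]

theorem cross_add_left (x y z : ℂ) : cross (x + y) z = cross x z + cross y z := by
  simp [cross]; ring

theorem cross_add_right (x y z : ℂ) : cross x (y + z) = cross x y + cross x z := by
  simp [cross]; ring

theorem cross_swap (x y : ℂ) : cross x y = -cross y x := by
  simp [cross]; ring

theorem Upper.ne_zero {z : ℂ} (h : Upper z) : z ≠ 0 := by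
  rintro rfl
  simp [Upper] at h

theorem Upper.im_nonneg {z : ℂ} (h : Upper z) : 0 ≤ z.im := by
  rcases h with h | h
  · exact h.le
  · exact h.1.ge

theorem Upper.add {x y : ℂ} (hx : Upper x) (hy : Upper y) : Upper (x + y) := by
  rcases hx with hx | hx <;> rcases hy with hy | hy
  · left; simp; linarith
  · left; simp; linarith
  · left; simp; linarith
  · right; simp; constructor <;> linarith

theorem Upper.arg_pos {z : ℂ} (h : Upper z) : 0 < z.arg := by
  rcases h with h | h
  · have h1 := Complex.arg_nonneg_iff.2 h.le
    refine lt_of_le_of_ne h1 fun h2 => ?_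
    have := (Complex.arg_eq_zero_iff.1 h2.symm).2
    linarith
  · rw [Complex.arg_eq_pi_iff.2 ⟨h.2, h.1⟩]
    exact Real.pi_pos

theorem cross_eq (x y : ℂ) : cross x y = ‖x‖ * ‖y‖ * sin (y.arg - x.arg) := by
  rw [Real.sin_sub, show ‖x‖ * ‖y‖ * (sin y.arg * cos x.arg - cos y.arg * sin x.arg) =
    ‖x‖ * cos x.arg * (‖y‖ * sin y.arg) - ‖x‖ * sin x.arg * (‖y‖ * cos y.arg) by ring]
  simp only [Complex.norm_mul_cos_arg, Complex.norm_mul_sin_arg, cross]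

/-- Both arguments lie in (0, π], so their difference lies in (−π, π), where the sine has the sign
of its argument. -/
theorem Upper.cross_pos_iff {x y : ℂ} (hx : Upper x) (hy : Upper y) :
    0 < cross x y ↔ x.arg < y.arg := by
  have h1 := norm_pos_iff.2 hx.ne_zero
  have h2 := norm_pos_iff.2 hy.ne_zero
  have := hx.arg_pos
  have := hy.arg_pos
  have := Complex.arg_le_pi x
  have := Complex.arg_le_pi y
  rw [cross_eq]
  constructor
  · intro h
    by_contra! hlt
    have : sin (y.arg - x.arg) ≤ 0 :=
      Real.sin_nonpos_of_nonpos_of_neg_pi_le (by linarith) (by linarith)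
    nlinarith [mul_pos h1 h2]
  · intro h
    exact mul_pos (mul_pos h1 h2) (Real.sin_pos_of_pos_of_lt_pi (by linarith) (by linarith))

theorem Upper.cross_nonneg_iff {x y : ℂ} (hx : Upper x) (hy : Upper y) :
    0 ≤ cross x y ↔ x.arg ≤ y.arg := by
  rw [← not_lt, ← not_lt, ← hy.cross_pos_iff hx, cross_swap]
  simp

theorem Upper.onRay {z : ℂ} (h : Upper z) : OnRay (z.arg / π) z := by
  refine ⟨‖z‖, norm_pos_iff.2 h.ne_zero, ?_⟩
  have := Complex.norm_mul_exp_arg_mul_I z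
  conv_lhs => rw [← this]
  congr 2
  have hpi : (π : ℂ) ≠ 0 := by exact_mod_cast Real.pi_ne_zero
  push_cast
  field_simp

/-- Two points of the upper half plane with the same argument. -/
theorem Upper.exists_smul {x y : ℂ} (hx : Upper x) (hy : Upper y) (h : cross x y = 0) :
    ∃ t : ℝ, 0 < t ∧ y = t * x := by
  have h1 := (hx.cross_nonneg_iff hy).1 h.ge
  have h2 := (hy.cross_nonneg_iff hx).1 (by rw [cross_swap, h]; simp)
  have harg := le_antisymm h1 h2
  have hx0 := norm_pos_iff.2 hx.ne_zero
  have hy0 := norm_pos_iff.2 hy.ne_zero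
  refine ⟨‖y‖ / ‖x‖, by positivity, ?_⟩
  conv_lhs => rw [← Complex.norm_mul_exp_arg_mul_I y, ← harg]
  have : (‖x‖ : ℂ) ≠ 0 := by exact_mod_cast hx0.ne'
  push_cast
  field_simp
  linear_combination (‖y‖ : ℂ) * Complex.norm_mul_exp_arg_mul_I x

/-- Bounds the real parts of destabilizing subobjects: a vector with argument at least that of `y`
and no higher than `y` cannot lie to the right of both `y` and the imaginary axis. -/
theorem Upper.re_le {x y : ℂ} (hx : Upper x) (h : 0 ≤ cross y x)
    (him : x.im ≤ y.im) {R : ℝ} (hR : 0 ≤ R) (hyR : y.re ≤ R) : x.re ≤ R := by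
  by_contra! hlt
  have hx0 : 0 < x.re := by linarith
  have hxi : 0 < x.im := by
    rcases hx with hx | hx
    · exact hx
    · linarith [hx.2]
  unfold cross at h
  nlinarith

end UpperHalfPlane

/-! ### Harder–Narasimhan filtrations from finiteness of subobject classes. -/

section AbstractHeart

variable {D : Type u} [Category.{w} D] [HasZeroObject D] [HasShift D ℤ] [Preadditive D]
  [∀ n : ℤ, (shiftFunctor D n).Additive] [Pretriangulated D]
  {Λ : Type*} [AddCommGroup Λ] {v : K₀ D →+ Λ}

/-- `S` is a subobject of `E` with quotient `T` in the extension-closed subcategory `A`. -/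
structure IsSub (A : D → Prop) (S E T : D) : Prop where
  tri : Tri S E T
  left : A S
  right : A T

/-- Slope semistability in `A` with respect to the central charge `w`. -/
def SlopeSemistable (v : K₀ D →+ Λ) (A : D → Prop) (w : Λ → ℂ) (E : D) : Prop :=
  A E ∧ ∀ S T, IsSub A S E T → 0 ≤ cross (w (cls v S)) (w (cls v E))

/-- The classes of subobjects of `E` whose central charge has real part at most `R`. -/
def subClasses (v : K₀ D →+ Λ) (A : D → Prop) (w : Λ → ℂ) (E : D) (R : ℝ) : Set Λ :=
  {x | ∃ S T, IsSub A S E T ∧ cls v S = x ∧ (w x).re ≤ R}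

variable {A : D → Prop}

theorem IsSub.trans [IsTriangulated D] (hext : ∀ X Y Z, Tri X Y Z → A X → A Z → A Y)
    {S' S C E T : D} (h₁ : IsSub A S' S C) (h₂ : IsSub A S E T) :
    ∃ X, IsSub A S' E X := by
  obtain ⟨X, hX, hX'⟩ := h₁.tri.comp h₂.tri
  exact ⟨X, hX, h₁.left, hext _ _ _ hX' h₁.right h₂.right⟩

theorem IsSub.preimage [IsTriangulated D] (hext : ∀ X Y Z, Tri X Y Z → A X → A Z → A Y)
    {S E T B C : D} (h₁ : IsSub A S E T) (h₂ : IsSub A B T C) :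
    ∃ E', IsSub A E' E C ∧ cls v E' = cls v S + cls v B := by
  obtain ⟨E', hE, hE'⟩ := h₁.tri.pullback h₂.tri
  exact ⟨E', ⟨hE', hext _ _ _ hE h₁.left h₂.left, h₂.right⟩, cls_tri hE⟩

variable [IsTriangulated D]

/-- No chain condition on objects is needed. Among the classes of nonzero subobjects with real part
at most `R`, choose one of maximal argument and then of maximal norm. A representing `S` is
semistable, and every nonzero subobject of the quotient `T` has smaller argument. The induction is
on the number of classes in `subClasses`. Bounding each phase by that of an actual subobject is what
makes the phases strictly decrease when the factor `S` is added. -/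
theorem exists_hnChain_of_finite (h0 : ∀ X, IsZero X → A X)
    (hext : ∀ X Y Z, Tri X Y Z → A X → A Z → A Y) (w : Λ →+ ℂ)
    (hw : ∀ E, A E → ¬ IsZero E → Upper (w (cls v E)))
    (hfin : ∀ E, A E → ∀ R, (subClasses v A w E R).Finite)
    (P : ℝ → ObjectProperty D) (β : ℝ)
    (hP : ∀ E, SlopeSemistable v A w E → ¬ IsZero E → P (β + (w (cls v E)).arg / Real.pi) E)
    (E : D) (hE : A E) :
    ∃ l, HNChain P l E ∧ ∀ p ∈ l, β < p.1 ∧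
      ∃ S T, IsSub A S E T ∧ ¬ IsZero S ∧ p.1 ≤ β + (w (cls v S)).arg / Real.pi := by
  -- `R` is nonnegative so that the class 0 is counted, and at least the real part of the charge of
  -- `E` so that `E` itself is a candidate.
  suffices H : ∀ (n : ℕ) (E : D) (R : ℝ), A E → 0 ≤ R → (w (cls v E)).re ≤ R →
      (subClasses v A w E R).ncard = n → ∃ l, HNChain P l E ∧ ∀ p ∈ l, β < p.1 ∧
      ∃ S T, IsSub A S E T ∧ ¬ IsZero S ∧ p.1 ≤ β + (w (cls v S)).arg / Real.pi from
    H _ E (max 0 (w (cls v E)).re) hE (le_max_left _ _) (le_max_right _ _) rfl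
  intro n
  induction n using Nat.strong_induction_on with
  | _ n ih =>
  intro E R hE hR hER hn
  by_cases hE0 : IsZero E
  · exact ⟨[], .nil hE0, by simp⟩
  have hself : IsSub A E E 0 := ⟨tri_of_isZero_right (Iso.refl _) (isZero_zero D), hE,
    h0 _ (isZero_zero D)⟩
  have hEu := hw E hE hE0
  have him : ∀ S T, IsSub A S E T → (w (cls v S)).im ≤ (w (cls v E)).im := by
    intro S T h
    rw [cls_tri h.tri, map_add, Complex.add_im]
    by_cases hT : IsZero T
    · simp [cls_isZero hT]
    · linarith [(hw T h.right hT).im_nonneg]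
  let M : Set Λ := {x | ∃ S T, IsSub A S E T ∧ ¬ IsZero S ∧ cls v S = x ∧ (w x).re ≤ R}
  have hMfin : M.Finite := (hfin E hE R).subset
    fun x ⟨S, T, h1, _, h2, h3⟩ => ⟨S, T, h1, h2, h3⟩
  have hEM : cls v E ∈ M := ⟨E, 0, hself, hE0, rfl, hER⟩
  obtain ⟨x, ⟨S, T, hS, hS0, rfl, hSR⟩, hmax⟩ :=
    Set.exists_max_image M (fun x => toLex ((w x).arg, ‖w x‖)) hMfin ⟨_, hEM⟩
  have hSu := hw S hS.left hS0
  have hargE : (w (cls v E)).arg ≤ (w (cls v S)).arg := by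
    rcases Prod.Lex.toLex_le_toLex.1 (hmax _ hEM) with h | h
    · exact h.le
    · exact h.1.le
  have hmem : ∀ S' T', IsSub A S' E T' → ¬ IsZero S' →
      (w (cls v S)).arg ≤ (w (cls v S')).arg → cls v S' ∈ M := by
    intro S' T' h hS' harg
    have hu := hw S' h.left hS'
    exact ⟨S', T', h, hS', rfl, hu.re_le ((hEu.cross_nonneg_iff hu).2 (hargE.trans harg))
      (him _ _ h) hR hER⟩
  have hle : ∀ S' T', IsSub A S' E T' → ¬ IsZero S' →
      (w (cls v S')).arg ≤ (w (cls v S)).arg := by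
    intro S' T' h hS'
    by_contra! hlt
    rcases Prod.Lex.toLex_le_toLex.1 (hmax _ (hmem S' T' h hS' hlt.le)) with h | h
    · exact absurd h (by simpa using hlt.le)
    · exact absurd h.1 hlt.ne'
  have hSS : SlopeSemistable v A w S := by
    refine ⟨hS.left, fun S' T' h => ?_⟩
    by_cases hS' : IsZero S'
    · simp [cls_isZero hS']
    · obtain ⟨X, hX⟩ := h.trans hext hS
      exact ((hw _ h.left hS').cross_nonneg_iff hSu).2 (hle _ _ hX hS')
  have hne : ∀ x ∈ M, w x ≠ 0 := by
    rintro _ ⟨S', T', h, hS', rfl, -⟩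
    exact (hw _ h.left hS').ne_zero
  have hpre : ∀ B C, IsSub A B T C → ∃ E', IsSub A E' E C ∧ ¬ IsZero E' ∧
      cls v E' = cls v S + cls v B := by
    intro B C h
    obtain ⟨E', h1, h2⟩ := IsSub.preimage (v := v) hext hS h
    refine ⟨E', h1, fun h3 => ?_, h2⟩
    have h4 : w (cls v S) + w (cls v B) = 0 := by
      rw [← map_add, ← h2, cls_isZero h3, map_zero]
    by_cases hB : IsZero B
    · rw [cls_isZero hB, map_zero, add_zero] at h4
      exact hSu.ne_zero h4
    · exact (hSu.add (hw B h.left hB)).ne_zero h4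
  -- Otherwise the preimage in `E` of such a `B` would have the same argument as `S` and larger
  -- norm, contradicting the lexicographic maximality.
  have hlt : ∀ B C, IsSub A B T C → ¬ IsZero B → (w (cls v B)).arg < (w (cls v S)).arg := by
    intro B C h hB
    by_contra! hge
    obtain ⟨E', h1, h1', h2⟩ := hpre B C h
    have hBu := hw B h.left hB
    have hu := hw E' h1.left h1'
    have hc : 0 ≤ cross (w (cls v S)) (w (cls v E')) := by
      rw [h2, map_add, cross_add_right, cross_self, zero_add]
      exact (hSu.cross_nonneg_iff hBu).2 hge
    have hc' := (hSu.cross_nonneg_iff hu).1 hc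
    have hc0 : cross (w (cls v S)) (w (cls v B)) = 0 := by
      have h3 := (hu.cross_nonneg_iff hSu).2 (hle _ _ h1 h1')
      rw [cross_swap] at h3
      have h4 : cross (w (cls v S)) (w (cls v E')) = 0 := le_antisymm (by linarith) hc
      rwa [h2, map_add, cross_add_right, cross_self, zero_add] at h4
    obtain ⟨t, ht, htB⟩ := hSu.exists_smul hBu hc0
    have hnorm : ‖w (cls v S)‖ < ‖w (cls v E')‖ := by
      rw [h2, map_add, htB]
      have : w (cls v S) + t * w (cls v S) = ((1 + t : ℝ) : ℂ) * w (cls v S) := by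
        push_cast; ring
      rw [this, norm_mul, Complex.norm_real, Real.norm_of_nonneg (by linarith)]
      have := norm_pos_iff.2 hSu.ne_zero
      nlinarith
    rcases Prod.Lex.toLex_le_toLex.1 (hmax _ (hmem E' C h1 h1' hc')) with h | h
    · exact absurd h (by simpa using hc')
    · exact absurd h.2 (by simpa using hnorm)
  -- Taking preimages adds `cls v S`, which embeds the classes of `T` for the lowered bound into
  -- those of `E`; the class 0 is missed because a preimage contains the nonzero `S`.
  have hcard : (subClasses v A w T (R - (w (cls v S)).re)).ncard < n := by
    have hinj : Function.Injective fun x : Λ => cls v S + x := add_right_injective _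
    rw [← Set.ncard_image_of_injective _ hinj, ← hn]
    refine Set.ncard_lt_ncard (Set.ssubset_iff_of_subset ?_ |>.2 ?_) (hfin E hE R)
    · rintro _ ⟨_, ⟨B, C, h, rfl, hre⟩, rfl⟩
      obtain ⟨E', h1, h1', h2⟩ := hpre B C h
      refine ⟨E', C, h1, h2, ?_⟩
      rw [map_add, Complex.add_re]
      linarith
    · refine ⟨0, ⟨0, E, ⟨tri_of_isZero_left (Iso.refl _) (isZero_zero D), h0 _ (isZero_zero D),
        hE⟩, cls_isZero (isZero_zero D), by simpa using hR⟩, ?_⟩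
      rintro ⟨_, ⟨B, C, h, rfl, hre⟩, hx⟩
      obtain ⟨E', h1, h1', h2⟩ := hpre B C h
      have := hw E' h1.left h1'
      rw [h2] at this
      dsimp only at hx
      rw [hx, map_zero] at this
      exact this.ne_zero rfl
  have hre : (w (cls v E)).re = (w (cls v S)).re + (w (cls v T)).re := by
    rw [cls_tri hS.tri, map_add, Complex.add_re]
  obtain ⟨l, hl, hl'⟩ := ih _ hcard T (R - (w (cls v S)).re) hS.right (by linarith)
    (by linarith) rfl
  have hpi := Real.pi_pos
  have hchain : HNChain P [(β + (w (cls v S)).arg / Real.pi, S)] S :=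
    .cons (.nil (isZero_zero D)) (tri_of_isZero_left (Iso.refl _) (isZero_zero D)) (hP S hSS hS0)
      hS0 (by simp)
  refine ⟨l ++ [(β + (w (cls v S)).arg / Real.pi, S)], hchain.append hl hS.tri ?_, ?_⟩
  · intro p hp q hq
    rw [List.mem_singleton] at hp
    subst hp
    obtain ⟨-, B, C, h, hB, hq'⟩ := hl' q hq
    have := hlt B C h hB
    refine hq'.trans_lt ?_
    dsimp only
    gcongr
  · intro p hp
    rcases List.mem_append.1 hp with hp | hp
    · obtain ⟨h1, B, C, h, hB, hq'⟩ := hl' p hp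
      have := hlt B C h hB
      refine ⟨h1, S, T, hS, hS0, hq'.trans ?_⟩
      gcongr
    · rw [List.mem_singleton] at hp
      subst hp
      have := hSu.arg_pos
      refine ⟨?_, S, T, hS, hS0, le_rfl⟩
      dsimp only
      have : 0 < (w (cls v S)).arg / Real.pi := by positivity
      linarith

end AbstractHeart

theorem sum_map_filter_add {α : Type*} {M : Type*} [AddCommMonoid M] (l : List α) (f : α → M)
    (p q : α → Prop) [DecidablePred p] [DecidablePred q] (hpq : ∀ x, q x ↔ ¬ p x) :
    (l.map f).sum = ((l.filter fun x => p x).map f).sum + ((l.filter fun x => q x).map f).sum := by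
  induction l with
  | nil => simp
  | cons a l ih =>
    by_cases h : p a
    · have h' : ¬ q a := by rw [hpq]; simpa using h
      simp [h, h', ih, add_assoc]
    · have h' : q a := by rw [hpq]; exact h
      simp [h, h', ih, add_left_comm]

theorem norm_sum_map_le {α E : Type*} [SeminormedAddCommGroup E] (l : List α) (f : α → E)
    (g : α → ℝ) (h : ∀ x ∈ l, ‖f x‖ ≤ g x) : ‖(l.map f).sum‖ ≤ (l.map g).sum := by
  induction l with
  | nil => simp
  | cons a l ih =>
    simp only [List.mem_cons, forall_eq_or_imp] at h
    simp only [List.map_cons, List.sum_cons]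
    exact (norm_add_le _ _).trans (add_le_add h.1 (ih h.2))

theorem sum_map_filter_le {α : Type*} (l : List α) (f : α → ℝ) (hf : ∀ x ∈ l, 0 ≤ f x)
    (p : α → Bool) : ((l.filter p).map f).sum ≤ (l.map f).sum := by
  induction l with
  | nil => simp
  | cons a l ih =>
    simp only [List.mem_cons, forall_eq_or_imp] at hf
    by_cases h : p a
    · simpa [List.filter_cons, h] using ih hf.2
    · simp only [List.filter_cons, h, List.map_cons, List.sum_cons]
      have := ih hf.2
      simp
      linarith [hf.1]

/-! ### Mass estimates for subobjects and for pairs of stability conditions. -/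

section Mass

variable {D : Type u} [Category.{w} D] [HasZeroObject D] [HasShift D ℤ] [Preadditive D]
  [∀ n : ℤ, (shiftFunctor D n).Additive] [Pretriangulated D]
  {Λ : Type*} [AddCommGroup Λ] {v : K₀ D →+ Λ}

/-- The sum of the absolute values of the central charges of the members of a list. -/
def massList (v : K₀ D →+ Λ) (Z : Λ →ₗ[ℤ] ℂ) (l : List (ℝ × D)) : ℝ :=
  (l.map fun p => ‖Z (cls v p.2)‖).sum

theorem massList_nonneg (Z : Λ →ₗ[ℤ] ℂ) (l : List (ℝ × D)) : 0 ≤ massList v Z l :=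
  List.sum_nonneg (by
    simp only [List.mem_map]
    rintro _ ⟨p, _, rfl⟩
    exact norm_nonneg _)

/-- The list of phases and central charges. -/
def chargeList (v : K₀ D →+ Λ) (Z : Λ →ₗ[ℤ] ℂ) (l : List (ℝ × D)) : List (ℝ × ℂ) :=
  l.map fun p => (p.1, Z (cls v p.2))

theorem height_chargeList (Z : Λ →ₗ[ℤ] ℂ) {P : ℝ → ObjectProperty D} {l : List (ℝ × D)} {θ : ℝ}
    {X : D} (h : HNChain P (l.filter fun p => θ < p.1) X) :
    height (chargeList v Z l) θ = imRot θ (Z (cls v X)) := by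
  rw [h.map_cls_eq_sum, linear_sum_map, height, chargeList, List.map_map]
  clear h
  induction l with
  | nil => simp
  | cons a l ih =>
    by_cases h : θ < a.1
    · simp only [List.map_cons, List.sum_cons, ih, List.filter_cons, h, Function.comp_apply]
      simp
    · simp only [List.map_cons, List.sum_cons, ih, List.filter_cons, h, Function.comp_apply]
      simp

theorem massList_eq (Z : Λ →ₗ[ℤ] ℂ) (l : List (ℝ × D)) :
    ((chargeList v Z l).map fun p => ‖p.2‖).sum = massList v Z l := by
  simp [chargeList, massList, Function.comp_def]

theorem HNChain.sum_chargeList (Z : Λ →ₗ[ℤ] ℂ) {P : ℝ → ObjectProperty D} {l : List (ℝ × D)}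
    {E : D} (h : HNChain P l E) :
    ((chargeList v Z l).map fun p => p.2).sum = Z (cls v E) := by
  simp [chargeList, Function.comp_def, h.map_cls_eq_sum]

namespace PreStabilityCondition

theorem mass_eq_massList (σ : PreStabilityCondition v) (E : D) :
    σ.mass E = massList v σ.Z (σ.hn E).list := σ.mass_eq_sum E

variable {σ : PreStabilityCondition v}

theorem onRay_chargeList {E : D} {l : List (ℝ × D)} (h : HNChain σ.P l E) :
    ∀ p ∈ chargeList v σ.Z l, OnRay p.1 p.2 := by
  intro p hp
  obtain ⟨q, hq, rfl⟩ := List.mem_map.1 hp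
  exact onRay_of_chain h q hq

variable [IsTriangulated D]

theorem Heart.phase_chargeList {β : ℝ} {E : D} {l : List (ℝ × D)} (hE : σ.Heart β E)
    (h : HNChain σ.P l E) (W : Λ →ₗ[ℤ] ℂ) : ∀ p ∈ chargeList v W l, β < p.1 ∧ p.1 ≤ β + 1 := by
  intro p hp
  obtain ⟨q, hq, rfl⟩ := List.mem_map.1 hp
  exact ⟨h.gt_iff.1 hE.1 q hq, h.le_iff.1 hE.2 q hq⟩

/-- Every truncation of `S` is a subobject of `E` to which `imRot_le_of_tri` applies, so the polygon
of `S` lies below that of `E`; integrate. This is the estimate behind the finiteness of subobject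
classes. -/
theorem massList_sub_reRot_le {β : ℝ} {S E T : D} {lS lE : List (ℝ × D)} (hE : σ.Heart β E)
    (h : IsSub (σ.Heart β) S E T) (hS : HNChain σ.P lS S) (hl : HNChain σ.P lE E) :
    massList v σ.Z lS - reRot β (σ.Z (cls v S)) ≤
      massList v σ.Z lE - reRot β (σ.Z (cls v E)) := by
  have := sum_norm_sub_reRot_le (β := β) (ε := 0) (onRay_chargeList hl) (hE.phase_chargeList hl _)
    (onRay_chargeList hS) (h.left.phase_chargeList hS _) (fun θ h1 h2 => by
      obtain ⟨X, Y, hT, hX, hY⟩ := hS.exists_tri_filter θ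
      obtain ⟨X', Y', hT', hX', hY'⟩ := hl.exists_tri_filter θ
      rw [height_chargeList _ hX, height_chargeList _ hX', add_zero]
      obtain ⟨Q, hQ, hQ'⟩ := hT.comp h.tri
      have hX1 : σ.GT θ X := .of_chain hX (by simp)
      have hY1 : σ.LE θ Y := .of_chain hY (by simp)
      exact imRot_le_of_tri (β := β) hQ (hX1.anti h1) (.ext hQ' (hY1.mono h2) h.right.2) h1 h2 hT'
        (.of_chain hX' (by simp)) (.of_chain hY' (by simp)))
  simpa [massList_eq, hl.sum_chargeList, hS.sum_chargeList] using this

/-- Truncation triangles are unique. -/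
theorem nonempty_iso_of_trunc {a : ℝ} {X E Y X' Y' : D} (h : Tri X E Y) (hX : σ.GT a X)
    (hY : σ.LE a Y) (h' : Tri X' E Y') (hX' : σ.GT a X') (hY' : σ.LE a Y') :
    Nonempty (X ≅ X') ∧ Nonempty (Y ≅ Y') := by
  obtain ⟨f, f', f'', hf⟩ := h
  obtain ⟨x, x', x'', hx⟩ := h'
  obtain ⟨g, hg⟩ := exists_lift hx f (hX.hom_eq_zero hY' _)
  obtain ⟨R, hR, hR'⟩ := exists_tri_of_comp hf hx g hg
  have h0 : IsZero R := GT.isZero (.right hR hX' (hX.anti (by linarith)))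
    (.left hR' hY (hY'.mono (by linarith)))
  exact ⟨hR.nonempty_iso_left h0, hR'.nonempty_iso_right h0⟩

variable {τ : PreStabilityCondition v}

/-- The truncations of `E` by `τ` are admissible subobjects for `σ`, so their heights under `σ.Z`
lie below the polygon of `σ`. Passing from `σ.Z` to `τ.Z` costs at most κ times the `τ`-mass in each
height, hence π times that after integration, and once more in the real part: together π + 1. -/
theorem massList_le_of_heart {β κ : ℝ} {E : D} {l l' : List (ℝ × D)} (hκ : 0 ≤ κ)
    (hE : σ.Heart β E) (hE' : τ.Heart β E)
    (h1 : ∀ F, τ.GT β F → σ.GT β F) (h2 : ∀ F, τ.LE (β + 1) F → σ.LE (β + 1) F)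
    (hZ : ∀ φ F, τ.P φ F → ‖τ.Z (cls v F) - σ.Z (cls v F)‖ ≤ κ * ‖τ.Z (cls v F)‖)
    (hl : HNChain σ.P l E) (hl' : HNChain τ.P l' E) :
    massList v τ.Z l' ≤ massList v σ.Z l + (Real.pi + 1) * κ * massList v τ.Z l' := by
  have hdiff : ∀ (p : ℝ × D → Bool) (X : D), HNChain τ.P (l'.filter p) X →
      ‖τ.Z (cls v X) - σ.Z (cls v X)‖ ≤ κ * massList v τ.Z l' := by
    intro p X hX
    rw [← LinearMap.sub_apply, hX.map_cls_eq_sum]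
    refine (norm_sum_map_le _ _ (fun p => κ * ‖τ.Z (cls v p.2)‖)
      fun p hp => hZ p.1 p.2 (hX.mem p hp)).trans ?_
    rw [List.sum_map_mul_left]
    exact mul_le_mul_of_nonneg_left (sum_map_filter_le _ _ (by simp) _) hκ
  have := sum_norm_sub_reRot_le (β := β) (ε := κ * massList v τ.Z l') (onRay_chargeList hl)
    (hE.phase_chargeList hl _) (onRay_chargeList hl') (hE'.phase_chargeList hl' _)
    (fun θ hθ1 hθ2 => by
      obtain ⟨X, Y, hT, hX, hY⟩ := hl'.exists_tri_filter θ
      obtain ⟨X', Y', hT', hX', hY'⟩ := hl.exists_tri_filter θ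
      rw [height_chargeList _ hX, height_chargeList _ hX']
      have hX1 : τ.GT θ X := .of_chain hX (by simp)
      have hY1 : τ.LE θ Y := .of_chain hY (by simp)
      have h3 := imRot_le_of_tri (σ := σ) (β := β) hT (h1 _ (hX1.anti hθ1)) (h2 _ (hY1.mono hθ2))
        hθ1 hθ2 hT' (.of_chain hX' (by simp)) (.of_chain hY' (by simp))
      have h4 := (le_abs_self _).trans
        ((abs_imRot_le θ (τ.Z (cls v X) - σ.Z (cls v X))).trans (hdiff _ X hX))
      rw [map_sub] at h4
      linarith)
  rw [massList_eq, massList_eq, hl.sum_chargeList, hl'.sum_chargeList] at this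
  have h5 : reRot β (τ.Z (cls v E) - σ.Z (cls v E)) ≤ κ * massList v τ.Z l' :=
    (le_abs_self _).trans ((abs_reRot_le β _).trans (hdiff (fun _ => true) E (by simpa using hl')))
  rw [map_sub] at h5
  linarith

theorem massList_filter_add (Z : Λ →ₗ[ℤ] ℂ) (l : List (ℝ × D)) (a : ℝ) :
    massList v Z l = massList v Z (l.filter fun p => a < p.1) +
      massList v Z (l.filter fun p => p.1 ≤ a) :=
  sum_map_filter_add _ _ _ _ fun _ => not_lt.symm

/-- The slicings have the same truncations at the levels α + n, so `E` is cut into pieces from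
common hearts. Each piece obeys `massList_le_of_heart`, and masses add up. -/
theorem massList_le {α κ : ℝ} (hκ : 0 ≤ κ)
    (h1 : ∀ (n : ℤ) F, τ.GT (α + n) F ↔ σ.GT (α + n) F)
    (h2 : ∀ (n : ℤ) F, τ.LE (α + n) F ↔ σ.LE (α + n) F)
    (hZ : ∀ φ F, τ.P φ F → ‖τ.Z (cls v F) - σ.Z (cls v F)‖ ≤ κ * ‖τ.Z (cls v F)‖)
    {E : D} {l l' : List (ℝ × D)} (hl : HNChain σ.P l E) (hl' : HNChain τ.P l' E) :
    massList v τ.Z l' ≤ massList v σ.Z l + (Real.pi + 1) * κ * massList v τ.Z l' := by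
  have key : ∀ (n : ℤ) (k : ℕ) (E : D) (l l' : List (ℝ × D)), σ.GT (α + n) E →
      σ.LE (α + n + k) E → HNChain σ.P l E → HNChain τ.P l' E →
      massList v τ.Z l' ≤ massList v σ.Z l + (Real.pi + 1) * κ * massList v τ.Z l' := by
    intro n k
    induction k with
    | zero =>
      intro E l l' hE hE' hl hl'
      have h0 := hE.isZero (by simpa using hE')
      have := hl'.eq_nil_of_isZero h0
      subst this
      simpa [massList] using massList_nonneg (v := v) σ.Z l
    | succ k ih =>
      intro E l l' hE hE' hl hl'
      obtain ⟨X, Y, hT, hX, hY⟩ := hl.exists_tri_filter (α + n + k)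
      obtain ⟨X', Y', hT', hX', hY'⟩ := hl'.exists_tri_filter (α + n + k)
      have hX1 : σ.GT (α + n + k) X := .of_chain hX (by simp)
      have hY1 : σ.LE (α + n + k) Y := .of_chain hY (by simp)
      have e : α + n + k = α + ((n + k : ℤ) : ℝ) := by push_cast; ring
      have e' : α + n + k + 1 = α + ((n + k + 1 : ℤ) : ℝ) := by push_cast; ring
      have hX1' : σ.GT (α + n + k) X' := by
        have : τ.GT (α + n + k) X' := .of_chain hX' (by simp)
        rw [e] at this ⊢
        exact (h1 _ _).1 this
      have hY1' : σ.LE (α + n + k) Y' := by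
        have : τ.LE (α + n + k) Y' := .of_chain hY' (by simp)
        rw [e] at this ⊢
        exact (h2 _ _).1 this
      obtain ⟨⟨e1⟩, ⟨e2⟩⟩ := nonempty_iso_of_trunc hT' hX1' hY1' hT hX1 hY1
      have hXle : σ.LE (α + n + k + 1) X := .left hT (by
        push_cast at hE'; rwa [← add_assoc] at hE') (hY1.mono (by linarith))
      have hYgt : σ.GT (α + n) Y := .right hT hE (hX1.anti (by
        have : (0 : ℝ) ≤ k := Nat.cast_nonneg k
        linarith))
      have hA := massList_le_of_heart (β := α + n + k) hκ ⟨hX1, hXle⟩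
        ⟨by rw [e] at hX1 ⊢; exact (h1 _ _).2 hX1, by rw [e'] at hXle ⊢; exact (h2 _ _).2 hXle⟩
        (fun F hF => by rw [e] at hF ⊢; exact (h1 _ _).1 hF)
        (fun F hF => by rw [e'] at hF ⊢; exact (h2 _ _).1 hF) hZ hX (hX'.of_iso e1)
      have hB := ih Y _ _ hYgt hY1 hY (hY'.of_iso e2)
      rw [massList_filter_add τ.Z l' (α + n + k), massList_filter_add σ.Z l (α + n + k)]
      linarith
  obtain ⟨M, hM⟩ : ∃ M : ℝ, ∀ p ∈ l, |p.1 - α| < M := by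
    clear hl
    induction l with
    | nil => exact ⟨0, by simp⟩
    | cons a l ih =>
      obtain ⟨M, hM⟩ := ih
      refine ⟨max M (|a.1 - α| + 1), ?_⟩
      simp only [List.mem_cons, forall_eq_or_imp]
      exact ⟨lt_max_of_lt_right (by linarith), fun p hp => lt_max_of_lt_left (hM p hp)⟩
  obtain ⟨N, hN⟩ := exists_nat_gt M
  refine key (-N) (2 * N) E l l' (.of_chain hl fun p hp => ?_) (.of_chain hl fun p hp => ?_) hl hl'
  · have := abs_lt.1 (hM p hp)
    push_cast
    linarith [this.1]
  · have := abs_lt.1 (hM p hp)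
    push_cast
    linarith [this.2]

end PreStabilityCondition

end Mass

/-! ### How far a perturbation with one fixed component moves a phase. -/

section Drift

open Real

theorem imRot_add (β b : ℝ) (x : ℂ) :
    imRot (β + b) x = cos (π * b) * imRot β x - sin (π * b) * reRot β x := by
  simp only [imRot_apply, reRot_apply, mul_add, cos_add, sin_add]
  ring

/-- Multiplication by `exp (-iπβ)`. -/
def rotC (β : ℝ) : ℂ →+ ℂ where
  toFun x := ⟨reRot β x, imRot β x⟩
  map_zero' := by apply Complex.ext <;> simp
  map_add' x y := by apply Complex.ext <;> simp

@[simp] theorem rotC_re (β : ℝ) (x : ℂ) : (rotC β x).re = reRot β x := rfl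

@[simp] theorem rotC_im (β : ℝ) (x : ℂ) : (rotC β x).im = imRot β x := rfl

theorem cross_rotC (β : ℝ) (x y : ℂ) : cross (rotC β x) (rotC β y) = cross x y := by
  simp only [cross, rotC_re, rotC_im, imRot_apply, reRot_apply]
  linear_combination (x.re * y.im - x.im * y.re) * sin_sq_add_cos_sq (π * β)

theorem onRay_rotC {β φ : ℝ} {x : ℂ} (h : OnRay φ (rotC β x)) : OnRay (β + φ) x := by
  rw [onRay_iff] at *
  have e1 : reRot (β + φ) x = reRot φ (rotC β x) := by
    rw [reRot_apply φ, rotC_re, rotC_im]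
    simp only [imRot_apply, reRot_apply, mul_add, cos_add, sin_add]
    ring
  have e2 : imRot (β + φ) x = imRot φ (rotC β x) := by
    rw [imRot_apply φ, rotC_re, rotC_im]
    simp only [imRot_apply, reRot_apply, mul_add, cos_add, sin_add]
    ring
  rwa [e1, e2]

theorem Upper.exists_onRay {β : ℝ} {x : ℂ} (h : Upper (rotC β x)) :
    ∃ ψ, β < ψ ∧ ψ ≤ β + 1 ∧ OnRay ψ x := by
  have hpi := Real.pi_pos
  refine ⟨β + (rotC β x).arg / π, ?_, ?_, onRay_rotC h.onRay⟩
  · have := div_pos h.arg_pos hpi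
    linarith
  · have := (div_le_one hpi).2 (Complex.arg_le_pi (rotC β x))
    linarith

theorem OnRay.cross_eq {φ : ℝ} {y : ℂ} (h : OnRay φ y) (x : ℂ) :
    cross x y = -(‖y‖ * BridgelandStab.imRot φ x) := by
  obtain ⟨r, hr, rfl⟩ := h
  rw [norm_ray hr.le, cross, ray_re, ray_im, imRot_apply]
  ring

theorem OnRay.cross_nonneg_iff {φ : ℝ} {y : ℂ} (h : OnRay φ y) (x : ℂ) :
    0 ≤ cross x y ↔ BridgelandStab.imRot φ x ≤ 0 := by
  rw [h.cross_eq]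
  have := h.norm_pos
  constructor
  · intro h
    by_contra! h'
    nlinarith [mul_pos this h']
  · intro h
    nlinarith

theorem sin_mul_pi_le {ε u : ℝ} (h0 : 0 ≤ ε) (h1 : ε ≤ u) (h2 : u ≤ 1 - ε) :
    sin (π * ε) ≤ sin (π * u) := by
  have hpi := Real.pi_pos
  rcases le_total u (1 / 2) with h | h
  · exact Real.sin_le_sin_of_le_of_le_pi_div_two (by nlinarith) (by nlinarith) (by nlinarith)
  · rw [← Real.sin_pi_sub (π * u)]
    exact Real.sin_le_sin_of_le_of_le_pi_div_two (by nlinarith) (by nlinarith) (by nlinarith)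

theorem sin_le_cos_of_le {ε : ℝ} (h0 : 0 ≤ ε) (h1 : ε ≤ 1 / 4) : sin (π * ε) ≤ cos (π * ε) := by
  have hpi := Real.pi_pos
  rw [← Real.sin_pi_div_two_sub]
  exact Real.sin_le_sin_of_le_of_le_pi_div_two (by nlinarith) (by nlinarith) (by nlinarith)

/-- A perturbation of `z` that keeps the imaginary part moves the phase by at most `ε`. -/
theorem OnRay.imRot_neg_of_close {β φ ψ ε η : ℝ} {z w : ℂ} (h : OnRay φ z) (hβ : β < φ)
    (him : BridgelandStab.imRot β w = BridgelandStab.imRot β z) (hw : ‖w - z‖ ≤ η * ‖z‖)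
    (hη : η < sin (π * ε)) (hε : 0 < ε) (hε' : ε ≤ 1 / 4) (hψ' : ψ ≤ β + 1)
    (hlt : φ + ε < ψ) : BridgelandStab.imRot ψ w < 0 := by
  have hpi := Real.pi_pos
  have hr := h.norm_pos
  set d := BridgelandStab.reRot β (w - z) with hd
  have hd' := (abs_le.1 ((abs_reRot_le β (w - z)).trans hw)).1
  -- The displacement `w - z` is parallel to the direction β, so its height in direction ψ is
  -- −sin(π(ψ−β)) times its length `d` along β.
  have e : BridgelandStab.imRot ψ w = BridgelandStab.imRot ψ z - sin (π * (ψ - β)) * d := by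
    obtain ⟨b, rfl⟩ : ∃ b, ψ = β + b := ⟨ψ - β, by ring⟩
    rw [imRot_add, imRot_add, him, hd, map_sub, add_sub_cancel_left]
    ring
  have hsin : 0 ≤ sin (π * (ψ - β)) :=
    Real.sin_nonneg_of_nonneg_of_le_pi (by nlinarith) (by nlinarith)
  rw [e, h.imRot]
  have e2 : sin (π * (φ - ψ)) = -sin (π * (ψ - φ)) := by rw [← Real.sin_neg]; ring_nf
  rw [e2]
  rcases le_or_gt (ψ - φ) (1 - ε) with hu | hu
  · have h1 := sin_mul_pi_le hε.le (by linarith : ε ≤ ψ - φ) hu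
    have h2 := Real.sin_le_one (π * (ψ - β))
    have h3 : -(η * ‖z‖) ≤ sin (π * (ψ - β)) * d ∨ 0 ≤ sin (π * (ψ - β)) * d := by
      rcases le_total 0 d with hd0 | hd0
      · right; positivity
      · left; nlinarith
    have h4 : 0 < ‖z‖ * (sin (π * (ψ - φ)) - η) := mul_pos hr (by linarith)
    have h5 : 0 < ‖z‖ * sin (π * (ψ - φ)) := mul_pos hr (by
      refine lt_of_lt_of_le (Real.sin_pos_of_pos_of_lt_pi ?_ ?_) h1 <;> nlinarith)
    rcases h3 with h3 | h3 <;> nlinarith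
  -- Now φ is within ε of β and ψ within ε of β + 1, so sin(π(ψ−φ)) may be small. After expansion
  -- about β, the first term absorbs the displacement, since cos(π(φ−β)) ≥ cos(πε) ≥ sin(πε) > η,
  -- and the second is strictly positive.
  · have e3 : sin (π * (ψ - φ)) = sin (π * (ψ - β)) * cos (π * (φ - β)) -
        cos (π * (ψ - β)) * sin (π * (φ - β)) := by rw [← Real.sin_sub]; ring_nf
    have h1 : cos (π * ε) ≤ cos (π * (φ - β)) :=
      Real.cos_le_cos_of_nonneg_of_le_pi (by nlinarith) (by nlinarith) (by nlinarith)
    have h2 := sin_le_cos_of_le hε.le hε'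
    have h3 : cos (π * (ψ - β)) < 0 :=
      Real.cos_neg_of_pi_div_two_lt_of_lt (by nlinarith) (by nlinarith)
    have h4 : 0 < sin (π * (φ - β)) :=
      Real.sin_pos_of_pos_of_lt_pi (by nlinarith) (by nlinarith)
    rw [e3]
    have h5 : 0 ≤ sin (π * (ψ - β)) * (d + η * ‖z‖) := mul_nonneg hsin (by linarith)
    have h6 : 0 ≤ sin (π * (ψ - β)) * (‖z‖ * (cos (π * (φ - β)) - η)) :=
      mul_nonneg hsin (mul_nonneg hr.le (by linarith))
    have h7 : 0 < ‖z‖ * (-cos (π * (ψ - β)) * sin (π * (φ - β))) :=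
      mul_pos hr (mul_pos (by linarith) h4)
    nlinarith

theorem OnRay.imRot_pos_of_close {β φ ψ ε η : ℝ} {z w : ℂ} (h : OnRay φ z)
    (hβ' : φ ≤ β + 1)
    (him : BridgelandStab.imRot β w = BridgelandStab.imRot β z) (hw : ‖w - z‖ ≤ η * ‖z‖)
    (hη : η < sin (π * ε)) (hε : 0 < ε) (hε' : ε ≤ 1 / 4) (hψ : β < ψ)
    (hlt : ψ < φ - ε) : 0 < BridgelandStab.imRot ψ w := by
  have hpi := Real.pi_pos
  have hr := h.norm_pos
  set d := BridgelandStab.reRot β (w - z) with hd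
  have hd' := (abs_le.1 ((abs_reRot_le β (w - z)).trans hw)).2
  have e : BridgelandStab.imRot ψ w = BridgelandStab.imRot ψ z - sin (π * (ψ - β)) * d := by
    obtain ⟨b, rfl⟩ : ∃ b, ψ = β + b := ⟨ψ - β, by ring⟩
    rw [imRot_add, imRot_add, him, hd, map_sub, add_sub_cancel_left]
    ring
  have hsin : 0 < sin (π * (ψ - β)) :=
    Real.sin_pos_of_pos_of_lt_pi (by nlinarith) (by nlinarith)
  rw [e, h.imRot]
  rcases le_or_gt (φ - ψ) (1 - ε) with hu | hu
  · have h1 := sin_mul_pi_le hε.le (by linarith : ε ≤ φ - ψ) hu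
    have h2 := Real.sin_le_one (π * (ψ - β))
    have h3 : sin (π * (ψ - β)) * d ≤ (η * ‖z‖) ∨ sin (π * (ψ - β)) * d ≤ 0 := by
      rcases le_total d 0 with hd0 | hd0
      · right; nlinarith
      · left; nlinarith
    have h4 : 0 < ‖z‖ * (sin (π * (φ - ψ)) - η) := mul_pos hr (by linarith)
    have h5 : 0 < ‖z‖ * sin (π * (φ - ψ)) := mul_pos hr (by
      refine lt_of_lt_of_le (Real.sin_pos_of_pos_of_lt_pi ?_ ?_) h1 <;> nlinarith)
    rcases h3 with h3 | h3 <;> nlinarith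
  · have e3 : sin (π * (φ - ψ)) = sin (π * (φ - β)) * cos (π * (ψ - β)) -
        cos (π * (φ - β)) * sin (π * (ψ - β)) := by rw [← Real.sin_sub]; ring_nf
    have h1 : cos (π * ε) ≤ -cos (π * (φ - β)) := by
      rw [← Real.cos_pi_sub]
      exact Real.cos_le_cos_of_nonneg_of_le_pi (by nlinarith) (by nlinarith) (by nlinarith)
    have h2 := sin_le_cos_of_le hε.le hε'
    have h3 : 0 ≤ cos (π * (ψ - β)) :=
      Real.cos_nonneg_of_neg_pi_div_two_le_of_le (by nlinarith) (by nlinarith)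
    have h4 : 0 ≤ sin (π * (φ - β)) :=
      Real.sin_nonneg_of_nonneg_of_le_pi (by nlinarith) (by nlinarith)
    rw [e3]
    have h5 : 0 ≤ sin (π * (ψ - β)) * (η * ‖z‖ - d) := mul_nonneg hsin.le (by linarith)
    have h6 : 0 < sin (π * (ψ - β)) * (‖z‖ * (-cos (π * (φ - β)) - η)) :=
      mul_pos hsin (mul_pos hr (by linarith))
    have h7 : 0 ≤ ‖z‖ * (cos (π * (ψ - β)) * sin (π * (φ - β))) :=
      mul_nonneg hr.le (mul_nonneg h3 h4)
    nlinarith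

/-- For φ < β + 1 the positive height is unchanged. On the boundary ray φ = β + 1 the height is
zero, and η < 1 keeps the real part negative. -/
theorem OnRay.upper_of_close {β φ η : ℝ} {z w : ℂ} (h : OnRay φ z) (hβ : β < φ)
    (hβ' : φ ≤ β + 1) (him : BridgelandStab.imRot β w = BridgelandStab.imRot β z)
    (hw : ‖w - z‖ ≤ η * ‖z‖) (hη : η < 1) : Upper (rotC β w) := by
  rcases hβ'.lt_or_eq with hlt | rfl
  · left
    rw [rotC_im, him]
    exact h.imRot_pos hβ hlt
  · right
    have hr := h.norm_pos
    rw [rotC_im, rotC_re, him, h.imRot]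
    refine ⟨by simp, ?_⟩
    have h1 := (abs_le.1 ((abs_reRot_le β (w - z)).trans hw)).2
    rw [map_sub, h.reRot] at h1
    simp only [add_sub_cancel_left, mul_one, Real.cos_pi] at h1
    nlinarith

end Drift

theorem seminorm_sum_map_le {Λ α : Type*} [AddCommGroup Λ] (N : AddGroupSeminorm Λ) (l : List α)
    (f : α → Λ) (g : α → ℝ) (h : ∀ x ∈ l, N (f x) ≤ g x) : N (l.map f).sum ≤ (l.map g).sum := by
  induction l with
  | nil => simp
  | cons a l ih =>
    simp only [List.mem_cons, forall_eq_or_imp] at h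
    simp only [List.map_cons, List.sum_cons]
    exact (map_add_le_add N _ _).trans (add_le_add h.1 (ih h.2))

theorem upper_sum_map {α : Type*} (l : List α) (f : α → ℂ) (h : ∀ x ∈ l, Upper (f x))
    (hl : l ≠ []) : Upper (l.map f).sum := by
  induction l with
  | nil => exact absurd rfl hl
  | cons a l ih =>
    simp only [List.mem_cons, forall_eq_or_imp] at h
    simp only [List.map_cons, List.sum_cons]
    rcases eq_or_ne l [] with rfl | hl'
    · simpa using h.1
    · exact h.1.add (ih h.2 hl')

theorem sum_map_pos {α : Type*} (l : List α) (f : α → ℝ) (h : ∀ x ∈ l, 0 < f x)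
    (hl : l ≠ []) : 0 < (l.map f).sum := by
  induction l with
  | nil => exact absurd rfl hl
  | cons a l ih =>
    simp only [List.mem_cons, forall_eq_or_imp] at h
    simp only [List.map_cons, List.sum_cons]
    rcases eq_or_ne l [] with rfl | hl'
    · simpa using h.1
    · exact add_pos h.1 (ih h.2 hl')

/-! ### Locating a phase in its interval of α + ℤ. -/

section Base

/-- The largest `β ∈ α + ℤ` with `β < φ`. -/
def base (α φ : ℝ) : ℝ := α + ((⌈φ - α⌉ - 1 : ℤ) : ℝ)

theorem base_lt (α φ : ℝ) : base α φ < φ := by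
  have := Int.ceil_lt_add_one (φ - α)
  simp only [base]
  push_cast
  linarith

theorem le_base_add_one (α φ : ℝ) : φ ≤ base α φ + 1 := by
  have := Int.le_ceil (φ - α)
  simp only [base]
  push_cast
  linarith

theorem base_add_one (α φ : ℝ) : base α (φ + 1) = base α φ + 1 := by
  simp only [base]
  rw [show φ + 1 - α = φ - α + 1 by ring, Int.ceil_add_one]
  push_cast
  ring

theorem base_eq {α φ : ℝ} {n : ℤ} (h1 : α + n < φ) (h2 : φ ≤ α + n + 1) : base α φ = α + n := by
  have : ⌈φ - α⌉ = n + 1 := by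
    rw [Int.ceil_eq_iff]
    push_cast
    constructor <;> linarith
  simp [base, this]

theorem le_base {α φ : ℝ} {n : ℤ} (h : α + n < φ) : α + n ≤ base α φ := by
  have : (n : ℝ) < ⌈φ - α⌉ := lt_of_lt_of_le (by linarith) (Int.le_ceil _)
  have : n ≤ ⌈φ - α⌉ - 1 := by
    have := Int.cast_lt.1 this
    omega
  simp only [base]
  have := (Int.cast_le (R := ℝ)).2 this
  linarith

theorem base_add_one_le {α φ : ℝ} {n : ℤ} (h : φ ≤ α + n) : base α φ + 1 ≤ α + n := by
  have : ⌈φ - α⌉ ≤ n := Int.ceil_le.2 (by linarith)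
  have := (Int.cast_le (R := ℝ)).2 this
  simp only [base]
  push_cast
  linarith

theorem base_eq_or_add_one_le {α φ ψ : ℝ} (h : φ < ψ) :
    base α φ = base α ψ ∨ base α φ + 1 ≤ base α ψ := by
  have h1 : ⌈φ - α⌉ ≤ ⌈ψ - α⌉ := Int.ceil_mono (by linarith)
  rcases h1.eq_or_lt with h1 | h1
  · left; simp [base, h1]
  · right
    have h2 : ⌈φ - α⌉ + 1 ≤ ⌈ψ - α⌉ := h1
    have := (Int.cast_le (R := ℝ)).2 h2
    simp only [base]
    push_cast at this ⊢
    linarith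

theorem imRot_add_int (α : ℝ) (n : ℤ) {x y : ℂ} (h : imRot α x = imRot α y) :
    imRot (α + n) x = imRot (α + n) y := by
  have : Real.sin (Real.pi * n) = 0 := by rw [mul_comm]; exact Real.sin_int_mul_pi n
  rw [imRot_add, imRot_add, this, h]
  ring

end Base

/-! ### The deformed slicing and its Harder–Narasimhan property. -/

section Deformation

variable {D : Type u} [Category.{w} D] [HasZeroObject D] [HasShift D ℤ] [Preadditive D]
  [∀ n : ℤ, (shiftFunctor D n).Additive] [Pretriangulated D]
  {Λ : Type*} [AddCommGroup Λ] {v : K₀ D →+ Λ}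

/-- `W` is a small deformation of the central charge of `σ`, in the direction of phase `α`. -/
structure Deformation (σ : PreStabilityCondition v) (α : ℝ) (W : Λ →ₗ[ℤ] ℂ)
    (N : AddGroupSeminorm Λ) (C δ ε : ℝ) : Prop where
  im_eq : ∀ x, imRot α (W x) = imRot α (σ.Z x)
  finite : ∀ R, {x | N x ≤ R}.Finite
  norm_le : ∀ φ E, σ.P φ E → N (cls v E) ≤ C * ‖σ.Z (cls v E)‖
  close : ∀ x, ‖W x - σ.Z x‖ ≤ δ * N x
  C_nonneg : 0 ≤ C
  δ_nonneg : 0 ≤ δ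
  ε_pos : 0 < ε
  ε_le : ε ≤ 1 / 4
  lt_sin : δ * C < Real.sin (Real.pi * ε)
  le_fifth : δ * C ≤ 1 / 5

/-- The objects of phase `φ` of the deformed stability condition. -/
def slopeP (σ : PreStabilityCondition v) (α : ℝ) (W : Λ →ₗ[ℤ] ℂ) (φ : ℝ) : ObjectProperty D :=
  fun E => SlopeSemistable v (σ.Heart (base α φ)) W E ∧ (IsZero E ∨ OnRay φ (W (cls v E)))

open PreStabilityCondition

theorem PreStabilityCondition.heart_shift_iff {σ : PreStabilityCondition v} {β : ℝ} {E : D} :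
    σ.Heart (β + 1) (E⟦(1 : ℤ)⟧) ↔ σ.Heart β E :=
  and_congr gt_shift_iff le_shift_iff

theorem PreStabilityCondition.Heart.neg_shift {σ : PreStabilityCondition v} {β : ℝ} {E : D}
    (h : σ.Heart (β + 1) E) : σ.Heart β (E⟦(-1 : ℤ)⟧) :=
  ⟨by simpa using gt_neg_shift h.1, by simpa using le_neg_shift h.2⟩

theorem cls_neg_shift (E : D) : cls v (E⟦(-1 : ℤ)⟧) = -cls v E := by
  rw [eq_neg_iff_add_eq_zero, ← cls_iso (v := v) (shiftNegShift E (1 : ℤ)), cls_shift]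
  simp

theorem slopeSemistable_shift_iff {σ : PreStabilityCondition v} {β : ℝ} {W : Λ →ₗ[ℤ] ℂ} {E : D} :
    SlopeSemistable v (σ.Heart (β + 1)) W (E⟦(1 : ℤ)⟧) ↔
      SlopeSemistable v (σ.Heart β) W E := by
  have hc : ∀ x y, cross (-x) (-y) = cross x y := by intro x y; simp [cross]
  constructor
  · rintro ⟨h1, h2⟩
    refine ⟨heart_shift_iff.1 h1, fun S T h => ?_⟩
    have := h2 (S⟦(1 : ℤ)⟧) (T⟦(1 : ℤ)⟧)
      ⟨h.tri.shift 1, heart_shift_iff.2 h.left, heart_shift_iff.2 h.right⟩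
    rwa [cls_shift, cls_shift, map_neg, map_neg, hc] at this
  · rintro ⟨h1, h2⟩
    refine ⟨heart_shift_iff.2 h1, fun S T h => ?_⟩
    have := h2 (S⟦(-1 : ℤ)⟧) (T⟦(-1 : ℤ)⟧)
      ⟨(h.tri.shift (-1)).of_iso (Iso.refl _) (shiftShiftNeg E 1).symm (Iso.refl _),
        h.left.neg_shift, h.right.neg_shift⟩
    rw [cls_neg_shift] at this
    rw [cls_shift, map_neg]
    rw [map_neg] at this
    simpa [cross] using this

theorem slopeSemistable_iso {A : D → Prop} (hA : ∀ X Y, (X ≅ Y) → A X → A Y) {W : Λ → ℂ} {E F : D}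
    (e : E ≅ F) (h : SlopeSemistable v A W E) : SlopeSemistable v A W F := by
  refine ⟨hA _ _ e h.1, fun S T hS => ?_⟩
  rw [← cls_iso e]
  exact h.2 S T ⟨hS.tri.of_iso (Iso.refl _) e (Iso.refl _), hS.left, hS.right⟩

theorem slopeP_shift_iff {σ : PreStabilityCondition v} {α : ℝ} {W : Λ →ₗ[ℤ] ℂ} (φ : ℝ) (E : D) :
    slopeP σ α W (φ + 1) (E⟦(1 : ℤ)⟧) ↔ slopeP σ α W φ E := by
  unfold slopeP
  rw [base_add_one, slopeSemistable_shift_iff, cls_shift, map_neg, onRay_neg_iff, isZero_shift_iff]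

namespace Deformation

variable {σ : PreStabilityCondition v} {α : ℝ} {W : Λ →ₗ[ℤ] ℂ} {N : AddGroupSeminorm Λ}
  {C δ ε : ℝ}

/-- The product `δ * C` is the relative error of `W` on semistable objects. The field `lt_sin` turns
it into a phase shift of at most ε, and `le_fifth` lets masses be recovered from the new charge. -/
theorem close_of_mem (h : Deformation σ α W N C δ ε) {φ : ℝ} {E : D} (hE : σ.P φ E) :
    ‖W (cls v E) - σ.Z (cls v E)‖ ≤ δ * C * ‖σ.Z (cls v E)‖ := by
  refine (h.close _).trans ?_
  rw [mul_assoc]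
  exact mul_le_mul_of_nonneg_left (h.norm_le φ E hE) h.δ_nonneg

theorem norm_le_massList (h : Deformation σ α W N C δ ε)
    {E : D} {l : List (ℝ × D)} (hl : HNChain σ.P l E) :
    N (cls v E) ≤ C * massList v σ.Z l := by
  rw [hl.cls_eq_sum]
  refine (seminorm_sum_map_le N l _ (fun p => C * ‖σ.Z (cls v p.2)‖) fun p hp =>
    h.norm_le p.1 p.2 (hl.mem p hp)).trans ?_
  rw [List.sum_map_mul_left]
  rfl

theorem close_massList (h : Deformation σ α W N C δ ε)
    {E : D} {l : List (ℝ × D)} (hl : HNChain σ.P l E) :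
    ‖W (cls v E) - σ.Z (cls v E)‖ ≤ δ * C * massList v σ.Z l := by
  refine (h.close _).trans ?_
  rw [mul_assoc]
  exact mul_le_mul_of_nonneg_left (h.norm_le_massList hl) h.δ_nonneg

theorem im_eq_int (h : Deformation σ α W N C δ ε)
    (n : ℤ) (x : Λ) : imRot (α + n) (W x) = imRot (α + n) (σ.Z x) :=
  imRot_add_int α n (h.im_eq x)

theorem im_eq_base (h : Deformation σ α W N C δ ε)
    (φ : ℝ) (x : Λ) : imRot (base α φ) (W x) = imRot (base α φ) (σ.Z x) :=
  h.im_eq_int _ x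

variable [IsTriangulated D]

theorem upper (h : Deformation σ α W N C δ ε)
    (n : ℤ) {E : D} (hE : σ.Heart (α + n) E) (h0 : ¬ IsZero E) :
    Upper (rotC (α + n) (W (cls v E))) := by
  obtain ⟨l, hl⟩ := σ.exists_chain E
  have hne : l ≠ [] := by
    rintro rfl
    exact h0 hl.isZero_of_nil
  rw [hl.map_cls_eq_sum, map_list_sum, List.map_map]
  refine upper_sum_map l _ (fun p hp => ?_) hne
  exact (onRay_of_chain hl p hp).upper_of_close (hl.gt_iff.1 hE.1 p hp) (hl.le_iff.1 hE.2 p hp)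
    (h.im_eq_int n _) (h.close_of_mem (hl.mem p hp)) (h.le_fifth.trans_lt (by norm_num))

theorem finite_subClasses (h : Deformation σ α W N C δ ε)
    (n : ℤ) {E : D} (hE : σ.Heart (α + n) E) (R : ℝ) :
    (subClasses v (σ.Heart (α + n)) (fun x => rotC (α + n) (W x)) E R).Finite := by
  obtain ⟨lE, hlE⟩ := σ.exists_chain E
  set M := massList v σ.Z lE - reRot (α + n) (σ.Z (cls v E)) with hM
  -- The mass of `S` is at most `M` plus its old real part, hence at most M + R plus one fifth of
  -- itself; solving gives the factor 5/4.
  refine (h.finite (C * ((R + M) * (5 / 4)))).subset ?_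
  rintro _ ⟨S, T, hS, rfl, hre⟩
  obtain ⟨l, hl⟩ := σ.exists_chain S
  have h1 := massList_sub_reRot_le hE hS hl hlE
  have h2 := (abs_le.1 ((abs_reRot_le (α + n) _).trans (h.close_massList hl))).1
  rw [map_sub] at h2
  rw [rotC_re] at hre
  have h3 := massList_nonneg (v := v) σ.Z l
  refine (h.norm_le_massList hl).trans (mul_le_mul_of_nonneg_left ?_ h.C_nonneg)
  have := mul_le_mul_of_nonneg_right h.le_fifth h3
  linarith

/-- If both phases belong to the same heart, a nonzero image of `f` would be a quotient of `E`, of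
phase at least φ₁, and a subobject of `F`, of phase at most φ₂. If the hearts differ, the original
slicing already kills `f`. -/
theorem slopeP_hom_eq_zero (h : Deformation σ α W N C δ ε)
    {φ₁ φ₂ : ℝ} (hφ : φ₂ < φ₁) {E F : D} (hE : slopeP σ α W φ₁ E)
    (hF : slopeP σ α W φ₂ F) (f : E ⟶ F) : f = 0 := by
  rcases base_eq_or_add_one_le (α := α) hφ with hb | hb
  · obtain ⟨⟨hE1, hE2⟩, hE3⟩ := hE
    obtain ⟨⟨hF1, hF2⟩, hF3⟩ := hF
    have b1 := base_lt α φ₂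
    have b2 := le_base_add_one α φ₁
    rw [hb] at hF1 hF2 b1
    rcases hE3 with hE3 | hE3
    · exact hE3.eq_of_src _ _
    rcases hF3 with hF3 | hF3
    · exact hF3.eq_of_tgt _ _
    obtain ⟨K, I, Q, hK, hI, hQ, t1, t2, hf⟩ := hE1.exists_image hF1 f
    apply hf
    by_contra hI0
    obtain ⟨ψ, hψ1, hψ2, hψ⟩ := (h.upper _ hI hI0).exists_onRay
    change base α φ₁ < ψ at hψ1
    change ψ ≤ base α φ₁ + 1 at hψ2
    have c1 := (hE3.cross_nonneg_iff _).1 (hE2 K I ⟨t1, hK, hI⟩)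
    have c2 := (hF3.cross_nonneg_iff _).1 (hF2 I Q ⟨t2, hI, hQ⟩)
    have c3 : imRot φ₁ (W (cls v E)) = 0 := (onRay_iff.1 hE3).2
    rw [cls_tri t1, map_add, map_add] at c3
    have c4 : φ₁ ≤ ψ := by
      by_contra! hlt
      have := hψ.imRot_neg (by linarith) hlt
      linarith
    have c5 : ψ ≤ φ₂ := by
      by_contra! hlt
      have := hψ.imRot_pos hlt (by linarith)
      linarith
    linarith
  · exact GT.hom_eq_zero (hE.1.1.1.anti hb) hF.1.1.2 f

theorem exists_hnChain_heart (h : Deformation σ α W N C δ ε)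
    (n : ℤ) {E : D} (hE : σ.Heart (α + n) E) :
    ∃ l, HNChain (slopeP σ α W) l E ∧ ∀ p ∈ l, α + n < p.1 ∧ p.1 ≤ α + n + 1 := by
  have hpi := Real.pi_pos
  obtain ⟨l, hl, hl'⟩ := exists_hnChain_of_finite (v := v) (A := σ.Heart (α + n))
    (fun X => Heart.of_isZero) (fun X Y Z => Heart.ext)
    ((rotC (α + n)).comp W.toAddMonoidHom) (fun E hE hE0 => h.upper n hE hE0)
    (fun E hE R => h.finite_subClasses n hE R) (slopeP σ α W) (α + n) (fun E hE hE0 => by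
      have hu := h.upper n hE.1 hE0
      have b1 : α + n < α + n + (rotC (α + n) (W (cls v E))).arg / Real.pi := by
        have := div_pos hu.arg_pos hpi
        linarith
      have b2 : α + n + (rotC (α + n) (W (cls v E))).arg / Real.pi ≤ α + n + 1 := by
        have := (div_le_one hpi).2 (Complex.arg_le_pi (rotC (α + n) (W (cls v E))))
        linarith
      refine ⟨?_, Or.inr (onRay_rotC hu.onRay)⟩
      change SlopeSemistable v (σ.Heart (base α (α + n +
        (rotC (α + n) (W (cls v E))).arg / Real.pi))) W E
      rw [base_eq b1 b2]
      exact ⟨hE.1, fun S T hS => by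
        have := hE.2 S T hS
        rw [← cross_rotC (α + n)]
        exact this⟩) E hE
  refine ⟨l, hl, fun p hp => ⟨(hl' p hp).1, ?_⟩⟩
  obtain ⟨-, S, T, hS, hS0, hle⟩ := hl' p hp
  refine hle.trans ?_
  have := (div_le_one hpi).2 (Complex.arg_le_pi
    (((rotC (α + n)).comp W.toAddMonoidHom) (cls v S)))
  linarith

/-- The old slicing cuts `E` at the levels α + n, and the chains of the pieces concatenate because
their phases lie in successive disjoint intervals. -/
theorem exists_hnChain (h : Deformation σ α W N C δ ε)
    (E : D) : ∃ l, HNChain (slopeP σ α W) l E := by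
  have key : ∀ (n : ℤ) (k : ℕ) (E : D), σ.GT (α + n) E → σ.LE (α + n + k) E →
      ∃ l, HNChain (slopeP σ α W) l E ∧ ∀ p ∈ l, p.1 ≤ α + n + k := by
    intro n k
    induction k with
    | zero =>
      intro E hE hE'
      exact ⟨[], .nil (hE.isZero (by simpa using hE')), by simp⟩
    | succ k ih =>
      intro E hE hE'
      obtain ⟨X, Y, hT, hX, hY⟩ := σ.exists_trunc (α + n + k) E
      have e : α + n + k = α + ((n + k : ℤ) : ℝ) := by push_cast; ring
      have hXle : σ.LE (α + n + k + 1) X := .left hT (by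
        push_cast at hE'; rwa [← add_assoc] at hE') (hY.mono (by linarith))
      have hYgt : σ.GT (α + n) Y := .right hT hE (hX.anti (by
        have : (0 : ℝ) ≤ k := Nat.cast_nonneg k
        linarith))
      obtain ⟨l₂, hl₂, hl₂'⟩ := ih Y hYgt hY
      rw [e] at hX hXle hl₂'
      obtain ⟨l₁, hl₁, hl₁'⟩ := h.exists_hnChain_heart (n + k) ⟨hX, hXle⟩
      refine ⟨l₂ ++ l₁, hl₁.append hl₂ hT fun p hp q hq =>
        (hl₂' q hq).trans_lt (hl₁' p hp).1, fun p hp => ?_⟩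
      rw [Nat.cast_add_one, ← add_assoc, e]
      rcases List.mem_append.1 hp with hp | hp
      · linarith [hl₂' p hp]
      · exact (hl₁' p hp).2
  obtain ⟨l, hl⟩ := σ.exists_chain E
  obtain ⟨M, hM⟩ : ∃ M : ℝ, ∀ p ∈ l, |p.1 - α| < M := by
    clear hl
    induction l with
    | nil => exact ⟨0, by simp⟩
    | cons a l ih =>
      obtain ⟨M, hM⟩ := ih
      refine ⟨max M (|a.1 - α| + 1), ?_⟩
      simp only [List.mem_cons, forall_eq_or_imp]
      exact ⟨lt_max_of_lt_right (by linarith), fun p hp => lt_max_of_lt_left (hM p hp)⟩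
  obtain ⟨N, hN⟩ := exists_nat_gt M
  obtain ⟨l', hl', -⟩ := key (-N) (2 * N) E (.of_chain hl fun p hp => by
    have := abs_lt.1 (hM p hp)
    push_cast
    linarith [this.1]) (.of_chain hl fun p hp => by
    have := abs_lt.1 (hM p hp)
    push_cast
    linarith [this.2])
  exact ⟨l', hl'⟩

/-- The deformed pre-stability condition. -/
def deform (h : Deformation σ α W N C δ ε) : PreStabilityCondition v where
  Z := W
  P := slopeP σ α W
  iso_closed φ E F e hE := ⟨slopeSemistable_iso (fun X Y e hX => hX.of_iso e) e hE.1,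
    hE.2.imp (fun h0 => h0.of_iso e.symm) fun hr => by rwa [← cls_iso e]⟩
  zero_mem φ E hE := ⟨⟨.of_isZero hE, fun S T _ => by simp [cls_isZero hE]⟩, Or.inl hE⟩
  shift_iff φ E := slopeP_shift_iff φ E
  hom_eq_zero := fun hφ _ _ hE hF f => h.slopeP_hom_eq_zero hφ hE hF f
  charge_mem_ray := fun hE hE0 => hE.2.resolve_left hE0
  exists_hn E := (h.exists_hnChain E).choose_spec.nonempty_hnFiltration

end Deformation

end Deformation

/-! ### Distance between a stability condition and its deformation. -/

section Closeness

variable {D : Type u} [Category.{w} D] [HasZeroObject D] [HasShift D ℤ] [Preadditive D]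
  [∀ n : ℤ, (shiftFunctor D n).Additive] [Pretriangulated D] [IsTriangulated D]
  {Λ : Type*} [AddCommGroup Λ] {v : K₀ D →+ Λ}

open PreStabilityCondition

namespace Deformation

variable {σ : PreStabilityCondition v} {α : ℝ} {W : Λ →ₗ[ℤ] ℂ} {N : AddGroupSeminorm Λ}
  {C δ ε : ℝ}

/-- Truncate `F` by `σ` at `a`. The factors of the quotient `G` have phases below ψ − ε, so after
the deformation they still lie strictly below the ray ψ; semistability of `F` puts the charge of `G`
on or above that ray, so `G = 0`. -/
theorem gt_of_slopeP (h : Deformation σ α W N C δ ε)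
    {ψ a : ℝ} {F : D} (hF : slopeP σ α W ψ F) (ha : a < ψ - ε) : σ.GT a F := by
  rcases hF.2 with h0 | hray
  · exact .of_isZero h0
  obtain ⟨⟨hF1, hF2⟩, hF3⟩ := hF
  have b1 := base_lt α ψ
  have b2 := le_base_add_one α ψ
  have hε := h.ε_pos
  rcases lt_or_ge a (base α ψ) with hab | hab
  · exact hF1.1.anti hab.le
  obtain ⟨X, G, t, hX, hG⟩ := σ.exists_trunc a F
  have hG' : σ.GT (base α ψ) G := .right t hF1.1 (hX.anti (by linarith))
  have hX' : σ.LE (base α ψ + 1) X := .left t hF1.2 (hG.mono (by linarith))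
  have c1 := (hray.cross_nonneg_iff _).1
    (hF2 X G ⟨t, ⟨hX.anti hab, hX'⟩, ⟨hG', hG.mono (by linarith)⟩⟩)
  have c2 : imRot ψ (W (cls v F)) = 0 := (onRay_iff.1 hray).2
  rw [cls_tri t, map_add, map_add] at c2
  have hG0 : IsZero G := by
    by_contra hG0
    obtain ⟨l, hl⟩ := σ.exists_chain G
    have hne : l ≠ [] := by
      rintro rfl
      exact hG0 hl.isZero_of_nil
    have : 0 < (-imRot ψ) (W (cls v G)) := by
      rw [hl.map_cls_eq_sum, linear_sum_map]
      refine sum_map_pos l _ (fun p hp => neg_pos.2 ?_) hne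
      exact (onRay_of_chain hl p hp).imRot_neg_of_close (hl.gt_iff.1 hG' p hp)
        (h.im_eq_base ψ _) (h.close_of_mem (hl.mem p hp)) h.lt_sin hε h.ε_le b2
        (by linarith [hl.le_iff.1 hG p hp])
    rw [LinearMap.neg_apply] at this
    linarith
  obtain ⟨e⟩ := t.nonempty_iso_left hG0
  exact hX.of_iso e

theorem le_of_slopeP (h : Deformation σ α W N C δ ε)
    {ψ : ℝ} {F : D} (hF : slopeP σ α W ψ F) : σ.LE (ψ + ε) F := by
  rcases hF.2 with h0 | hray
  · exact .of_isZero h0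
  obtain ⟨⟨hF1, hF2⟩, hF3⟩ := hF
  have b1 := base_lt α ψ
  have b2 := le_base_add_one α ψ
  have hε := h.ε_pos
  -- The planar estimate needs strict inequality, so the level ψ + ε is reached as a limit: a phase
  -- above it is separated from it by a midpoint.
  suffices H : ∀ a, ψ + ε < a → σ.LE a F from
    fun φ hφ => H ((φ + (ψ + ε)) / 2) (by linarith) φ (by linarith)
  intro a ha
  rcases le_or_gt (base α ψ + 1) a with hab | hab
  · exact hF1.2.mono hab
  obtain ⟨X, G, t, hX, hG⟩ := σ.exists_trunc a F
  have hG' : σ.GT (base α ψ) G := .right t hF1.1 (hX.anti (by linarith))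
  have hX' : σ.LE (base α ψ + 1) X := .left t hF1.2 (hG.mono (by linarith))
  have c1 := (hray.cross_nonneg_iff _).1
    (hF2 X G ⟨t, ⟨hX.anti (by linarith), hX'⟩, ⟨hG', hG.mono hab.le⟩⟩)
  have hX0 : IsZero X := by
    by_contra hX0
    obtain ⟨l, hl⟩ := σ.exists_chain X
    have hne : l ≠ [] := by
      rintro rfl
      exact hX0 hl.isZero_of_nil
    have : 0 < imRot ψ (W (cls v X)) := by
      rw [hl.map_cls_eq_sum, linear_sum_map]
      refine sum_map_pos l _ (fun p hp => ?_) hne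
      exact (onRay_of_chain hl p hp).imRot_pos_of_close (hl.le_iff.1 hX' p hp)
        (h.im_eq_base ψ _) (h.close_of_mem (hl.mem p hp)) h.lt_sin hε h.ε_le b1
        (by linarith [hl.gt_iff.1 hX p hp])
    linarith
  obtain ⟨e⟩ := t.nonempty_iso_right hX0
  exact hG.of_iso e.symm

/-- The old phases of `F` are within ε ≤ 1/4 of ψ, so projection to the ray ψ keeps at least
cos(π/4) ≥ 7/10 of the mass. The change of charge loses at most 1/5, and 7/10 − 1/5 = 1/2. -/
theorem massList_le_two_mul (h : Deformation σ α W N C δ ε)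
    {ψ : ℝ} {F : D} (hF : slopeP σ α W ψ F) {l : List (ℝ × D)}
    (hl : HNChain σ.P l F) : massList v σ.Z l ≤ 2 * ‖W (cls v F)‖ := by
  have hpi := Real.pi_pos
  have hε := h.ε_pos
  have hε' := h.ε_le
  have hsqrt : (7 / 10 : ℝ) ≤ Real.sqrt 2 / 2 := by
    rw [le_div_iff₀ (by norm_num)]
    exact Real.le_sqrt_of_sq_le (by norm_num)
  have h1 : ∀ p ∈ l, 7 / 10 * ‖σ.Z (cls v p.2)‖ ≤ reRot ψ (σ.Z (cls v p.2)) := by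
    intro p hp
    rw [(onRay_of_chain hl p hp).reRot, mul_comm]
    refine mul_le_mul_of_nonneg_left ?_ (norm_nonneg _)
    refine hsqrt.trans ?_
    rw [← Real.cos_pi_div_four, ← Real.cos_abs (Real.pi * (p.1 - ψ))]
    have hp1 : p.1 ≤ ψ + ε := hl.le_iff.1 (h.le_of_slopeP hF) p hp
    have hp2 : ψ - ε ≤ p.1 := le_of_forall_lt fun a ha =>
      hl.gt_iff.1 (h.gt_of_slopeP hF ha) p hp
    refine Real.cos_le_cos_of_nonneg_of_le_pi (abs_nonneg _) (by linarith) ?_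
    rw [abs_le]
    constructor <;> nlinarith
  have h2 : 7 / 10 * massList v σ.Z l ≤ reRot ψ (σ.Z (cls v F)) := by
    rw [hl.map_cls_eq_sum, linear_sum_map, massList, ← List.sum_map_mul_left]
    exact List.sum_le_sum h1
  have h3 := (le_abs_self _).trans (abs_reRot_le ψ (σ.Z (cls v F)))
  have h4 := h.close_massList hl
  have h5 := norm_sub_norm_le (σ.Z (cls v F)) (W (cls v F))
  rw [norm_sub_rev] at h5
  have h6 := mul_le_mul_of_nonneg_right h.le_fifth (massList_nonneg (v := v) σ.Z l)
  linarith

theorem norm_le_of_slopeP (h : Deformation σ α W N C δ ε) {ψ : ℝ} {F : D} (hF : slopeP σ α W ψ F) :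
    N (cls v F) ≤ 2 * C * ‖W (cls v F)‖ := by
  obtain ⟨l, hl⟩ := σ.exists_chain F
  have h1 := h.norm_le_massList hl
  have h2 := mul_le_mul_of_nonneg_left (h.massList_le_two_mul hF hl) h.C_nonneg
  linarith

theorem deform_gt (h : Deformation σ α W N C δ ε)
    {b : ℝ} {E : D} (hE : h.deform.GT b E) : σ.GT (b - ε) E := by
  obtain ⟨l, hl⟩ := h.deform.exists_chain E
  exact hl.ext_induction _ (fun _ => .of_isZero) (fun _ _ _ => .ext)
    fun p hp => h.gt_of_slopeP (hl.mem p hp) (by linarith [hl.gt_iff.1 hE p hp])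

theorem deform_le (h : Deformation σ α W N C δ ε)
    {b : ℝ} {E : D} (hE : h.deform.LE b E) : σ.LE (b + ε) E := by
  obtain ⟨l, hl⟩ := h.deform.exists_chain E
  exact hl.ext_induction _ (fun _ => .of_isZero) (fun _ _ _ => .ext)
    fun p hp => (h.le_of_slopeP (hl.mem p hp)).mono (by linarith [hl.le_iff.1 hE p hp])

theorem gt_deform (h : Deformation σ α W N C δ ε)
    {b : ℝ} {E : D} (hE : σ.GT b E) : h.deform.GT (b - ε) E :=
  .of_hom fun F hF f => hE.hom_eq_zero (by simpa using h.deform_le hF) f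

theorem le_deform (h : Deformation σ α W N C δ ε)
    {b : ℝ} {E : D} (hE : σ.LE b E) : h.deform.LE (b + ε) E :=
  .of_hom fun F hF f => GT.hom_eq_zero (by simpa using h.deform_gt hF) hE f

/-- The hearts at the levels α + n were not changed; `massList_le` relies on this agreement of
truncations. -/
theorem deform_gt_int (h : Deformation σ α W N C δ ε)
    (n : ℤ) (E : D) : h.deform.GT (α + n) E ↔ σ.GT (α + n) E := by
  have hle : ∀ F, h.deform.LE (α + n) F → σ.LE (α + n) F := by
    intro F hF
    obtain ⟨l, hl⟩ := h.deform.exists_chain F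
    exact hl.ext_induction _ (fun _ => .of_isZero) (fun _ _ _ => .ext)
      fun p hp => (hl.mem p hp).1.1.2.mono (base_add_one_le (hl.le_iff.1 hF p hp))
  constructor
  · intro hE
    obtain ⟨l, hl⟩ := h.deform.exists_chain E
    exact hl.ext_induction _ (fun _ => .of_isZero) (fun _ _ _ => .ext)
      fun p hp => (hl.mem p hp).1.1.1.anti (le_base (hl.gt_iff.1 hE p hp))
  · exact fun hE => .of_hom fun F hF f => hE.hom_eq_zero (hle F hF) f

theorem deform_le_int (h : Deformation σ α W N C δ ε)
    (n : ℤ) (E : D) : h.deform.LE (α + n) E ↔ σ.LE (α + n) E := by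
  constructor
  · intro hE
    exact .of_hom fun F hF f => GT.hom_eq_zero ((h.deform_gt_int n F).2 hF) hE f
  · intro hE
    exact .of_hom fun F hF f => GT.hom_eq_zero ((h.deform_gt_int n F).1 hF) hE f

theorem abs_phiPlus_sub_le (h : Deformation σ α W N C δ ε) (E : {E : D // ¬ IsZero E}) :
    |σ.phiPlus E - h.deform.phiPlus E| ≤ ε := by
  have h1 := (h.deform.phiPlus_le_iff E _).2 (h.le_deform ((σ.phiPlus_le_iff E _).1 le_rfl))
  have h2 := (σ.phiPlus_le_iff E _).2 (h.deform_le ((h.deform.phiPlus_le_iff E _).1 le_rfl))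
  rw [abs_le]
  constructor <;> linarith

theorem abs_phiMinus_sub_le (h : Deformation σ α W N C δ ε) (E : {E : D // ¬ IsZero E}) :
    |σ.phiMinus E - h.deform.phiMinus E| ≤ ε := by
  have h1 : h.deform.phiMinus E - ε ≤ σ.phiMinus E := le_of_forall_lt fun a ha => by
    have := (σ.lt_phiMinus_iff E _).2
      (h.deform_gt ((h.deform.lt_phiMinus_iff E (a + ε)).1 (by linarith)))
    linarith
  have h2 : σ.phiMinus E - ε ≤ h.deform.phiMinus E := le_of_forall_lt fun a ha => by
    have := (h.deform.lt_phiMinus_iff E _).2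
      (h.gt_deform ((σ.lt_phiMinus_iff E (a + ε)).1 (by linarith)))
    linarith
  rw [abs_le]
  constructor <;> linarith

/-- On the new semistable objects `norm_le_of_slopeP` has constant 2C, so the relative error is 2δC
instead of δC. -/
theorem mass_deform_le (h : Deformation σ α W N C δ ε) (E : D) :
    h.deform.mass E ≤ σ.mass E + (Real.pi + 1) * (2 * (δ * C)) * h.deform.mass E := by
  rw [mass_eq_massList, mass_eq_massList]
  refine massList_le (α := α) (mul_nonneg (by norm_num) (mul_nonneg h.δ_nonneg h.C_nonneg))
    h.deform_gt_int h.deform_le_int (fun φ F hF => ?_) (σ.hn E).chain (h.deform.hn E).chain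
  refine (h.close _).trans ?_
  have := mul_le_mul_of_nonneg_left (h.norm_le_of_slopeP hF) h.δ_nonneg
  change _ ≤ _ * ‖W (cls v F)‖
  linarith

theorem mass_le_deform (h : Deformation σ α W N C δ ε) (E : D) :
    σ.mass E ≤ h.deform.mass E + (Real.pi + 1) * (δ * C) * σ.mass E := by
  rw [mass_eq_massList, mass_eq_massList]
  refine massList_le (α := α) (mul_nonneg h.δ_nonneg h.C_nonneg)
    (fun n F => (h.deform_gt_int n F).symm) (fun n F => (h.deform_le_int n F).symm)
    (fun φ F hF => ?_) (h.deform.hn E).chain (σ.hn E).chain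
  rw [norm_sub_rev]
  exact h.close_of_mem hF

end Deformation

theorem PreStabilityCondition.mass_pos (σ : PreStabilityCondition v) {E : D} (hE : ¬ IsZero E) :
    0 < σ.mass E := by
  rw [mass_eq_massList]
  refine sum_map_pos _ _ (fun p hp => (onRay_of_chain (σ.hn E).chain p hp).norm_pos) ?_
  intro h0
  have := (σ.hn E).chain
  rw [h0] at this
  exact hE this.isZero_of_nil

/-- The constant 10 dominates 2(π + 1), since π < 4; each mass is then at least exp(−ρ) times the
other. -/
theorem Deformation.abs_log_mass_sub_le {σ : PreStabilityCondition v} {α : ℝ}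
    {W : Λ →ₗ[ℤ] ℂ} {N : AddGroupSeminorm Λ} {C δ ε ρ : ℝ} (h : Deformation σ α W N C δ ε)
    (hρ : 10 * (δ * C) ≤ 1 - Real.exp (-ρ)) {E : D} (hE : ¬ IsZero E) :
    |Real.log (σ.mass E) - Real.log (h.deform.mass E)| ≤ ρ := by
  have hpi := Real.pi_lt_four
  have hpi' := Real.pi_pos
  have p1 := σ.mass_pos hE
  have p2 := h.deform.mass_pos hE
  have hη : 0 ≤ δ * C := mul_nonneg h.δ_nonneg h.C_nonneg
  have h1 := h.mass_deform_le E
  have h2 := h.mass_le_deform E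
  have e1 : Real.exp (-ρ) * h.deform.mass E ≤ σ.mass E := by
    have : (Real.pi + 1) * (2 * (δ * C)) * h.deform.mass E ≤
        (1 - Real.exp (-ρ)) * h.deform.mass E :=
      mul_le_mul_of_nonneg_right (by nlinarith) p2.le
    linarith
  have e2 : Real.exp (-ρ) * σ.mass E ≤ h.deform.mass E := by
    have : (Real.pi + 1) * (δ * C) * σ.mass E ≤ (1 - Real.exp (-ρ)) * σ.mass E :=
      mul_le_mul_of_nonneg_right (by nlinarith) p1.le
    linarith
  have l1 := Real.log_le_log (by positivity) e1
  have l2 := Real.log_le_log (by positivity) e2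
  rw [Real.log_mul (by positivity) (by positivity), Real.log_exp] at l1 l2
  rw [abs_le]
  constructor <;> linarith

end Closeness

/-! ### The quadratic form on rays, and straight paths of charges. -/

section QuadraticForms

variable {Λ : Type*} [AddCommGroup Λ]

theorem liftBaseChange_one_tmul (Z : Λ →ₗ[ℤ] ℂ) (x : Λ) :
    Z.liftBaseChange ℝ ((1 : ℝ) ⊗ₜ[ℤ] x) = Z x := by
  rw [LinearMap.liftBaseChange_tmul, one_smul]

/-- The classes with `Q ≥ 0` whose central charge lies on a fixed ray form a convex cone. -/
theorem KerNegDef.add_nonneg {Q : QuadraticForm ℝ (ℝ ⊗[ℤ] Λ)} {Z : Λ →ₗ[ℤ] ℂ}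
    (h : KerNegDef Q Z) {x y : ℝ ⊗[ℤ] Λ} {c : ℂ} {r s : ℝ} (hr : 0 < r) (hs : 0 < s)
    (hx : Z.liftBaseChange ℝ x = r * c) (hy : Z.liftBaseChange ℝ y = s * c)
    (hQx : 0 ≤ Q x) (hQy : 0 ≤ Q y) : 0 ≤ Q (x + y) := by
  -- The combination sx − ry is in the kernel of the charge, so Q is nonpositive there; as Q(x),
  -- Q(y) ≥ 0, this forces the polar form of `x` and `y` to be nonnegative.
  have hker : Z.liftBaseChange ℝ (s • x + (-r) • y) = 0 := by
    rw [map_add, map_smul, map_smul, hx, hy]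
    simp only [Complex.real_smul]
    push_cast
    ring
  have hle : Q (s • x + (-r) • y) ≤ 0 := by
    by_cases h0 : s • x + (-r) • y = 0
    · rw [h0, QuadraticMap.map_zero]
    · exact (h _ hker h0).le
  rw [QuadraticMap.map_add Q, QuadraticMap.map_smul, QuadraticMap.map_smul,
    QuadraticMap.polar_smul_left, QuadraticMap.polar_smul_right] at hle
  simp only [smul_eq_mul] at hle
  rw [QuadraticMap.map_add Q]
  have h1 : 0 ≤ s * s * Q x := mul_nonneg (by positivity) hQx
  have h2 : 0 ≤ -r * -r * Q y := mul_nonneg (by nlinarith) hQy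
  have h3 : 0 ≤ s * r * QuadraticMap.polar Q x y := by linarith
  have := nonneg_of_mul_nonneg_right h3 (mul_pos hs hr)
  linarith

/-- The straight path between two central charges. -/
def lerp (Z W : Λ →ₗ[ℤ] ℂ) (t : ℝ) : Λ →ₗ[ℤ] ℂ := Z + t • (W - Z)

theorem lerp_apply (Z W : Λ →ₗ[ℤ] ℂ) (t : ℝ) (x : Λ) : lerp Z W t x = Z x + t * (W x - Z x) := by
  simp [lerp]

@[simp] theorem lerp_zero (Z W : Λ →ₗ[ℤ] ℂ) : lerp Z W 0 = Z := by simp [lerp]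

@[simp] theorem lerp_one (Z W : Λ →ₗ[ℤ] ℂ) : lerp Z W 1 = W := by simp [lerp]

/-- In coordinates rotated by β only the real parts move, and linearly, so the signed area is affine
in `t` rather than quadratic. This makes walls zeros of affine functions. -/
theorem cross_lerp {β : ℝ} {Z W : Λ →ₗ[ℤ] ℂ} (h : ∀ x, imRot β (W x) = imRot β (Z x)) (t : ℝ)
    (x y : Λ) : cross (lerp Z W t x) (lerp Z W t y) = cross (Z x) (Z y) +
      t * (cross (W x) (W y) - cross (Z x) (Z y)) := by
  have him : ∀ x, imRot β (lerp Z W t x) = imRot β (Z x) := by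
    intro x
    have : imRot β ((t : ℂ) * (W x - Z x)) = t * (imRot β (W x) - imRot β (Z x)) := by
      rw [← Complex.real_smul, map_smul, map_sub, smul_eq_mul]
    rw [lerp_apply, map_add, this, h]
    ring
  have hre : ∀ x, reRot β (lerp Z W t x) =
      reRot β (Z x) + t * (reRot β (W x) - reRot β (Z x)) := by
    intro x
    rw [lerp_apply, map_add, ← Complex.real_smul, map_smul, map_sub, smul_eq_mul]
  rw [← cross_rotC β (lerp Z W t x), ← cross_rotC β (Z x), ← cross_rotC β (W x)]
  simp only [cross, rotC_re, rotC_im, him, hre, h]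
  ring

end QuadraticForms

theorem exists_pos_mul_of_cross_eq_zero {β : ℝ} {x y : ℂ} (hx : Upper (rotC β x))
    (hy : Upper (rotC β y)) (h : cross x y = 0) : ∃ r : ℝ, 0 < r ∧ y = r * x := by
  obtain ⟨r, hr, hxy⟩ := hx.exists_smul hy (by rwa [cross_rotC])
  refine ⟨r, hr, ?_⟩
  have h1 := congrArg Complex.re hxy
  have h2 := congrArg Complex.im hxy
  rw [Complex.re_ofReal_mul, rotC_re, rotC_re] at h1
  rw [Complex.im_ofReal_mul, rotC_im, rotC_im] at h2
  rw [← sub_eq_zero]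
  refine eq_zero_of_rot (θ := β) ?_ ?_
  · rw [map_sub, ← Complex.real_smul, map_smul, smul_eq_mul, h1, sub_self]
  · rw [map_sub, ← Complex.real_smul, map_smul, smul_eq_mul, h2, sub_self]

theorem cross_mul_right (x y : ℂ) (r : ℝ) : cross x (r * y) = r * cross x y := by
  simp [cross]
  ring

/-! ### Wall-crossing and preservation of the support property. -/

section Support

variable {D : Type u} [Category.{w} D] [HasZeroObject D] [HasShift D ℤ] [Preadditive D]
  [∀ n : ℤ, (shiftFunctor D n).Additive] [Pretriangulated D] [IsTriangulated D]
  {Λ : Type*} [AddCommGroup Λ] {v : K₀ D →+ Λ}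

open PreStabilityCondition

theorem PreStabilityCondition.mem_of_gt_of_le {σ : PreStabilityCondition v} {ψ : ℝ} {E : D}
    (h1 : ∀ a < ψ, σ.GT a E) (h2 : σ.LE ψ E) : σ.P ψ E := by
  obtain ⟨l, hl⟩ := σ.exists_chain E
  have hall : ∀ p ∈ l, p.1 = ψ := fun p hp => le_antisymm (hl.le_iff.1 h2 p hp)
    (le_of_forall_lt fun a ha => hl.gt_iff.1 (h1 a ha) p hp)
  cases hl with
  | nil h => exact σ.zero_mem ψ h
  | @cons E' E A φ l h t hA hA' hlt =>
    have hφ : φ = ψ := hall (φ, A) List.mem_cons_self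
    subst hφ
    cases h with
    | nil h0 =>
      obtain ⟨e⟩ := t.nonempty_iso_right h0
      exact σ.iso_closed _ e.symm hA
    | @cons E'' _ B χ l' h' t' hB hB' hlt' =>
      have h3 := hall (χ, B) (by simp)
      have h4 := hlt (χ, B) List.mem_cons_self
      exact absurd h3 h4.ne'

theorem Deformation.lerp {σ : PreStabilityCondition v} {α : ℝ} {W : Λ →ₗ[ℤ] ℂ}
    {N : AddGroupSeminorm Λ} {C δ ε : ℝ} (h : Deformation σ α W N C δ ε) {t : ℝ} (ht : 0 ≤ t)
    (ht' : t ≤ 1) : Deformation σ α (lerp σ.Z W t) N C δ ε where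
  im_eq x := by
    have : imRot α ((t : ℂ) * (W x - σ.Z x)) = t * (imRot α (W x) - imRot α (σ.Z x)) := by
      rw [← Complex.real_smul, map_smul, map_sub, smul_eq_mul]
    rw [lerp_apply, map_add, this, h.im_eq]
    ring
  finite := h.finite
  norm_le := h.norm_le
  close x := by
    rw [lerp_apply, add_sub_cancel_left, norm_mul, Complex.norm_real, Real.norm_of_nonneg ht]
    have := h.close x
    nlinarith [norm_nonneg (W x - σ.Z x)]
  C_nonneg := h.C_nonneg
  δ_nonneg := h.δ_nonneg
  ε_pos := h.ε_pos
  ε_le := h.ε_le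
  lt_sin := h.lt_sin
  le_fifth := h.le_fifth

namespace Deformation

variable {σ : PreStabilityCondition v} {α : ℝ} {W : Λ →ₗ[ℤ] ℂ} {N : AddGroupSeminorm Λ}
  {C δ ε : ℝ}

theorem exists_slopeP (h : Deformation σ α W N C δ ε) {n : ℤ} {E : D}
    (hE : SlopeSemistable v (σ.Heart (α + n)) W E) (h0 : ¬ IsZero E) :
    ∃ ψ, slopeP σ α W ψ E := by
  obtain ⟨ψ, h1, h2, hψ⟩ := (h.upper n hE.1 h0).exists_onRay
  refine ⟨ψ, ?_, Or.inr hψ⟩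
  rwa [base_eq h1 h2]

/-- The constant deformation has δ = 0 and is admissible for every ε in (0, 1/4]. Letting ε tend to
0, the phase bounds for `slopeP` pin all phases to ψ. -/
theorem isSemistable_of_slopeSemistable (h : Deformation σ α W N C δ ε) {n : ℤ} {E : D}
    (hE : SlopeSemistable v (σ.Heart (α + n)) σ.Z E) (h0 : ¬ IsZero E) : σ.IsSemistable E := by
  have hpi := Real.pi_pos
  have hdef : ∀ ε', 0 < ε' → ε' ≤ 1 / 4 → Deformation σ α σ.Z N C 0 ε' := fun ε' h1 h2 =>
    { im_eq := fun _ => rfl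
      finite := h.finite
      norm_le := h.norm_le
      close := fun x => by simp
      C_nonneg := h.C_nonneg
      δ_nonneg := le_rfl
      ε_pos := h1
      ε_le := h2
      lt_sin := by
        rw [zero_mul]
        exact Real.sin_pos_of_pos_of_lt_pi (by positivity) (by nlinarith)
      le_fifth := by simp }
  obtain ⟨ψ, hψ⟩ := (hdef (1 / 4) (by norm_num) le_rfl).exists_slopeP hE h0
  refine ⟨ψ, mem_of_gt_of_le (fun a ha => ?_) fun φ hφ => ?_⟩
  · have h1 : 0 < min (1 / 4) ((ψ - a) / 2) := lt_min (by norm_num) (by linarith)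
    have h2 := min_le_right (1 / 4) ((ψ - a) / 2)
    exact (hdef _ h1 (min_le_left _ _)).gt_of_slopeP hψ (by linarith)
  · have h1 : 0 < min (1 / 4) ((φ - ψ) / 2) := lt_min (by norm_num) (by linarith)
    have h2 := min_le_right (1 / 4) ((φ - ψ) / 2)
    exact (hdef _ h1 (min_le_left _ _)).le_of_slopeP hψ φ (by linarith)

/-- An object that is semistable at time `t`, but not at time `0`, is strictly semistable at some
time in between. -/
theorem exists_wall (h : Deformation σ α W N C δ ε) {n : ℤ} {E : D} {t : ℝ} (ht : 0 ≤ t)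
    (hE : SlopeSemistable v (σ.Heart (α + n)) (BridgelandStab.lerp σ.Z W t) E)
    (hE' : ¬ SlopeSemistable v (σ.Heart (α + n)) σ.Z E) :
    ∃ s, 0 ≤ s ∧ s ≤ t ∧ SlopeSemistable v (σ.Heart (α + n)) (BridgelandStab.lerp σ.Z W s) E ∧
      ∃ S T, IsSub (σ.Heart (α + n)) S E T ∧ ¬ IsZero S ∧ ¬ IsZero T ∧
        cross (BridgelandStab.lerp σ.Z W s (cls v S)) (BridgelandStab.lerp σ.Z W s (cls v E)) =
          0 := by
  have hdef0 : Deformation σ α σ.Z N C δ ε := by simpa using h.lerp le_rfl zero_le_one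
  let g : ℝ → Λ → ℝ := fun s x =>
    cross (BridgelandStab.lerp σ.Z W s x) (BridgelandStab.lerp σ.Z W s (cls v E))
  let k : Λ → ℝ := fun x => cross (W x) (W (cls v E)) - cross (σ.Z x) (σ.Z (cls v E))
  have hg : ∀ s x, g s x = g 0 x + s * k x := by
    intro s x
    simp only [g, k, lerp_zero]
    exact cross_lerp (h.im_eq_int n) s x (cls v E)
  -- The classes of subobjects destabilizing `E` at time 0. Their real parts are bounded by
  -- `Upper.re_le`, so there are finitely many.
  let G : Set Λ := {x | ∃ S T, IsSub (σ.Heart (α + n)) S E T ∧ cls v S = x ∧ g 0 x < 0}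
  have hnz : ∀ S T, IsSub (σ.Heart (α + n)) S E T → g 0 (cls v S) < 0 →
      ¬ IsZero S ∧ ¬ IsZero T := by
    intro S T hS hlt
    refine ⟨fun hz => ?_, fun hz => ?_⟩
    · simp [g, cls_isZero hz] at hlt
    · have : cls v E = cls v S := by rw [cls_tri hS.tri, cls_isZero hz, add_zero]
      simp [g, this] at hlt
  have hfin : G.Finite := by
    refine (hdef0.finite_subClasses n hE.1 (max 0 (reRot (α + n) (σ.Z (cls v E))))).subset ?_
    rintro _ ⟨S, T, hS, rfl, hlt⟩
    have hSu := hdef0.upper n hS.left (hnz S T hS hlt).1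
    have hTu := hdef0.upper n hS.right (hnz S T hS hlt).2
    refine ⟨S, T, hS, rfl, hSu.re_le (y := rotC (α + n) (σ.Z (cls v E))) ?_ ?_ (le_max_left _ _)
      (by simp)⟩
    · rw [cross_rotC, cross_swap]
      simp only [g, lerp_zero] at hlt
      linarith
    · rw [cls_tri hS.tri, map_add, map_add, Complex.add_im]
      linarith [hTu.im_nonneg]
  have hGne : G.Nonempty := by
    by_contra hempty
    rw [Set.not_nonempty_iff_eq_empty] at hempty
    refine hE' ⟨hE.1, fun S T hS => ?_⟩
    by_contra! hlt
    have : cls v S ∈ G := ⟨S, T, hS, rfl, by simpa [g] using hlt⟩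
    rw [hempty] at this
    exact this
  have hpos : ∀ x ∈ G, 0 < k x ∧ 0 ≤ g t x := by
    rintro _ ⟨S, T, hS, rfl, hlt⟩
    have h1 : 0 ≤ g t (cls v S) := hE.2 S T hS
    refine ⟨?_, h1⟩
    rw [hg] at h1
    by_contra! hk
    nlinarith
  -- For x in `G` the area is negative at 0, nonnegative at `t` and affine, and −g(0)/k is the time
  -- it vanishes. The last such time is the wall.
  obtain ⟨x, hx, hmax⟩ := Set.exists_max_image G (fun x => -g 0 x / k x) hfin hGne
  obtain ⟨hkx, hgx⟩ := hpos x hx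
  obtain ⟨S, T, hS, rfl, hlt⟩ := hx
  set s := -g 0 (cls v S) / k (cls v S) with hs
  have hs0 : 0 < s := div_pos (by linarith) hkx
  have hst : s ≤ t := by
    rw [hs, div_le_iff₀ hkx]
    rw [hg] at hgx
    linarith
  refine ⟨s, hs0.le, hst, ⟨hE.1, fun S' T' hS' => ?_⟩, S, T, hS, (hnz S T hS hlt).1,
    (hnz S T hS hlt).2, ?_⟩
  · change 0 ≤ g s (cls v S')
    have h1 : 0 ≤ g t (cls v S') := hE.2 S' T' hS'
    rw [hg] at h1 ⊢
    -- Classes in `G` have stopped destabilizing by time `s`; for the others the area is nonnegative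
    -- at 0 and at `t`, hence in between.
    rcases lt_or_ge (g 0 (cls v S')) 0 with hneg | hnonneg
    · have hmem : cls v S' ∈ G := ⟨S', T', hS', rfl, hneg⟩
      have h2 := hmax _ hmem
      have h3 := (hpos _ hmem).1
      rw [div_le_iff₀ h3] at h2
      linarith
    · rcases le_or_gt 0 (k (cls v S')) with hk | hk
      · nlinarith [mul_nonneg hs0.le hk]
      · nlinarith
  · change g s (cls v S) = 0
    rw [hg, hs, div_mul_cancel₀ _ hkx.ne']
    ring

/-- The induction bounds 2C‖W_t(E)‖exp(Kt) by a natural number. The exponential with K = 2Cδ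
compensates for the possible growth of the norm when time goes back from t to the wall s. At the
wall the charges of the two pieces are positive multiples of that of `E`, with ratios adding to 1.
Each piece is nonzero and semistable, so its class has `N` at least 1 and contributes at least 1 to
2C‖W_s(E)‖; the other piece therefore drops below the next smaller integer. -/
theorem quadratic_nonneg (h : Deformation σ α W N C δ ε) (hN : ∀ x, x ≠ 0 → 1 ≤ N x)
    {Q : QuadraticForm ℝ (ℝ ⊗[ℤ] Λ)} (hQ : σ.SupportProperty Q)
    (hker : ∀ t : ℝ, 0 ≤ t → t ≤ 1 → KerNegDef Q (BridgelandStab.lerp σ.Z W t)) {n : ℤ} {t : ℝ}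
    (ht : 0 ≤ t) (ht' : t ≤ 1) {E : D}
    (hE : SlopeSemistable v (σ.Heart (α + n)) (BridgelandStab.lerp σ.Z W t) E) :
    0 ≤ Q ((1 : ℝ) ⊗ₜ[ℤ] cls v E) := by
  set K := δ * (2 * C) with hK
  suffices H : ∀ (m : ℕ) (t : ℝ), 0 ≤ t → t ≤ 1 → ∀ E : D,
      SlopeSemistable v (σ.Heart (α + n)) (BridgelandStab.lerp σ.Z W t) E →
      2 * C * ‖BridgelandStab.lerp σ.Z W t (cls v E)‖ * Real.exp (K * t) < m →
      0 ≤ Q ((1 : ℝ) ⊗ₜ[ℤ] cls v E) by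
    obtain ⟨m, hm⟩ := exists_nat_gt
      (2 * C * ‖BridgelandStab.lerp σ.Z W t (cls v E)‖ * Real.exp (K * t))
    exact H m t ht ht' E hE hm
  intro m
  induction m with
  | zero =>
    intro t ht ht' E hE hlt
    have := h.C_nonneg
    have : 0 ≤ 2 * C * ‖BridgelandStab.lerp σ.Z W t (cls v E)‖ * Real.exp (K * t) := by positivity
    push_cast at hlt
    linarith
  | succ m ih =>
    intro t ht ht' E hE hlt
    by_cases h0 : IsZero E
    · rw [cls_isZero h0, TensorProduct.tmul_zero, QuadraticMap.map_zero]
    by_cases hE0 : SlopeSemistable v (σ.Heart (α + n)) σ.Z E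
    · exact hQ.2 E (h.isSemistable_of_slopeSemistable hE0 h0)
    obtain ⟨s, hs0, hst, hEs, S, T, hS, hS0, hT0, hcr⟩ := h.exists_wall ht hE hE0
    have hd := h.lerp hs0 (hst.trans ht')
    have hEu := hd.upper n hE.1 h0
    have hSu := hd.upper n hS.left hS0
    have hTu := hd.upper n hS.right hT0
    have hadd := cls_tri (v := v) hS.tri
    set Ws := BridgelandStab.lerp σ.Z W s with hWs
    have haddW : Ws (cls v E) = Ws (cls v S) + Ws (cls v T) := by rw [hadd, map_add]
    have hcrT : cross (Ws (cls v T)) (Ws (cls v E)) = 0 := by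
      have h1 := cross_self (Ws (cls v E))
      nth_rewrite 1 [haddW] at h1
      rw [cross_add_left, hcr, zero_add] at h1
      exact h1
    obtain ⟨r₁, hr₁, hr₁'⟩ := exists_pos_mul_of_cross_eq_zero hEu hSu
      (by rw [cross_swap, hcr, neg_zero])
    obtain ⟨r₂, hr₂, hr₂'⟩ := exists_pos_mul_of_cross_eq_zero hEu hTu
      (by rw [cross_swap, hcrT, neg_zero])
    have hSS : SlopeSemistable v (σ.Heart (α + n)) Ws S := by
      refine ⟨hS.left, fun S' T' hS' => ?_⟩
      obtain ⟨X, hX⟩ := hS'.trans (fun X Y Z => Heart.ext) hS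
      rw [hr₁', cross_mul_right]
      exact mul_nonneg hr₁.le (hEs.2 S' X hX)
    have hTS : SlopeSemistable v (σ.Heart (α + n)) Ws T := by
      refine ⟨hS.right, fun B B' hB => ?_⟩
      obtain ⟨E', hE', hcls⟩ := IsSub.preimage (v := v) (fun X Y Z => Heart.ext) hS hB
      rw [hr₂', cross_mul_right]
      refine mul_nonneg hr₂.le ?_
      have := hEs.2 E' B' hE'
      rwa [hcls, map_add, cross_add_left, hcr, zero_add] at this
    have hE0' : Ws (cls v E) ≠ 0 := by
      intro hz
      rw [hz, map_zero] at hEu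
      exact hEu.ne_zero rfl
    have hEpos := norm_pos_iff.2 hE0'
    have hr : r₁ + r₂ = 1 := by
      have h1 : ((r₁ + r₂ - 1 : ℝ) : ℂ) * Ws (cls v E) = 0 := by
        push_cast
        linear_combination -haddW - hr₁' - hr₂'
      have := (mul_eq_zero.1 h1).resolve_right hE0'
      have : r₁ + r₂ - 1 = 0 := by exact_mod_cast this
      linarith
    have hnS : ‖Ws (cls v S)‖ = r₁ * ‖Ws (cls v E)‖ := by
      rw [hr₁', norm_mul, Complex.norm_real, Real.norm_of_nonneg hr₁.le]
    have hnT : ‖Ws (cls v T)‖ = r₂ * ‖Ws (cls v E)‖ := by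
      rw [hr₂', norm_mul, Complex.norm_real, Real.norm_of_nonneg hr₂.le]
    have hone : ∀ F, SlopeSemistable v (σ.Heart (α + n)) Ws F → ¬ IsZero F →
        1 ≤ 2 * C * ‖Ws (cls v F)‖ := by
      intro F hF hF0
      obtain ⟨ψ, hψ⟩ := hd.exists_slopeP hF hF0
      refine (hN _ ?_).trans (hd.norm_le_of_slopeP hψ)
      intro hz
      have := hd.upper n hF.1 hF0
      rw [hz, map_zero, map_zero] at this
      exact this.ne_zero rfl
    -- Going back to `s` changes the charge by at most (t−s)δN, and N ≤ 2C‖W_t(E)‖, so the norm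
    -- grows at most by the factor 1 + K(t−s) ≤ exp(K(t−s)).
    have hmono : ‖Ws (cls v E)‖ * Real.exp (K * s) ≤
        ‖BridgelandStab.lerp σ.Z W t (cls v E)‖ * Real.exp (K * t) := by
      obtain ⟨ψ, hψ⟩ := (h.lerp ht ht').exists_slopeP hE h0
      have h1 := (h.lerp ht ht').norm_le_of_slopeP hψ
      have h2 : ‖Ws (cls v E)‖ ≤ ‖BridgelandStab.lerp σ.Z W t (cls v E)‖ +
          (t - s) * (δ * N (cls v E)) := by
        have e : Ws (cls v E) = BridgelandStab.lerp σ.Z W t (cls v E) -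
            ((t - s : ℝ) : ℂ) * (W (cls v E) - σ.Z (cls v E)) := by
          rw [hWs, lerp_apply, lerp_apply]
          push_cast
          ring
        rw [e]
        refine (norm_sub_le _ _).trans ?_
        rw [norm_mul, Complex.norm_real, Real.norm_of_nonneg (by linarith)]
        gcongr
        exact h.close _
      have h3 : ‖Ws (cls v E)‖ ≤
          ‖BridgelandStab.lerp σ.Z W t (cls v E)‖ * Real.exp (K * (t - s)) := by
        refine h2.trans ?_
        have h4 := mul_le_mul_of_nonneg_left h1 h.δ_nonneg
        have h5 := mul_le_mul_of_nonneg_left h4 (by linarith : 0 ≤ t - s)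
        have h6 := mul_le_mul_of_nonneg_left (Real.add_one_le_exp (K * (t - s)))
          (norm_nonneg (BridgelandStab.lerp σ.Z W t (cls v E)))
        rw [hK] at h6 ⊢
        linarith
      have h7 : Real.exp (K * t) = Real.exp (K * (t - s)) * Real.exp (K * s) := by
        rw [← Real.exp_add]; ring_nf
      rw [h7, ← mul_assoc]
      exact mul_le_mul_of_nonneg_right h3 (Real.exp_pos _).le
    have hexp : 1 ≤ Real.exp (K * s) := Real.one_le_exp (by
      have := h.δ_nonneg
      have := h.C_nonneg
      positivity)
    have hmono' := mul_le_mul_of_nonneg_left hmono (by linarith [h.C_nonneg] : 0 ≤ 2 * C)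
    have hdrop : ∀ r r' : ℝ, r + r' = 1 → 1 ≤ 2 * C * (r' * ‖Ws (cls v E)‖) →
        2 * C * (r * ‖Ws (cls v E)‖) * Real.exp (K * s) < m := by
      intro r r' hrr h1
      have e : r = 1 - r' := by linarith
      have h2 : 2 * C * (r * ‖Ws (cls v E)‖) ≤ 2 * C * ‖Ws (cls v E)‖ - 1 := by
        rw [e]
        linarith
      have h3 := mul_le_mul_of_nonneg_right h2 (Real.exp_pos (K * s)).le
      push_cast at hlt
      linarith
    have hQS := ih s hs0 (hst.trans ht') S hSS (by
      rw [hnS]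
      exact hdrop r₁ r₂ hr (hnT ▸ hone T hTS hT0))
    have hQT := ih s hs0 (hst.trans ht') T hTS (by
      rw [hnT]
      exact hdrop r₂ r₁ (by linarith) (hnS ▸ hone S hSS hS0))
    rw [hadd, TensorProduct.tmul_add]
    exact (hker s hs0 (hst.trans ht')).add_nonneg hr₁ hr₂
      (by rw [liftBaseChange_one_tmul]; exact hr₁') (by rw [liftBaseChange_one_tmul]; exact hr₂')
      hQS hQT

theorem supportProperty (h : Deformation σ α W N C δ ε) (hN : ∀ x, x ≠ 0 → 1 ≤ N x)
    {Q : QuadraticForm ℝ (ℝ ⊗[ℤ] Λ)} (hQ : σ.SupportProperty Q)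
    (hker : ∀ t : ℝ, 0 ≤ t → t ≤ 1 → KerNegDef Q (BridgelandStab.lerp σ.Z W t)) :
    h.deform.SupportProperty Q := by
  have hk := hker 1 zero_le_one le_rfl
  rw [lerp_one] at hk
  refine ⟨hk, ?_⟩
  rintro E ⟨φ, hE⟩
  refine h.quadratic_nonneg hN hQ hker (n := ⌈φ - α⌉ - 1) (t := 1) zero_le_one le_rfl ?_
  rw [lerp_one]
  exact hE.1

end Deformation

end Support

/-! ### Nearby stability conditions with equal charges coincide. -/

section LocalInjectivity

variable {D : Type u} [Category.{w} D] [HasZeroObject D] [HasShift D ℤ] [Preadditive D]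
  [∀ n : ℤ, (shiftFunctor D n).Additive] [Pretriangulated D] [IsTriangulated D]
  {Λ : Type*} [AddCommGroup Λ] {v : K₀ D →+ Λ}

namespace PreStabilityCondition

variable {σ τ : PreStabilityCondition v}

theorem imRot_pos {θ a : ℝ} {E : D} (h1 : σ.GT θ E) (h2 : σ.LE a E) (ha : a < θ + 1)
    (hE : ¬ IsZero E) : 0 < imRot θ (σ.Z (cls v E)) := by
  obtain ⟨l, hl⟩ := σ.exists_chain E
  rw [hl.map_cls_eq_sum, linear_sum_map]
  refine sum_map_pos _ _ (fun p hp => (onRay_of_chain hl p hp).imRot_pos (hl.gt_iff.1 h1 p hp)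
    ((hl.le_iff.1 h2 p hp).trans_lt ha)) ?_
  rintro rfl
  exact hE hl.isZero_of_nil

theorem imRot_neg {θ a : ℝ} {E : D} (h1 : σ.GT (θ - 1) E) (h2 : σ.LE a E) (ha : a < θ)
    (hE : ¬ IsZero E) : imRot θ (σ.Z (cls v E)) < 0 := by
  have h := imRot_pos h1 h2 (by linarith) hE
  have h3 := imRot_add_one (θ - 1) (σ.Z (cls v E))
  rw [sub_add_cancel] at h3
  linarith

/-- The phases of all objects with respect to `τ` differ by at most `ε` from those with
respect to `σ`. -/
def PhaseClose (ε : ℝ) (σ τ : PreStabilityCondition v) : Prop :=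
  ∀ a E, (σ.LE a E → τ.LE (a + ε) E) ∧ (σ.GT a E → τ.GT (a - ε) E)

/-- Truncate `E` by `τ`. A nonzero piece on the wrong side of φ has `σ`-phases on one side of a ray
and `τ`-phases strictly on the other, within ranges where the height has a sign; a common charge
cannot satisfy both. -/
theorem P_of_phaseClose {ε : ℝ} (hε : ε ≤ 1 / 8) (hZ : σ.Z = τ.Z) (h : PhaseClose ε σ τ)
    (h' : PhaseClose ε τ σ) {φ : ℝ} {E : D} (hE : σ.P φ E) : τ.P φ E := by
  have hle : σ.LE φ E := .of_mem hE le_rfl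
  have hgt : ∀ a < φ, σ.GT a E := fun a ha => .of_mem hE ha
  have hleτ : τ.LE (φ + 1 / 8) E := ((h φ E).1 hle).mono (by linarith)
  have hgtτ : ∀ a < φ, τ.GT (a - 1 / 8) E := fun a ha => ((h a E).2 (hgt a ha)).anti (by linarith)
  refine mem_of_gt_of_le (fun a₀ ha₀ => ?_) ?_
  · obtain ⟨a, haa, ha'⟩ : ∃ a, a₀ ≤ a ∧ φ - 1 / 4 ≤ a ∧ a < φ :=
      ⟨max a₀ (φ - 1 / 4), le_max_left _ _, le_max_right _ _, max_lt ha₀ (by linarith)⟩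
    obtain ⟨X, Y, t, hX, hY⟩ := τ.exists_trunc a E
    have hX' : σ.GT (a - 1 / 8) X := ((h' a X).2 hX).anti (by linarith)
    have hY' : σ.LE (a + 1 / 8) Y := ((h' a Y).1 hY).mono (by linarith)
    obtain ⟨b, hb1, hb2⟩ := exists_between ha'.2
    have hYσ : σ.GT b Y := .right t (hgt b hb2) (hX'.anti (by linarith))
    have hYτ : τ.GT (b - 1) Y :=
      .right t ((hgtτ b hb2).anti (by linarith)) (hX.anti (by linarith))
    have h0 : IsZero Y := by
      by_contra h0
      have h1 := imRot_nonneg hYσ (hY'.mono (by linarith))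
      have h2 := imRot_neg hYτ hY hb1 h0
      rw [hZ] at h1
      linarith
    exact (GT.ext t hX (.of_isZero h0)).anti haa
  · obtain ⟨X, Y, t, hX, hY⟩ := τ.exists_trunc φ E
    have hX' : σ.GT (φ - 1 / 8) X := ((h' φ X).2 hX).anti (by linarith)
    have hY' : σ.LE (φ + 1 / 8) Y := ((h' φ Y).1 hY).mono (by linarith)
    have hXσ : σ.LE φ X := .left t hle (hY'.mono (by linarith))
    have hXτ : τ.LE (φ + 1 / 8) X := .left t hleτ (hY.mono (by linarith))
    have h0 : IsZero X := by
      by_contra h0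
      have h1 := imRot_nonpos (hX'.anti (by linarith)) hXσ
      have h2 := imRot_pos hX hXτ (by linarith) h0
      rw [hZ] at h1
      linarith
    exact LE.ext t (.of_isZero h0) hY

end PreStabilityCondition

namespace StabilityCondition

open PreStabilityCondition

variable {σ τ : StabilityCondition v}

theorem edist_le_iff {ε : ℝ} (hε : 0 ≤ ε) : edist σ τ ≤ ENNReal.ofReal ε ↔
    ∀ E : {E : D // ¬ IsZero E}, |σ.phiMinus E - τ.phiMinus E| ≤ ε ∧
      |σ.phiPlus E - τ.phiPlus E| ≤ ε ∧ |Real.log (σ.mass E.1) - Real.log (τ.mass E.1)| ≤ ε := by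
  change stabEDist σ τ ≤ _ ↔ _
  simp only [stabEDist, iSup_le_iff, max_le_iff, edist_dist, ENNReal.ofReal_le_ofReal_iff hε,
    Real.dist_eq]

theorem phaseClose_of_edist_le {ε : ℝ} (hε : 0 ≤ ε) (h : edist σ τ ≤ ENNReal.ofReal ε) :
    PhaseClose ε σ.toPreStabilityCondition τ.toPreStabilityCondition := by
  rw [edist_le_iff hε] at h
  intro a E
  by_cases hE : IsZero E
  · exact ⟨fun _ => .of_isZero hE, fun _ => .of_isZero hE⟩
  obtain ⟨h1, h2, -⟩ := h ⟨E, hE⟩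
  rw [abs_le] at h1 h2
  refine ⟨fun hl => (phiPlus_le_iff _ ⟨E, hE⟩ _).1 ?_, fun hl => (lt_phiMinus_iff _ ⟨E, hE⟩ _).1 ?_⟩
  · have := (phiPlus_le_iff _ ⟨E, hE⟩ _).2 hl
    linarith
  · have := (lt_phiMinus_iff _ ⟨E, hE⟩ _).2 hl
    linarith

/-- The forgetful map is injective on small balls. -/
theorem eq_of_edist_le (h : edist σ τ ≤ ENNReal.ofReal (1 / 8)) (hZ : σ.charge = τ.charge) :
    σ = τ := by
  have h1 := phaseClose_of_edist_le (by norm_num) h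
  have h2 := phaseClose_of_edist_le (by norm_num) (edist_comm σ τ ▸ h)
  have hP : σ.P = τ.P := by
    funext φ
    ext E
    exact ⟨P_of_phaseClose le_rfl hZ h1 h2, P_of_phaseClose le_rfl hZ.symm h2 h1⟩
  obtain ⟨⟨Z, P, _, _, _, _, _, _⟩, _⟩ := σ
  obtain ⟨⟨Z', P', _, _, _, _, _, _⟩, _⟩ := τ
  obtain rfl : Z = Z' := hZ
  obtain rfl : P = P' := hP
  rfl

end StabilityCondition

end LocalInjectivity

/-! ### Continuity of the central charge in the generalized metric. -/

section Continuity

open Filter Topology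

variable {D : Type u} [Category.{w} D] [HasZeroObject D] [HasShift D ℤ] [Preadditive D]
  [∀ n : ℤ, (shiftFunctor D n).Additive] [Pretriangulated D] [IsTriangulated D]
  {Λ : Type*} [AddCommGroup Λ] {v : K₀ D →+ Λ}

theorem OnRay.norm_sub_le {φ ψ : ℝ} {z : ℂ} (h : OnRay ψ z) :
    ‖z - ‖z‖ * Complex.exp (Complex.I * Real.pi * φ)‖ ≤ Real.pi * |ψ - φ| * ‖z‖ := by
  obtain ⟨r, hr, rfl⟩ := h
  rw [norm_ray hr.le, ← mul_sub, norm_mul, Complex.norm_real, Real.norm_of_nonneg hr.le,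
    mul_comm r]
  refine mul_le_mul_of_nonneg_right ?_ hr.le
  have e : Complex.exp (Complex.I * Real.pi * ψ) - Complex.exp (Complex.I * Real.pi * φ) =
      Complex.exp ((Real.pi * φ : ℝ) * Complex.I) *
        (Complex.exp (Complex.I * (Real.pi * (ψ - φ) : ℝ)) - 1) := by
    rw [mul_sub, ← Complex.exp_add, mul_one]
    push_cast
    ring_nf
  rw [e, norm_mul, Complex.norm_exp_ofReal_mul_I, one_mul]
  refine Real.norm_exp_I_mul_ofReal_sub_one_le.trans ?_
  rw [norm_mul, Real.norm_of_nonneg Real.pi_pos.le, Real.norm_eq_abs]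

/-- Each factor differs from its norm times exp(iπφ) by a chord no longer than the arc. Thus mass
and extreme phases, the data in the metric, determine the charge approximately. -/
theorem PreStabilityCondition.norm_Z_sub_mass_le (σ : PreStabilityCondition v)
    (E : {E : D // ¬ IsZero E}) {φ ε : ℝ} (h1 : φ - ε ≤ σ.phiMinus E)
    (h2 : σ.phiPlus E ≤ φ + ε) :
    ‖σ.Z (cls v E.1) - σ.mass E.1 * Complex.exp (Complex.I * Real.pi * φ)‖ ≤
      Real.pi * ε * σ.mass E.1 := by
  have hl := (σ.hn E.1).chain
  have h1' : ∀ p ∈ (σ.hn E.1).list, φ - ε ≤ p.1 := fun p hp => le_of_forall_lt fun a ha =>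
    hl.gt_iff.1 ((σ.lt_phiMinus_iff E a).1 (ha.trans_le h1)) p hp
  have h2' := hl.le_iff.1 ((σ.phiPlus_le_iff E _).1 h2)
  rw [hl.map_cls_eq_sum, mass_eq_massList, massList]
  have key : ∀ l : List (ℝ × D), (∀ p ∈ l, OnRay p.1 (σ.Z (cls v p.2)) ∧ |p.1 - φ| ≤ ε) →
      ‖(l.map fun p => σ.Z (cls v p.2)).sum - ((l.map fun p => ‖σ.Z (cls v p.2)‖).sum : ℝ) *
        Complex.exp (Complex.I * Real.pi * φ)‖ ≤
      Real.pi * ε * (l.map fun p => ‖σ.Z (cls v p.2)‖).sum := by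
    intro l
    induction l with
    | nil => simp
    | cons p l ih =>
      intro h
      simp only [List.mem_cons, forall_eq_or_imp] at h
      simp only [List.map_cons, List.sum_cons]
      have i1 := ih h.2
      have i2 := h.1.1.norm_sub_le (φ := φ)
      have i3 : Real.pi * |p.1 - φ| * ‖σ.Z (cls v p.2)‖ ≤ Real.pi * ε * ‖σ.Z (cls v p.2)‖ :=
        mul_le_mul_of_nonneg_right (mul_le_mul_of_nonneg_left h.1.2 Real.pi_pos.le)
          (norm_nonneg _)
      push_cast
      rw [add_mul, add_sub_add_comm, mul_add]
      exact (norm_add_le _ _).trans (add_le_add (i2.trans i3) (by exact_mod_cast i1))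
  refine key _ fun p hp => ⟨onRay_of_chain hl p hp, ?_⟩
  rw [abs_le]
  constructor <;> linarith [h1' p hp, h2' p hp]

theorem PreStabilityCondition.phiMinus_of_mem (σ : PreStabilityCondition v)
    (E : {E : D // ¬ IsZero E}) {φ : ℝ} (h : σ.P φ E.1) : φ ≤ σ.phiMinus E :=
  le_of_forall_lt fun _ ha => (σ.lt_phiMinus_iff E _).2 (.of_mem h ha)

theorem PreStabilityCondition.phiPlus_of_mem (σ : PreStabilityCondition v)
    (E : {E : D // ¬ IsZero E}) {φ : ℝ} (h : σ.P φ E.1) : σ.phiPlus E ≤ φ :=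
  (σ.phiPlus_le_iff E _).2 (.of_mem h le_rfl)

namespace StabilityCondition

open PreStabilityCondition

/-- At `σ` the charge of `E` is exactly the mass times exp(iπφ). Near `σ` the object may cease to be
semistable, but its phases remain within the distance of φ and its mass converges. -/
theorem tendsto_Z_of_mem (σ : StabilityCondition v) {φ : ℝ} {E : D} (hE : σ.P φ E)
    (h0 : ¬ IsZero E) :
    Tendsto (fun τ : StabilityCondition v => τ.Z (cls v E)) (𝓝 σ) (𝓝 (σ.Z (cls v E))) := by
  have hd : Tendsto (fun τ : StabilityCondition v => (edist σ τ).toReal) (𝓝 σ) (𝓝 0) := by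
    have h1 : Tendsto (fun τ : StabilityCondition v => edist σ τ) (𝓝 σ) (𝓝 0) := by
      have : Continuous fun τ : StabilityCondition v => edist σ τ := by fun_prop
      simpa using this.tendsto σ
    simpa [Function.comp_def] using (ENNReal.tendsto_toReal ENNReal.zero_ne_top).comp h1
  have hfin : ∀ᶠ τ : StabilityCondition v in 𝓝 σ, edist σ τ ≠ ⊤ := by
    filter_upwards [Metric.eball_mem_nhds σ (ε := 1) one_pos] with τ hτ
    rw [Metric.mem_eball, edist_comm] at hτ
    exact (hτ.trans ENNReal.one_lt_top).ne
  have hall : ∀ᶠ τ : StabilityCondition v in 𝓝 σ,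
      |σ.phiMinus ⟨E, h0⟩ - τ.phiMinus ⟨E, h0⟩| ≤ (edist σ τ).toReal ∧
      |σ.phiPlus ⟨E, h0⟩ - τ.phiPlus ⟨E, h0⟩| ≤ (edist σ τ).toReal ∧
      |Real.log (σ.mass E) - Real.log (τ.mass E)| ≤ (edist σ τ).toReal := by
    filter_upwards [hfin] with τ hτ
    exact (edist_le_iff ENNReal.toReal_nonneg).1 (ENNReal.ofReal_toReal hτ).ge ⟨E, h0⟩
  have hlog : Tendsto (fun τ : StabilityCondition v => Real.log (τ.mass E)) (𝓝 σ)
      (𝓝 (Real.log (σ.mass E))) := by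
    rw [tendsto_iff_dist_tendsto_zero]
    refine squeeze_zero' (.of_forall fun _ => dist_nonneg) ?_ hd
    filter_upwards [hall] with τ hτ
    rw [dist_comm, Real.dist_eq]
    exact hτ.2.2
  have hmass : Tendsto (fun τ : StabilityCondition v => τ.mass E) (𝓝 σ) (𝓝 (σ.mass E)) := by
    have := (Real.continuous_exp.tendsto _).comp hlog
    simpa [Function.comp_def, Real.exp_log (mass_pos _ h0)] using this
  have hσ := σ.norm_Z_sub_mass_le ⟨E, h0⟩ (φ := φ) (ε := 0)
    (by simpa using phiMinus_of_mem _ ⟨E, h0⟩ hE) (by simpa using phiPlus_of_mem _ ⟨E, h0⟩ hE)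
  simp only [mul_zero, zero_mul, norm_le_zero_iff, sub_eq_zero] at hσ
  rw [hσ]
  have hm : Tendsto (fun τ : StabilityCondition v =>
      (τ.mass E : ℂ) * Complex.exp (Complex.I * Real.pi * φ)) (𝓝 σ)
      (𝓝 (σ.mass E * Complex.exp (Complex.I * Real.pi * φ))) :=
    ((Complex.continuous_ofReal.tendsto _).comp hmass).mul_const _
  have hz : Tendsto (fun τ : StabilityCondition v =>
      τ.Z (cls v E) - τ.mass E * Complex.exp (Complex.I * Real.pi * φ)) (𝓝 σ) (𝓝 0) := by
    refine squeeze_zero_norm' (a := fun τ => Real.pi * (edist σ τ).toReal * τ.mass E) ?_ ?_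
    · filter_upwards [hall] with τ hτ
      have h1 := phiMinus_of_mem _ ⟨E, h0⟩ hE
      have h2 := phiPlus_of_mem _ ⟨E, h0⟩ hE
      obtain ⟨h3, h4, -⟩ := hτ
      rw [abs_le] at h3 h4
      exact τ.norm_Z_sub_mass_le ⟨E, h0⟩ (by linarith) (by linarith)
    · simpa using (hd.const_mul Real.pi).mul hmass
  simpa using hz.add hm

/-- Surjectivity of `v` reduces to classes of objects, and a Harder–Narasimhan filtration for `σ` to
semistable ones. -/
theorem tendsto_Z (hv : Function.Surjective v) (σ : StabilityCondition v) (x : Λ) :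
    Tendsto (fun τ : StabilityCondition v => τ.Z x) (𝓝 σ) (𝓝 (σ.Z x)) := by
  have hobj : ∀ E : D,
      Tendsto (fun τ : StabilityCondition v => τ.Z (cls v E)) (𝓝 σ) (𝓝 (σ.Z (cls v E))) := by
    intro E
    obtain ⟨l, hl⟩ := σ.exists_chain E
    simp only [hl.map_cls_eq_sum]
    have key : ∀ l : List (ℝ × D), (∀ p ∈ l, σ.P p.1 p.2 ∧ ¬ IsZero p.2) →
        Tendsto (fun τ : StabilityCondition v => (l.map fun p => τ.Z (cls v p.2)).sum) (𝓝 σ)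
          (𝓝 (l.map fun p => σ.Z (cls v p.2)).sum) := by
      intro l
      induction l with
      | nil => simp
      | cons p l ih =>
        intro h
        simp only [List.mem_cons, forall_eq_or_imp] at h
        simpa using (σ.tendsto_Z_of_mem h.1.1 h.1.2).add (ih h.2)
    exact key l fun p hp => ⟨hl.mem p hp, hl.ne_zero p hp⟩
  obtain ⟨k, rfl⟩ := hv x
  induction k using QuotientAddGroup.induction_on with
  | H a =>
    induction a using FreeAbelianGroup.induction_on with
    | zero => simp
    | of E => exact hobj E
    | neg E _ =>
      have := (hobj E).neg
      simpa [cls, K₀.of] using this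
    | add a b ha hb => simpa using ha.add hb

theorem continuous_charge (hv : Function.Surjective v) :
    Continuous (charge : StabilityCondition v → _) := by
  rw [continuous_induced_rng, continuous_pi_iff]
  intro x
  exact continuous_iff_continuousAt.2 fun σ => σ.tendsto_Z hv x

end StabilityCondition

end Continuity

/-! ### Boxes of charges and uniform bounds on the cone Q ≥ 0. -/

section Boxes

open Module Filter Topology

variable {ι Λ : Type*} [Fintype ι] [AddCommGroup Λ] (b : Basis ι ℤ Λ)

/-- The `ℓ¹`-norm on a lattice with respect to a basis. -/
def coordNorm : AddGroupSeminorm Λ where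
  toFun x := ∑ i, |(b.repr x i : ℝ)|
  map_zero' := by simp
  add_le' x y := by
    rw [← Finset.sum_add_distrib]
    refine Finset.sum_le_sum fun i _ => ?_
    simpa using abs_add_le (b.repr x i : ℝ) (b.repr y i)
  neg' x := by simp

theorem coordNorm_apply (x : Λ) : coordNorm b x = ∑ i, |(b.repr x i : ℝ)| := rfl

theorem one_le_coordNorm {x : Λ} (hx : x ≠ 0) : 1 ≤ coordNorm b x := by
  obtain ⟨i, hi⟩ : ∃ i, b.repr x i ≠ 0 := by
    by_contra! h
    exact hx (b.repr.map_eq_zero_iff.1 (Finsupp.ext h))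
  refine le_trans ?_ (Finset.single_le_sum (f := fun i => |(b.repr x i : ℝ)|)
    (fun i _ => abs_nonneg _) (Finset.mem_univ i))
  exact_mod_cast Int.one_le_abs hi

theorem finite_coordNorm_le (R : ℝ) : {x | coordNorm b x ≤ R}.Finite := by
  have hfin : (Set.Icc (fun _ : ι => -⌈R⌉) (fun _ => ⌈R⌉)).Finite := by
    classical exact Set.finite_Icc _ _
  refine Set.Finite.subset (hfin.preimage b.equivFun.injective.injOn) fun x hx => ?_
  have key : ∀ i, |b.repr x i| ≤ ⌈R⌉ := fun i => by
    have h1 := (Finset.single_le_sum (f := fun i => |(b.repr x i : ℝ)|)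
      (fun i _ => abs_nonneg _) (Finset.mem_univ i)).trans (hx.trans (Int.le_ceil R))
    exact_mod_cast h1
  exact ⟨fun i => by simpa using (abs_le.1 (key i)).1, fun i => by simpa using (abs_le.1 (key i)).2⟩

/-- The central charges whose real and imaginary parts on the basis are `δ`-close to those
of `Z`. -/
def box (Z : Λ →ₗ[ℤ] ℂ) (δ : ℝ) : Set (Λ →ₗ[ℤ] ℂ) :=
  {W | ∀ i, |(W (b i)).re - (Z (b i)).re| < δ ∧ |(W (b i)).im - (Z (b i)).im| < δ}

theorem mem_box_self (Z : Λ →ₗ[ℤ] ℂ) {δ : ℝ} (hδ : 0 < δ) : Z ∈ box b Z δ := by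
  simp [box, hδ]

theorem box_mono (Z : Λ →ₗ[ℤ] ℂ) {δ δ' : ℝ} (h : δ ≤ δ') : box b Z δ ⊆ box b Z δ' :=
  fun _ hW i => ⟨(hW i).1.trans_le h, (hW i).2.trans_le h⟩

theorem continuous_charge_apply (x : Λ) : Continuous fun Z : Λ →ₗ[ℤ] ℂ => Z x :=
  (continuous_apply x).comp continuous_induced_dom

theorem isOpen_box (Z : Λ →ₗ[ℤ] ℂ) (δ : ℝ) : IsOpen (box b Z δ) := by
  simp only [box, Set.ofPred_forall]
  refine isOpen_iInter_of_finite fun i => ?_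
  have h1 : Continuous fun W : Λ →ₗ[ℤ] ℂ => (W (b i)).re :=
    Complex.continuous_re.comp (continuous_charge_apply (b i))
  have h2 : Continuous fun W : Λ →ₗ[ℤ] ℂ => (W (b i)).im :=
    Complex.continuous_im.comp (continuous_charge_apply (b i))
  exact (isOpen_lt (h1.sub continuous_const).abs continuous_const).inter
    (isOpen_lt (h2.sub continuous_const).abs continuous_const)

theorem box_mem_nhds (Z : Λ →ₗ[ℤ] ℂ) {δ : ℝ} (hδ : 0 < δ) : box b Z δ ∈ 𝓝 Z :=
  (isOpen_box b Z δ).mem_nhds (mem_box_self b Z hδ)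

theorem abs_lerp_sub_lt {x y z δ t : ℝ} (hx : |x - z| < δ) (hy : |y - z| < δ) (h0 : 0 ≤ t)
    (h1 : t ≤ 1) : |x + t * (y - x) - z| < δ := by
  rcases h0.eq_or_lt with rfl | h0
  · simpa using hx
  have e : x + t * (y - x) - z = (1 - t) * (x - z) + t * (y - z) := by ring
  rw [e]
  refine (abs_add_le _ _).trans_lt ?_
  rw [abs_mul, abs_mul, abs_of_pos h0, abs_of_nonneg (sub_nonneg.2 h1)]
  have i1 := mul_le_mul_of_nonneg_left hx.le (sub_nonneg.2 h1)
  have i2 := mul_lt_mul_of_pos_left hy h0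
  linarith

theorem lerp_mem_box {Z₀ Z W : Λ →ₗ[ℤ] ℂ} {δ t : ℝ} (hZ : Z ∈ box b Z₀ δ) (hW : W ∈ box b Z₀ δ)
    (h0 : 0 ≤ t) (h1 : t ≤ 1) : lerp Z W t ∈ box b Z₀ δ := by
  intro i
  have := abs_lerp_sub_lt (hZ i).1 (hW i).1 h0 h1
  have := abs_lerp_sub_lt (hZ i).2 (hW i).2 h0 h1
  simp [lerp_apply]
  constructor <;> assumption

theorem continuous_lerp (Z W : Λ →ₗ[ℤ] ℂ) : Continuous (lerp Z W) := by
  rw [continuous_induced_rng, continuous_pi_iff]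
  intro x
  simp only [Function.comp_def, lerp_apply]
  fun_prop

theorem isPreconnected_box (Z : Λ →ₗ[ℤ] ℂ) (δ : ℝ) : IsPreconnected (box b Z δ) := by
  refine isPreconnected_of_forall_pair fun x hx y hy => ⟨lerp x y '' Set.Icc 0 1, ?_, ?_, ?_, ?_⟩
  · rintro _ ⟨t, ht, rfl⟩
    exact lerp_mem_box b hx hy ht.1 ht.2
  · exact ⟨0, by simp, lerp_zero x y⟩
  · exact ⟨1, by simp, lerp_one x y⟩
  · exact isPreconnected_Icc.image _ (continuous_lerp x y).continuousOn

theorem norm_sub_le_of_mem_box {Z₀ Z : Λ →ₗ[ℤ] ℂ} {δ : ℝ} (hZ : Z ∈ box b Z₀ δ) (i : ι) :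
    ‖Z (b i) - Z₀ (b i)‖ ≤ 2 * δ := by
  refine (Complex.norm_le_abs_re_add_abs_im _).trans ?_
  have := hZ i
  simp only [Complex.sub_re, Complex.sub_im]
  linarith [this.1, this.2]

theorem charge_eq_sum (Z : Λ →ₗ[ℤ] ℂ) (x : Λ) : Z x = ∑ i, (b.repr x i : ℂ) * Z (b i) := by
  conv_lhs => rw [← b.sum_repr x, map_sum]
  exact Finset.sum_congr rfl fun i _ => by rw [map_zsmul, zsmul_eq_mul]

theorem norm_sub_le_coordNorm {Z W : Λ →ₗ[ℤ] ℂ} {δ : ℝ}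
    (h : ∀ i, ‖W (b i) - Z (b i)‖ ≤ δ) (x : Λ) : ‖W x - Z x‖ ≤ δ * coordNorm b x := by
  rw [charge_eq_sum b Z, charge_eq_sum b W, ← Finset.sum_sub_distrib, coordNorm_apply,
    Finset.mul_sum]
  refine (norm_sum_le _ _).trans (Finset.sum_le_sum fun i _ => ?_)
  rw [← mul_sub, norm_mul, mul_comm δ, Complex.norm_intCast]
  exact mul_le_mul_of_nonneg_left (h i) (abs_nonneg _)

theorem liftBaseChange_eq_sum (Z : Λ →ₗ[ℤ] ℂ) (y : ι → ℝ) :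
    Z.liftBaseChange ℝ ((b.baseChange ℝ).equivFun.symm y) = ∑ i, (y i : ℂ) * Z (b i) := by
  simp [Basis.equivFun_symm_apply, map_sum, LinearMap.liftBaseChange_tmul]

theorem continuous_quadraticForm (Q : QuadraticForm ℝ (ι → ℝ)) : Continuous Q := by
  classical
  have h : ∀ y, Q y = ∑ i, y i * QuadraticMap.associated Q (Pi.single i 1) y := by
    intro y
    rw [← QuadraticMap.associated_eq_self_apply ℝ Q y]
    conv_lhs => rw [LinearMap.pi_apply_eq_sum_univ (QuadraticMap.associated Q) y]
    rw [LinearMap.sum_apply]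
    refine Finset.sum_congr rfl fun i _ => ?_
    rw [LinearMap.smul_apply, smul_eq_mul]
    congr 3
    ext j
    simp [Pi.single_apply, eq_comm]
  rw [show (Q : (ι → ℝ) → ℝ) = fun y => _ from funext h]
  refine continuous_finsetSum _ fun i _ => (continuous_apply i).mul ?_
  exact (QuadraticMap.associated Q (Pi.single i 1)).continuous_of_finiteDimensional

/-- The vectors of ℓ¹-norm one with Q ≥ 0 form a compact set that avoids the kernel, so the norm of
the charge has a positive minimum there; scale by homogeneity. -/
theorem KerNegDef.exists_le_norm {Q : QuadraticForm ℝ (ℝ ⊗[ℤ] Λ)} {Z : Λ →ₗ[ℤ] ℂ}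
    (h : KerNegDef Q Z) : ∃ c > 0, ∀ y : ι → ℝ, 0 ≤ Q ((b.baseChange ℝ).equivFun.symm y) →
      c * ∑ i, |y i| ≤ ‖∑ i, (y i : ℂ) * Z (b i)‖ := by
  set e := (b.baseChange ℝ).equivFun.symm
  have hQ : Continuous fun y => Q (e y) := 
    continuous_quadraticForm (Q.comp e.toLinearMap)
  have hN : Continuous fun y : ι → ℝ => ∑ i, |y i| := by fun_prop
  have hZ : Continuous fun y : ι → ℝ => ‖∑ i, (y i : ℂ) * Z (b i)‖ := by fun_prop
  set K : Set (ι → ℝ) := {y | ∑ i, |y i| = 1 ∧ 0 ≤ Q (e y)}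
  have hK : IsCompact K := by
    refine Metric.isCompact_of_isClosed_isBounded
      ((isClosed_eq hN continuous_const).inter (isClosed_le continuous_const hQ)) ?_
    refine (Metric.isBounded_closedBall (x := (0 : ι → ℝ)) (r := 1)).subset fun y hy => ?_
    rw [mem_closedBall_zero_iff, pi_norm_le_iff_of_nonneg zero_le_one]
    intro i
    rw [← hy.1]
    exact Finset.single_le_sum (f := fun i => |y i|) (fun i _ => abs_nonneg _) (Finset.mem_univ i)
  obtain ⟨c, hc, hcK⟩ : ∃ c > 0, ∀ y ∈ K, c ≤ ‖∑ i, (y i : ℂ) * Z (b i)‖ := by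
    rcases K.eq_empty_or_nonempty with h0 | h0
    · exact ⟨1, one_pos, by simp [h0]⟩
    obtain ⟨y, hy, hmin⟩ := hK.exists_isMinOn h0 hZ.continuousOn
    refine ⟨_, norm_pos_iff.2 fun h0 => ?_, fun z hz => hmin hz⟩
    refine absurd hy.2 (not_le.2 (h (e y) ?_ ?_))
    · rw [liftBaseChange_eq_sum, h0]
    · intro h1
      have : y = 0 := e.map_eq_zero_iff.1 h1
      have h2 := hy.1
      simp [this] at h2
  refine ⟨c, hc, fun y hy => ?_⟩
  set s := ∑ i, |y i| with hs
  have hs0 : 0 ≤ s := Finset.sum_nonneg fun i _ => abs_nonneg (y i)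
  rcases hs0.eq_or_lt with h0 | h0
  · rw [← h0, mul_zero]
    exact norm_nonneg _
  have hmem : s⁻¹ • y ∈ K := by
    refine ⟨?_, ?_⟩
    · simp only [Pi.smul_apply, smul_eq_mul, abs_mul, abs_inv, abs_of_pos h0, ← Finset.mul_sum,
        ← hs]
      exact inv_mul_cancel₀ h0.ne'
    · rw [map_smul, QuadraticMap.map_smul]
      exact mul_nonneg (mul_self_nonneg _) hy
  have h1 := hcK _ hmem
  have h2 : ∑ i, (((s⁻¹ • y) i : ℝ) : ℂ) * Z (b i) = (s⁻¹ : ℝ) * ∑ i, (y i : ℂ) * Z (b i) := by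
    rw [Finset.mul_sum]
    refine Finset.sum_congr rfl fun i _ => ?_
    simp [mul_assoc]
  rw [h2, norm_mul, Complex.norm_real, Real.norm_of_nonneg (inv_nonneg.2 h0.le),
    ← div_eq_inv_mul, le_div_iff₀ h0] at h1
  exact h1

/-- Near a central charge with negative definite kernel, central charges have negative definite
kernel and the norm is uniformly controlled on the classes with `Q ≥ 0`. -/
theorem KerNegDef.exists_box {Q : QuadraticForm ℝ (ℝ ⊗[ℤ] Λ)} {Z₀ : Λ →ₗ[ℤ] ℂ}
    (h : KerNegDef Q Z₀) : ∃ c > 0, ∀ Z ∈ box b Z₀ c, KerNegDef Q Z ∧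
      ∀ x : Λ, 0 ≤ Q ((1 : ℝ) ⊗ₜ[ℤ] x) → c * coordNorm b x ≤ ‖Z x‖ := by
  obtain ⟨c, hc, hcQ⟩ := h.exists_le_norm b
  -- In this box each basis value moves by at most c/2, which leaves c/2 of the original bound; c/4
  -- is kept so that one constant serves as radius and as bound.
  have key : ∀ Z ∈ box b Z₀ (c / 4), ∀ y : ι → ℝ, 0 ≤ Q ((b.baseChange ℝ).equivFun.symm y) →
      c / 4 * ∑ i, |y i| ≤ ‖∑ i, (y i : ℂ) * Z (b i)‖ := by
    intro Z hZ y hy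
    have h1 := hcQ y hy
    have h2 : ‖∑ i, (y i : ℂ) * Z₀ (b i) - ∑ i, (y i : ℂ) * Z (b i)‖ ≤ c / 2 * ∑ i, |y i| := by
      rw [← Finset.sum_sub_distrib, Finset.mul_sum]
      refine (norm_sum_le _ _).trans (Finset.sum_le_sum fun i _ => ?_)
      rw [← mul_sub, norm_mul, mul_comm (c / 2), Complex.norm_real, Real.norm_eq_abs, norm_sub_rev]
      refine mul_le_mul_of_nonneg_left ?_ (abs_nonneg _)
      have := norm_sub_le_of_mem_box b hZ i
      linarith
    have h3 := norm_sub_norm_le (∑ i, (y i : ℂ) * Z₀ (b i)) (∑ i, (y i : ℂ) * Z (b i))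
    have h4 : 0 ≤ ∑ i, |y i| := Finset.sum_nonneg fun i _ => abs_nonneg _
    nlinarith
  refine ⟨c / 4, by positivity, fun Z hZ => ⟨fun x hx hx0 => ?_, fun x hx => ?_⟩⟩
  · by_contra! hQ
    obtain ⟨y, rfl⟩ := (b.baseChange ℝ).equivFun.symm.surjective x
    have h1 := key Z hZ y hQ
    rw [liftBaseChange_eq_sum] at hx
    rw [hx, norm_zero] at h1
    have h2 : ∑ i, |y i| ≤ 0 := by
      by_contra! h2
      have : 0 < c / 4 * ∑ i, |y i| := by positivity
      linarith
    have h3 := (Finset.sum_eq_zero_iff_of_nonneg fun i _ => abs_nonneg (y i)).1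
      (le_antisymm h2 (Finset.sum_nonneg fun i _ => abs_nonneg (y i)))
    refine hx0 ?_
    have : y = 0 := funext fun i => abs_eq_zero.1 (h3 i (Finset.mem_univ i))
    rw [this, map_zero]
  · have e : (1 : ℝ) ⊗ₜ[ℤ] x = (b.baseChange ℝ).equivFun.symm fun i => (b.repr x i : ℝ) := by
      rw [LinearEquiv.eq_symm_apply]
      ext i
      simp
    rw [e] at hx
    have := key Z hZ _ hx
    rw [charge_eq_sum b]
    simpa [coordNorm_apply] using this

theorem isOpen_negDefCharges {ι Λ : Type*} [Fintype ι] [AddCommGroup Λ] (b : Basis ι ℤ Λ)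
    (Q : QuadraticForm ℝ (ℝ ⊗[ℤ] Λ)) : IsOpen (negDefCharges Q) := by
  refine isOpen_iff_mem_nhds.2 fun Z hZ => ?_
  obtain ⟨c, hc, h⟩ := KerNegDef.exists_box b hZ
  exact mem_of_superset (box_mem_nhds b Z hc) fun W hW => (h W hW).1

end Boxes

/-! ### Deformations over a box with uniform control. -/

section LocalLift

open Module

variable {D : Type u} [Category.{w} D] [HasZeroObject D] [HasShift D ℤ] [Preadditive D]
  [∀ n : ℤ, (shiftFunctor D n).Additive] [Pretriangulated D] [IsTriangulated D]
  {ι Λ : Type*} [Fintype ι] [AddCommGroup Λ] {v : K₀ D →+ Λ} (b : Basis ι ℤ Λ)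

theorem exists_bound {ε : ℝ} (hε : 0 < ε) (hε' : ε ≤ 1 / 4) :
    ∃ κ > 0, κ < Real.sin (Real.pi * ε) ∧ κ ≤ 1 / 5 ∧ 10 * κ ≤ 1 - Real.exp (-ε) := by
  have hs : 0 < Real.sin (Real.pi * ε) :=
    Real.sin_pos_of_pos_of_lt_pi (by positivity) (by nlinarith [Real.pi_pos])
  have he : Real.exp (-ε) < 1 := by
    rw [← Real.exp_zero]
    exact Real.exp_lt_exp.2 (by linarith)
  refine ⟨min (Real.sin (Real.pi * ε) / 2) (min (1 / 5) ((1 - Real.exp (-ε)) / 10)),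
    lt_min (by linarith) (lt_min (by norm_num) (by linarith)), ?_, ?_, ?_⟩
  · exact (min_le_left _ _).trans_lt (by linarith)
  · exact (min_le_right _ _).trans (min_le_left _ _)
  · have := (min_le_right (Real.sin (Real.pi * ε) / 2) _).trans
      (min_le_right (1 / 5) ((1 - Real.exp (-ε)) / 10))
    linarith

/-- The charge with the real part of `W` and the imaginary part of `Z`. -/
def mixCharge (W Z : Λ →ₗ[ℤ] ℂ) : Λ →ₗ[ℤ] ℂ :=
  AddMonoidHom.toIntLinearMap
    { toFun := fun x => ⟨(W x).re, (Z x).im⟩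
      map_zero' := by simp [Complex.ext_iff]
      map_add' := by simp [Complex.ext_iff] }

@[simp] theorem mixCharge_re (W Z : Λ →ₗ[ℤ] ℂ) (x : Λ) : (mixCharge W Z x).re = (W x).re := rfl

@[simp] theorem mixCharge_im (W Z : Λ →ₗ[ℤ] ℂ) (x : Λ) : (mixCharge W Z x).im = (Z x).im := rfl

namespace StabilityCondition

variable {Q : QuadraticForm ℝ (ℝ ⊗[ℤ] Λ)} {Z₀ : Λ →ₗ[ℤ] ℂ}

/-- Deformations along which one component of the central charge is constant. -/
theorem exists_deform_of_imRot_eq {c κ ε : ℝ} (hc : 0 < c) (hε : 0 < ε) (hε' : ε ≤ 1 / 4)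
    (hκ₁ : κ < Real.sin (Real.pi * ε)) (hκ₂ : κ ≤ 1 / 5)
    (hκ₃ : 10 * κ ≤ 1 - Real.exp (-ε))
    (hbox : ∀ Z ∈ box b Z₀ c, KerNegDef Q Z ∧
      ∀ x : Λ, 0 ≤ Q ((1 : ℝ) ⊗ₜ[ℤ] x) → c * coordNorm b x ≤ ‖Z x‖)
    {δ : ℝ} (hδ0 : 0 < δ) (hδc : δ ≤ c) (hδκ : 4 * δ ≤ κ * c)
    (σ : StabilityCondition v) (hσ : σ.SupportProperty Q) (hσZ : σ.Z ∈ box b Z₀ δ)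
    {W : Λ →ₗ[ℤ] ℂ} (hW : W ∈ box b Z₀ δ) (α : ℝ)
    (him : ∀ x, imRot α (W x) = imRot α (σ.Z x)) :
    ∃ τ : StabilityCondition v, τ.SupportProperty Q ∧ τ.Z = W ∧
      edist σ τ ≤ ENNReal.ofReal ε := by
  have hη : 4 * δ * c⁻¹ ≤ κ := by rwa [← div_eq_mul_inv, div_le_iff₀ hc]
  -- The box bound gives C = c⁻¹. Two charges in the box are each within 2δ of the centre on every
  -- basis vector, hence the 4δ.
  have h : Deformation σ.toPreStabilityCondition α W (coordNorm b) c⁻¹ (4 * δ) ε :=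
    { im_eq := him
      finite := finite_coordNorm_le b
      norm_le := fun φ E hE => by
        rw [← div_eq_inv_mul, le_div_iff₀' hc]
        exact (hbox _ (box_mono b Z₀ hδc hσZ)).2 _ (hσ.2 E ⟨φ, hE⟩)
      close := norm_sub_le_coordNorm b fun i => by
        have h1 := norm_sub_le_of_mem_box b hσZ i
        have h2 := norm_sub_le_of_mem_box b hW i
        rw [norm_sub_rev] at h1
        have := norm_add_le (W (b i) - Z₀ (b i)) (Z₀ (b i) - σ.Z (b i))
        rw [sub_add_sub_cancel] at this
        linarith
      C_nonneg := inv_nonneg.2 hc.le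
      δ_nonneg := by positivity
      ε_pos := hε
      ε_le := hε'
      lt_sin := hη.trans_lt hκ₁
      le_fifth := hη.trans hκ₂ }
  have hsupp : h.deform.SupportProperty Q := by
    refine h.supportProperty (fun x => one_le_coordNorm b) hσ fun t h0 h1 => ?_
    exact (hbox _ (box_mono b Z₀ hδc (lerp_mem_box b hσZ hW h0 h1))).1
  refine ⟨⟨h.deform, Q, hsupp⟩, hsupp, rfl, (edist_le_iff hε.le).2 fun E => ⟨?_, ?_, ?_⟩⟩
  · exact h.abs_phiMinus_sub_le E
  · exact h.abs_phiPlus_sub_le E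
  · exact h.abs_log_mass_sub_le (by linarith) E.2

/-- Stability conditions supported by `Q` deform uniformly along their central charges. -/
theorem exists_deform (hZ₀ : KerNegDef Q Z₀) {ε : ℝ} (hε : 0 < ε) :
    ∃ δ > 0, (∀ Z ∈ box b Z₀ δ, KerNegDef Q Z) ∧ ∀ σ : StabilityCondition v,
      σ.SupportProperty Q → σ.charge ∈ box b Z₀ δ → ∀ W ∈ box b Z₀ δ,
        ∃ τ : StabilityCondition v, τ.SupportProperty Q ∧ τ.charge = W ∧
          edist σ τ ≤ ENNReal.ofReal ε := by
  obtain ⟨c, hc, hbox⟩ := hZ₀.exists_box b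
  -- Half of ε for each of the two moves; 1/4 is the bound required of a deformation.
  set ε' := min (ε / 2) (1 / 4)
  have hε'0 : 0 < ε' := lt_min (by linarith) (by norm_num)
  have hε'1 : ε' ≤ 1 / 4 := min_le_right _ _
  have hε'2 : ε' ≤ ε / 2 := min_le_left _ _
  obtain ⟨κ, hκ0, hκ₁, hκ₂, hκ₃⟩ := exists_bound hε'0 hε'1
  set δ := min c (κ * c / 4)
  have hδ0 : 0 < δ := lt_min hc (by positivity)
  have hδc : δ ≤ c := min_le_left _ _
  have hδκ : 4 * δ ≤ κ * c := by
    have : δ ≤ κ * c / 4 := min_le_right _ _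
    linarith
  refine ⟨δ, hδ0, fun Z hZ => (hbox Z (box_mono b Z₀ hδc hZ)).1, fun σ hσ hσZ W hW => ?_⟩
  replace hσZ : σ.Z ∈ box b Z₀ δ := hσZ
  -- The first move, α = 0, keeps the imaginary part; the second, α = 1/2, keeps the real part. A
  -- box is a product in these coordinates, so the intermediate charge stays inside.
  obtain ⟨τ₁, h1, hZ1, hd1⟩ := exists_deform_of_imRot_eq b hc hε'0 hε'1 hκ₁ hκ₂ hκ₃ hbox
    hδ0 hδc hδκ σ hσ hσZ (W := mixCharge W σ.Z)
    (fun i => ⟨by simpa using (hW i).1, by simpa using (hσZ i).2⟩) 0 (fun x => by simp [imRot_apply])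
  obtain ⟨τ₂, h2, hZ2, hd2⟩ := exists_deform_of_imRot_eq b hc hε'0 hε'1 hκ₁ hκ₂ hκ₃ hbox
    hδ0 hδc hδκ τ₁ h1
    (by rw [hZ1]; exact fun i => ⟨by simpa using (hW i).1, by simpa using (hσZ i).2⟩) hW (1 / 2)
    (fun x => by
      have : Real.cos (Real.pi * (1 / 2)) = 0 := by rw [mul_one_div, Real.cos_pi_div_two]
      rw [imRot_apply, imRot_apply, hZ1, this, mixCharge_re]
      ring)
  refine ⟨τ₂, h2, hZ2, (edist_triangle _ τ₁ _).trans ((add_le_add hd1 hd2).trans ?_)⟩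
  rw [← ENNReal.ofReal_add hε'0.le hε'0.le]
  exact ENNReal.ofReal_le_ofReal (by linarith)

end StabilityCondition

end LocalLift

/-! ### From uniform local lifts to a covering map. -/

section Covering

open Filter Topology

variable {X B : Type*} [PseudoEMetricSpace X] [TopologicalSpace B]

/-- A continuous map `f` that is injective on balls of a uniform radius, and whose restriction
to `S` lifts points locally over `V`, with control on the distance. -/
structure UniformLifting (f : X → B) (S : Set X) (V : Set B) : Prop where
  continuous : Continuous f
  mapsTo : Set.MapsTo f S V
  eq_of_edist_le : ∀ {x y}, edist x y ≤ ENNReal.ofReal (1 / 8) → f x = f y → x = y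
  exists_lift : ∀ z ∈ V, ∀ ε : ℝ, 0 < ε → ∃ W, IsOpen W ∧ z ∈ W ∧ W ⊆ V ∧ IsPreconnected W ∧
    ∀ x ∈ S, f x ∈ W → ∀ w ∈ W, ∃ y ∈ S, f y = w ∧ edist x y ≤ ENNReal.ofReal ε

theorem edist_le_ofReal_add {x y z : X} {a b c : ℝ} (ha : 0 ≤ a) (hb : 0 ≤ b)
    (h1 : edist x y ≤ ENNReal.ofReal a) (h2 : edist y z ≤ ENNReal.ofReal b) (hc : a + b ≤ c) :
    edist x z ≤ ENNReal.ofReal c := by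
  refine (edist_triangle x y z).trans ((add_le_add h1 h2).trans ?_)
  rw [← ENNReal.ofReal_add ha hb]
  exact ENNReal.ofReal_le_ofReal hc

theorem eventually_edist_le (x : X) {ε : ℝ} (hε : 0 < ε) :
    ∀ᶠ y in 𝓝 x, edist x y ≤ ENNReal.ofReal ε := by
  filter_upwards [Metric.eball_mem_nhds x (ENNReal.ofReal_pos.2 hε)] with y hy
  rw [edist_comm]
  exact (Metric.mem_eball.1 hy).le

/-- The family `ℓ` consists of sections over `W` through the points of `T`. -/
structure IsSectionFamily (f : X → B) (T : Set X) (W : Set B) (ℓ : X → B → X) : Prop where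
  continuousOn : ∀ {x}, x ∈ T → f x ∈ W → ContinuousOn (ℓ x) W
  apply_self : ∀ {x}, x ∈ T → f x ∈ W → ℓ x (f x) = x
  mem : ∀ {x}, x ∈ T → f x ∈ W → ∀ {w}, w ∈ W → ℓ x w ∈ T
  map : ∀ {x}, x ∈ T → f x ∈ W → ∀ {w}, w ∈ W → f (ℓ x w) = w
  comp : ∀ {x}, x ∈ T → f x ∈ W → ∀ {w w'}, w ∈ W → w' ∈ W → ℓ (ℓ x w) w' = ℓ x w'
  eq_of_edist_le : ∀ {x x'}, x ∈ T → f x ∈ W → x' ∈ T → f x' ∈ W →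
    edist x x' ≤ ENNReal.ofReal (1 / 32) → ∀ {w}, w ∈ W → ℓ x w = ℓ x' w

/-- Over `W` the trivialization sends `e` to its image and the value at `u` of the section through
`e`; its inverse evaluates sections. Fibres are discrete by injectivity on small balls, and the
fibre component is locally constant because nearby points share a section. -/
theorem isCoveringMap_of_sections {f : X → B} {T : Set X} {U : Set B} (hm : Set.MapsTo f T U)
    (hf : Continuous f)
    (hinj : ∀ x y, edist x y ≤ ENNReal.ofReal (1 / 8) → f x = f y → x = y)
    (h : ∀ u ∈ U, ∃ W, IsOpen W ∧ u ∈ W ∧ W ⊆ U ∧ ∃ ℓ, IsSectionFamily f T W ℓ) :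
    IsCoveringMap (hm.restrict f T U) := by
  rintro ⟨u, hu⟩
  obtain ⟨W, hW, huW, hWU, ℓ, hℓ⟩ := h u hu
  have hgc : Continuous (hm.restrict f T U) := hf.restrict hm
  have hfib : ∀ s : (hm.restrict f T U) ⁻¹' {⟨u, hu⟩}, f s.1.1 = u :=
    fun s => congrArg Subtype.val s.2
  have hfibW : ∀ s : (hm.restrict f T U) ⁻¹' {⟨u, hu⟩}, f s.1.1 ∈ W :=
    fun s => (hfib s).symm ▸ huW
  have hdisc : DiscreteTopology ((hm.restrict f T U) ⁻¹' {⟨u, hu⟩}) := by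
    rw [discreteTopology_iff_isOpen_singleton]
    intro s
    refine isOpen_iff_mem_nhds.2 fun s' hs' => ?_
    obtain rfl : s' = s := hs'
    have hc : Continuous fun t : (hm.restrict f T U) ⁻¹' {⟨u, hu⟩} => (t.1.1 : X) :=
      continuous_subtype_val.comp continuous_subtype_val
    filter_upwards [hc.continuousAt (eventually_edist_le s'.1.1 (ε := 1 / 8) (by norm_num))]
      with t ht
    exact (Subtype.ext (Subtype.ext (hinj _ _ ht ((hfib s').trans (hfib t).symm)))).symm
  refine ⟨hdisc, Subtype.val ⁻¹' W, huW, hW.preimage continuous_subtype_val,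
    (hW.preimage continuous_subtype_val).preimage hgc,
    { toFun := fun e => (⟨hm.restrict f T U e.1, e.2⟩,
        ⟨⟨ℓ e.1.1 u, hℓ.mem e.1.2 e.2 huW⟩, Subtype.ext (hℓ.map e.1.2 e.2 huW)⟩)
      invFun := fun p => ⟨⟨ℓ p.2.1.1 p.1.1.1, hℓ.mem p.2.1.2 (hfibW p.2) p.1.2⟩, by
        change f (ℓ p.2.1.1 p.1.1.1) ∈ W
        rw [hℓ.map p.2.1.2 (hfibW p.2) p.1.2]
        exact p.1.2⟩
      left_inv := fun e => ?_
      right_inv := fun p => ?_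
      continuous_toFun := ?_
      continuous_invFun := ?_ }, fun _ => rfl⟩
  · refine Subtype.ext (Subtype.ext ?_)
    change ℓ (ℓ e.1.1 u) (f e.1.1) = e.1.1
    exact (hℓ.comp e.1.2 e.2 huW e.2).trans (hℓ.apply_self e.1.2 e.2)
  · refine Prod.ext (Subtype.ext (Subtype.ext ?_)) (Subtype.ext (Subtype.ext ?_))
    · exact hℓ.map p.2.1.2 (hfibW p.2) p.1.2
    · change ℓ (ℓ p.2.1.1 p.1.1.1) u = p.2.1.1
      rw [hℓ.comp p.2.1.2 (hfibW p.2) p.1.2 huW]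
      exact (congrArg _ (hfib p.2).symm).trans (hℓ.apply_self p.2.1.2 (hfibW p.2))
  · refine Continuous.prodMk ((hgc.comp continuous_subtype_val).subtype_mk _)
      (IsLocallyConstant.continuous ((IsLocallyConstant.iff_eventually_eq _).2 fun e => ?_))
    have hc : Continuous fun t : hm.restrict f T U ⁻¹' (Subtype.val ⁻¹' W) => (t.1.1 : X) :=
      continuous_subtype_val.comp continuous_subtype_val
    filter_upwards [hc.continuousAt (eventually_edist_le e.1.1 (ε := 1 / 32) (by norm_num))]
      with t ht
    exact Subtype.ext (Subtype.ext (hℓ.eq_of_edist_le e.1.2 e.2 t.1.2 t.2 ht huW).symm)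
  · rw [continuous_prod_of_discrete_right]
    intro s
    refine Continuous.subtype_mk (Continuous.subtype_mk ?_ _) _
    exact (hℓ.continuousOn s.1.2 (hfibW s)).comp_continuous
      (continuous_subtype_val.comp continuous_subtype_val) fun w => w.2

namespace UniformLifting

variable {f : X → B} {S : Set X} {V : Set B}

/-- A point near x ∈ S agrees with the lift in `S`, close to x, of its image: both are near x and
over the same point. -/
theorem isOpen (h : UniformLifting f S V) : IsOpen S := by
  refine isOpen_iff_mem_nhds.2 fun x hx => ?_
  obtain ⟨W, hW, hxW, -, -, hl⟩ := h.exists_lift (f x) (h.mapsTo hx) (1 / 16) (by norm_num)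
  filter_upwards [h.continuous.continuousAt (hW.mem_nhds hxW),
    eventually_edist_le x (ε := 1 / 16) (by norm_num)] with x' hx' hd
  obtain ⟨y, hy, hfy, hxy⟩ := hl x hx hxW (f x') hx'
  rw [edist_comm] at hd
  have := h.eq_of_edist_le (edist_le_ofReal_add (by norm_num) (by norm_num) hd hxy (by norm_num))
    hfy.symm
  rwa [this]

/-- The lift now goes the other way: a nearby point of `S` would lift f(x) to a point of `S` close
to x, which would be x itself. Uniformity of the lifting neighbourhood over `S` is essential here.
-/
theorem isOpen_diff (h : UniformLifting f S V) : IsOpen (f ⁻¹' V \ S) := by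
  refine isOpen_iff_mem_nhds.2 fun x hx => ?_
  obtain ⟨W, hW, hxW, hWV, -, hl⟩ := h.exists_lift (f x) hx.1 (1 / 16) (by norm_num)
  filter_upwards [h.continuous.continuousAt (hW.mem_nhds hxW),
    eventually_edist_le x (ε := 1 / 16) (by norm_num)] with x' hx' hd
  refine ⟨hWV hx', fun hxS => hx.2 ?_⟩
  obtain ⟨y, hy, hfy, hxy⟩ := hl x' hxS hx' (f x) hxW
  have := h.eq_of_edist_le (edist_le_ofReal_add (by norm_num) (by norm_num) hd hxy (by norm_num))
    hfy.symm
  rwa [this]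

theorem subset_of_isPreconnected (h : UniformLifting f S V) {T : Set X} (hT : IsPreconnected T)
    (hTV : T ⊆ f ⁻¹' V) {x : X} (hx : x ∈ T) (hxS : x ∈ S) : T ⊆ S :=
  hT.subset_left_of_subset_union h.isOpen h.isOpen_diff Set.disjoint_sdiff_right
    (fun y hy => (em (y ∈ S)).imp id fun hyS => ⟨hTV hy, hyS⟩) ⟨x, hx, hxS⟩

/-- Local sections of `f` through all points of `S` over a common neighbourhood. -/
theorem exists_section (h : UniformLifting f S V) {u : B} (hu : u ∈ V) :
    ∃ W, IsOpen W ∧ u ∈ W ∧ W ⊆ V ∧ IsPreconnected W ∧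
      ∃ ℓ, IsSectionFamily f S W ℓ := by
  obtain ⟨W, hW, huW, hWV, hWc, hl⟩ := h.exists_lift u hu (1 / 32) (by norm_num)
  choose! ℓ hS hf hd using hl
  -- A lift at distance 1/32 from x equals any other lift within 1/16, as 1/32 + 1/16 < 1/8. This
  -- one uniqueness statement yields all the section axioms.
  have huniq : ∀ x ∈ S, f x ∈ W → ∀ w ∈ W, ∀ y, f y = w → edist x y ≤ ENNReal.ofReal (1 / 16) →
      ℓ x w = y := fun x hx hxW w hw y hy hxy =>
    h.eq_of_edist_le (edist_le_ofReal_add (by norm_num) (by norm_num)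
      ((edist_comm _ _).trans_le (hd x hx hxW w hw)) hxy (by norm_num))
      ((hf x hx hxW w hw).trans hy.symm)
  refine ⟨W, hW, huW, hWV, hWc, ℓ, fun {x} hx hxW w hw => ?_, fun {x} hx hxW => ?_,
    fun {x} hx hxW {w} hw => hS x hx hxW w hw, fun {x} hx hxW {w} hw => hf x hx hxW w hw,
    fun {x} hx hxW {w w'} hw hw' => ?_, fun {x x'} hx hxW hx' hxW' hxx {w} hw => ?_⟩
  · refine ContinuousAt.continuousWithinAt ?_
    rw [ContinuousAt, EMetric.tendsto_nhds]
    intro ε hε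
    obtain ⟨ε', hε'0, hε'⟩ : ∃ ε' : ℝ, 0 < ε' ∧ ε' ≤ 1 / 32 ∧ ENNReal.ofReal ε' < ε := by
      rcases eq_or_ne ε ⊤ with rfl | ht
      · exact ⟨1 / 32, by norm_num, le_rfl, ENNReal.ofReal_lt_top⟩
      have h0 : 0 < ε.toReal := ENNReal.toReal_pos hε.ne' ht
      refine ⟨min (1 / 32) (ε.toReal / 2), lt_min (by norm_num) (by linarith), min_le_left _ _, ?_⟩
      rw [ENNReal.ofReal_lt_iff_lt_toReal (lt_min (by norm_num) (by linarith)).le ht]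
      exact (min_le_right _ _).trans_lt (by linarith)
    -- Continuity at `w`: lifting from `ℓ x w` at the finer scale ε' gives a point close to it,
    -- which uniqueness identifies with the section.
    obtain ⟨W', hW', hwW', -, -, hl'⟩ := h.exists_lift w (hWV hw) ε' hε'0
    filter_upwards [hW'.mem_nhds hwW', hW.mem_nhds hw] with w' hw' hw'W
    obtain ⟨y, hy, hfy, hdy⟩ := hl' (ℓ x w) (hS x hx hxW w hw) (by rwa [hf x hx hxW w hw]) w' hw'
    rw [huniq x hx hxW w' hw'W y hfy (edist_le_ofReal_add (by norm_num) hε'0.le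
      (hd x hx hxW w hw) hdy (by linarith [hε'.1])), edist_comm]
    exact hdy.trans_lt hε'.2
  · exact huniq x hx hxW _ hxW x rfl (by simp)
  · refine huniq _ (hS x hx hxW w hw) (by rwa [hf x hx hxW w hw]) w' hw' _ (hf x hx hxW w' hw') ?_
    exact edist_le_ofReal_add (by norm_num) (by norm_num)
      ((edist_comm _ _).trans_le (hd x hx hxW w hw)) (hd x hx hxW w' hw') (by norm_num)
  · exact huniq x hx hxW w hw _ (hf x' hx' hxW' w hw) (edist_le_ofReal_add (by norm_num)
      (by norm_num) hxx (hd x' hx' hxW' w hw) (by norm_num))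

/-- Sections over preconnected sets do not leave connected components. -/
theorem section_mem {f : X → B} {U W : Set B} {ℓ : B → X} {x₀ x : X}
    (hx : x ∈ connectedComponentIn (f ⁻¹' U) x₀) (hWU : W ⊆ U) (hW : IsPreconnected W)
    (hℓ : ContinuousOn ℓ W) (hfℓ : ∀ w ∈ W, f (ℓ w) = w) (hxW : f x ∈ W) (hℓx : ℓ (f x) = x)
    {w : B} (hw : w ∈ W) : ℓ w ∈ connectedComponentIn (f ⁻¹' U) x₀ := by
  rw [connectedComponentIn_eq hx]
  refine (hW.image ℓ hℓ).subset_connectedComponentIn ⟨f x, hxW, hℓx⟩ ?_ ⟨w, hw, rfl⟩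
  rintro _ ⟨w, hw, rfl⟩
  rw [Set.mem_preimage, hfℓ w hw]
  exact hWU hw

/-- Preconnected neighbourhoods and their section images cannot leave components, so the sections
restrict to `𝒰` over `U`. The image of `𝒰` and its complement in `U` are then both open, and `U` is
connected, which gives surjectivity. -/
theorem isCoveringMap_and_surjective (h : UniformLifting f S V) {x₀ : X} (hx₀ : x₀ ∈ S)
    (hm : Set.MapsTo f (connectedComponentIn (f ⁻¹' connectedComponentIn V (f x₀)) x₀)
      (connectedComponentIn V (f x₀))) :
    IsCoveringMap (hm.restrict f _ _) ∧ Function.Surjective (hm.restrict f _ _) := by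
  set U := connectedComponentIn V (f x₀) with hU
  set 𝒰 := connectedComponentIn (f ⁻¹' U) x₀ with h𝒰
  have hUV : U ⊆ V := connectedComponentIn_subset _ _
  have hfx₀ : f x₀ ∈ U := mem_connectedComponentIn (h.mapsTo hx₀)
  have hx₀' : x₀ ∈ 𝒰 := mem_connectedComponentIn hfx₀
  have h𝒰S : 𝒰 ⊆ S := h.subset_of_isPreconnected isPreconnected_connectedComponentIn
    (fun x hx => hUV (hm hx)) hx₀' hx₀
  have key : ∀ u ∈ U, ∃ W, IsOpen W ∧ u ∈ W ∧ W ⊆ U ∧ ∃ ℓ, IsSectionFamily f 𝒰 W ℓ := by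
    intro u hu
    obtain ⟨W, hW, huW, hWV, hWc, ℓ, hℓ⟩ := h.exists_section (hUV hu)
    have hWU : W ⊆ U := by
      rw [hU, connectedComponentIn_eq hu]
      exact hWc.subset_connectedComponentIn huW hWV
    exact ⟨W, hW, huW, hWU, ℓ,
      { continuousOn := fun hx => hℓ.continuousOn (h𝒰S hx)
        apply_self := fun hx => hℓ.apply_self (h𝒰S hx)
        mem := fun hx hxW _ hw => section_mem hx hWU hWc (hℓ.continuousOn (h𝒰S hx) hxW)
          (fun _ => hℓ.map (h𝒰S hx) hxW) hxW (hℓ.apply_self (h𝒰S hx) hxW) hw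
        map := fun hx => hℓ.map (h𝒰S hx)
        comp := fun hx => hℓ.comp (h𝒰S hx)
        eq_of_edist_le := fun hx hxW hx' => hℓ.eq_of_edist_le (h𝒰S hx) hxW (h𝒰S hx') }⟩
  constructor
  · exact isCoveringMap_of_sections hm h.continuous (fun _ _ => h.eq_of_edist_le) key
  · have hpre : IsPreconnected U := isPreconnected_connectedComponentIn
    have ho1 : IsOpen (f '' 𝒰) := by
      refine isOpen_iff_mem_nhds.2 ?_
      rintro _ ⟨x, hx, rfl⟩
      obtain ⟨W, hW, huW, hWU, ℓ, hℓ⟩ := key (f x) (hm hx)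
      filter_upwards [hW.mem_nhds huW] with w hw
      exact ⟨_, hℓ.mem hx huW hw, hℓ.map hx huW hw⟩
    have ho2 : IsOpen (U \ f '' 𝒰) := by
      refine isOpen_iff_mem_nhds.2 fun u hu => ?_
      obtain ⟨W, hW, huW, hWU, ℓ, hℓ⟩ := key u hu.1
      filter_upwards [hW.mem_nhds huW] with w hw
      refine ⟨hWU hw, ?_⟩
      rintro ⟨x, hx, rfl⟩
      exact hu.2 ⟨_, hℓ.mem hx hw huW, hℓ.map hx hw huW⟩
    have hsub := hpre.subset_left_of_subset_union ho1 ho2 Set.disjoint_sdiff_right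
      (fun y hy => (em (y ∈ f '' 𝒰)).imp id fun hyS => ⟨hy, hyS⟩) ⟨f x₀, hfx₀, x₀, hx₀', rfl⟩
    rintro ⟨u, hu⟩
    obtain ⟨x, hx, hxu⟩ := hsub hu
    exact ⟨⟨x, hx⟩, Subtype.ext hxu⟩

end UniformLifting

end Covering

/-! ### The forgetful map satisfies the lifting axioms. -/

section Charge

variable {D : Type u} [Category.{w} D] [HasZeroObject D] [HasShift D ℤ] [Preadditive D]
  [∀ n : ℤ, (shiftFunctor D n).Additive] [Pretriangulated D] [IsTriangulated D]
  {ι Λ : Type*} [Fintype ι] [AddCommGroup Λ] {v : K₀ D →+ Λ}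

/-- The lifting set is the whole locus supported by `Q`; that the component of `σ` lies in it is a
consequence, and is the second assertion of the theorem. -/
theorem StabilityCondition.uniformLifting_charge (b : Module.Basis ι ℤ Λ)
    (hv : Function.Surjective v) (Q : QuadraticForm ℝ (ℝ ⊗[ℤ] Λ)) :
    UniformLifting (charge : StabilityCondition v → _) {σ | σ.SupportProperty Q}
      (negDefCharges Q) where
  continuous := continuous_charge hv
  mapsTo _ hσ := hσ.1
  eq_of_edist_le := eq_of_edist_le
  exists_lift Z hZ ε hε := by
    obtain ⟨δ, hδ, h1, h2⟩ := exists_deform (v := v) b hZ hε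
    exact ⟨box b Z δ, isOpen_box b Z δ, mem_box_self b Z hδ, h1, isPreconnected_box b Z δ, h2⟩

end Charge

end BridgelandStab

end

open BridgelandStab in
theorem mainTheorem8
    {D : Type*} [Category D] [HasZeroObject D] [HasShift D ℤ] [Preadditive D]
    [∀ n : ℤ, (shiftFunctor D n).Additive] [Pretriangulated D] [IsTriangulated D]
    {Λ : Type*} [AddCommGroup Λ] [Module.Free ℤ Λ] [Module.Finite ℤ Λ]
    (v : K₀ D →+ Λ) (hv : Function.Surjective v)
    (σ : StabilityCondition v) (Q : QuadraticForm ℝ (ℝ ⊗[ℤ] Λ))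
    (hσ : σ.SupportProperty Q) :
    IsOpen (negDefCharges Q) ∧
    (IsCoveringMap ((σ.mapsTo_charge Q).restrict StabilityCondition.charge
        (σ.stabComponent Q) (σ.chargeComponent Q)) ∧
      Function.Surjective ((σ.mapsTo_charge Q).restrict StabilityCondition.charge
        (σ.stabComponent Q) (σ.chargeComponent Q))) ∧
    ∀ τ ∈ σ.stabComponent Q, τ.SupportProperty Q := by
  have b := Module.Free.chooseBasis ℤ Λ
  have h := StabilityCondition.uniformLifting_charge b hv Q
  refine ⟨isOpen_negDefCharges b Q, h.isCoveringMap_and_surjective hσ (σ.mapsTo_charge Q), ?_⟩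
  refine h.subset_of_isPreconnected isPreconnected_connectedComponentIn (x := σ) ?_ ?_ hσ
  · exact fun τ hτ => connectedComponentIn_subset (negDefCharges Q) σ.charge (σ.mapsTo_charge Q hτ)
  · exact mem_connectedComponentIn (mem_connectedComponentIn hσ.1)
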